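/- Let $\tau_{11},\tau_{22},\tau_{12}\in\mathbb C$ with $\mathrm{Im}\,\tau_{11}>0$, $\mathrm{Im}\,\tau_{22}>0$, $(\mathrm{Im}\,\tau_{11})(\mathrm{Im}\,\tau_{22})-(\mathrm{Im}\,\tau_{12})^2>0$. For real $a,b,c,d$ put $$\vartheta\left[\begin{smallmatrix}a&c\\b&d\end{smallmatrix}\right](x,y)=\sum_{m,n\in\mathbb Z}\exp\Big\{\pi i\big(\tau_{11}(m+\tfrac a2)^2+\tau_{22}(n+\tfrac c2)^2+2\tau_{12}(m+\tfrac a2)(n+\tfrac c2)\big)+2\pi i\big((m+\tfrac a2)(x+\tfrac b2)+(n+\tfrac c2)(y+\tfrac d2)\big)\Big\},$$ and let $\Theta[\cdot]$ be the same series with $2\tau_{ij}$ in place of $\tau_{ij}$. Write $P_0,P_1,P_2,P_3$ for $\vartheta\left[\begin{smallmatrix}0&0\\b&d\end{smallmatrix}\right]$ with $(b,d)=(1,1),(0,1),(1,0),(0,0)$, and $S_0,S_1,S_2,S_3$ for $\vartheta\left[\begin{smallmatrix}1&1\\b&d\end{smallmatrix}\right]$ with the same $(b,d)$. Let $p=S_1/P_1$,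 $q=S_2/P_2$ as functions of $(u,v)\in\mathbb C^2$. Let $t,\mathsf u,\mathsf v,w$ be the constants $\Theta\left[\begin{smallmatrix}a&c\\0&0\end{smallmatrix}\right](0,0)$ with $(a,c)=(0,0),(1,0),(0,1),(1,1)$. Assume that $t^2-w^2$, $\mathsf u^2-\mathsf v^2$, $t\mathsf u\pm\mathsf vw$, $t\mathsf v\pm\mathsf uw$, $t^2+\mathsf u^2-\mathsf v^2-w^2$ and $t^2-\mathsf u^2+\mathsf v^2-w^2$ are all nonzero. Define $$E=\frac{t^2\mathsf u^2+t^2\mathsf v^2+\mathsf u^2w^2+\mathsf v^2w^2+4t\mathsf u\mathsf vw}{2(t\mathsf u+\mathsf vw)(t\mathsf v+\mathsf uw)},\qquad C=\frac{t^2\mathsf u^2+t^2\mathsf v^2+\mathsf u^2w^2+\mathsf v^2w^2-4t\mathsf u\mathsf vw}{2(t\mathsf u-\mathsf vw)(t\mathsf v-\mathsf uw)},$$ $$F=\frac{t^4+\mathsf u^4+\mathsf v^4+w^4-2t^2w^2-2\mathsf u^2\mathsf v^2}{(t^2+\mathsf u^2-\mathsf v^2-w^2)(t^2-\mathsf u^2+\mathsf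 v^2-w^2)},$$ $$D=\frac{(t^2-w^2)^2(\mathsf u^2-\mathsf v^2)^2\cdot\left(-\tfrac12 P_3P_0S_3S_0(0,0)\right)}{(t^2+\mathsf u^2-\mathsf v^2-w^2)(t^2-\mathsf u^2+\mathsf v^2-w^2)(t^2\mathsf u^2-\mathsf v^2w^2)(t^2\mathsf v^2-\mathsf u^2w^2)},$$ $$R=\frac{(t^2-w^2)^2(\mathsf u^2-\mathsf v^2)^2}{4(t^2\mathsf u^2-\mathsf v^2w^2)(t^2\mathsf v^2-\mathsf u^2w^2)},\quad b=\frac{CF-E}{R},\quad b_1=\frac DR,\quad E_1=\frac{C-E-D}{F-1},\quad E_2=\frac{C+E-D}{F+1},$$ $$m=\frac{E+1}{E-1},\quad m_1=\frac{E_1+1}{E_1-1},\quad m_2=\frac{E_2+1}{E_2-1},\qquad f_5(x)=x(1-x)(1-mx)(1-m_1x)(1-m_2x).$$ Put $\Theta_{\pm\pm}=\Theta\left[\begin{smallmatrix}\pm1/2&\pm1/2\\0&0\end{smallmatrix}\right]$, let $(\alpha,\gamma)$ be the gradient at $(0,0)$ of $\Theta_{++}-\Theta_{--}$ and $(\beta,\delta)$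 that of $\Theta_{+-}-\Theta_{-+}$, and let $$\mu=\frac{-i(\beta u+\delta v)}{\Theta_{+-}(0,0)},\qquad \nu=\frac{i(\alpha u+\gamma v)}{\Theta_{++}(0,0)}.$$ Then $m,m_1,m_2$ are pairwise distinct and different from $0$ and $1$ (so $y^2=f_5(x)$ has genus two), and there are constants $\kappa_1,\kappa_2$ with $$\kappa_1^2=4(b+b_1)\frac{(1-E)(1-E_1)}{(F+1)(1-E_2)},\qquad \kappa_2^2=4(b-b_1)\frac{(1-E)(1-E_2)}{(F-1)(1-E_1)}$$ such that, with $\hat\mu=\kappa_1\nu$ and $\hat\nu=\kappa_2\mu$, the following holds. The linear map $(u,v)\mapsto(U_1,U_2)=\Big(\dfrac{m_1\hat\mu-m_2\hat\nu}{m_1-m_2},\dfrac{\hat\mu-\hat\nu}{m_1-m_2}\Big)$ of $\mathbb C^2$ is invertible. Let $\Delta(s)^2=1-2Es^2+s^4$, let $V\subseteq\mathbb C^2$ be open, let $\Delta(p)\Delta(q)$ denote any holomorphic function on $V$ whose square is $\Delta(p)^2\Delta(q)^2$, and put $$x=\frac{E(1+p^2q^2)-(p^2+q^2)-\Delta(p)\Delta(q)}{(E+1)(pq+1)^2},\qquad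 x'=\frac{E(1+p^2q^2)-(p^2+q^2)+\Delta(p)\Delta(q)}{(E+1)(pq+1)^2}.$$ Suppose that $P_1,P_2,1+pq,\Delta(p)\Delta(q),f_5(x),f_5(x')$ have no zero on $V$. Then $x,x'$ are holomorphic on $V$, and for suitable holomorphic branches of $\sqrt{f_5(x)}$ and $\sqrt{f_5(x')}$ on $V$ $$\frac{(1-m_2x)\,dx}{\sqrt{f_5(x)}}+\frac{(1-m_2x')\,dx'}{\sqrt{f_5(x')}}=d\hat\mu,\qquad \frac{(1-m_1x)\,dx}{\sqrt{f_5(x)}}+\frac{(1-m_1x')\,dx'}{\sqrt{f_5(x')}}=d\hat\nu.$$ As functions of $(U_1,U_2)$, $x$ and $x'$ satisfy, for suitable holomorphic branches of the roots, the standard Jacobi inversion system $$\frac{dx}{\sqrt{f_5(x)}}+\frac{dx'}{\sqrt{f_5(x')}}=dU_1,\qquad \frac{x\,dx}{\sqrt{f_5(x)}}+\frac{x'\,dx'}{\sqrt{f_5(x')}}=dU_2,$$ and its symmetric functions $\wp_{22}(U_1,U_2):=x+x'$ and $\wp_{12}(U_1,U_2):=-xx'$ are $$\wp_{22}=\frac{2\left(E(1+p^2q^2)-(p^2+q^2)\right)}{(E+1)(1+pq)^2}=\frac{2E}{E+1}-\frac{2(p^2+q^2+2Epq)}{(E+1)(1+pq)^2},\qquad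 \wp_{12}=-\frac{E-1}{E+1}+\frac{4(E-1)pq}{(E+1)(1+pq)^2},$$ where $p,q$ are taken at the point $(u,v)$ that corresponds to $(U_1,U_2)$. -/

import Mathlib

open Complex

/-- A point of the Siegel upper half space of degree two: the entries of a symmetric complex
`2 × 2` matrix with positive definite imaginary part. -/
structure Period where
  τ₁₁ : ℂ
  τ₂₂ : ℂ
  τ₁₂ : ℂ
  im_pos₁₁ : 0 < τ₁₁.im
  im_pos₂₂ : 0 < τ₂₂.im
  im_det_pos : 0 < τ₁₁.im * τ₂₂.im - τ₁₂.im ^ 2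

/-- The two-variable theta series with characteristic `[a c; b d]` and period entries
`τ₁₁`, `τ₂₂`, `τ₁₂`, at the point `z = (x, y)`. -/
noncomputable def thetaSeries (τ₁₁ τ₂₂ τ₁₂ : ℂ) (a c b d : ℝ) (z : ℂ × ℂ) : ℂ :=
  ∑' k : ℤ × ℤ, exp
    (Real.pi * I * (τ₁₁ * ((k.1 : ℂ) + a / 2) ^ 2 + τ₂₂ * ((k.2 : ℂ) + c / 2) ^ 2
        + 2 * τ₁₂ * ((k.1 : ℂ) + a / 2) * ((k.2 : ℂ) + c / 2))
      + 2 * Real.pi * I * (((k.1 : ℂ) + a / 2) * (z.1 + b / 2)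
        + ((k.2 : ℂ) + c / 2) * (z.2 + d / 2)))

namespace Period

variable (τ : Period)

/-- The theta function `ϑ[a c; b d](u, v)` of the period matrix. -/
noncomputable def theta (a c b d : ℝ) (z : ℂ × ℂ) : ℂ :=
  thetaSeries τ.τ₁₁ τ.τ₂₂ τ.τ₁₂ a c b d z

/-- The theta function `Θ[a c; b d](u, v)` of twice the period matrix. -/
noncomputable def bigTheta (a c b d : ℝ) (z : ℂ × ℂ) : ℂ :=
  thetaSeries (2 * τ.τ₁₁) (2 * τ.τ₂₂) (2 * τ.τ₁₂) a c b d z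

noncomputable def P₀ (z : ℂ × ℂ) : ℂ := τ.theta 0 0 1 1 z
noncomputable def P₁ (z : ℂ × ℂ) : ℂ := τ.theta 0 0 0 1 z
noncomputable def P₂ (z : ℂ × ℂ) : ℂ := τ.theta 0 0 1 0 z
noncomputable def P₃ (z : ℂ × ℂ) : ℂ := τ.theta 0 0 0 0 z
noncomputable def S₀ (z : ℂ × ℂ) : ℂ := τ.theta 1 1 1 1 z
noncomputable def S₁ (z : ℂ × ℂ) : ℂ := τ.theta 1 1 0 1 z
noncomputable def S₂ (z : ℂ × ℂ) : ℂ := τ.theta 1 1 1 0 z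
noncomputable def S₃ (z : ℂ × ℂ) : ℂ := τ.theta 1 1 0 0 z

/-- `p = S₁ / P₁`. -/
noncomputable def p (z : ℂ × ℂ) : ℂ := τ.S₁ z / τ.P₁ z

/-- `q = S₂ / P₂`. -/
noncomputable def q (z : ℂ × ℂ) : ℂ := τ.S₂ z / τ.P₂ z

/-! The theta constants `t, u, v, w`. -/

noncomputable def t : ℂ := τ.bigTheta 0 0 0 0 (0, 0)
noncomputable def u : ℂ := τ.bigTheta 1 0 0 0 (0, 0)
noncomputable def v : ℂ := τ.bigTheta 0 1 0 0 (0, 0)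
noncomputable def w : ℂ := τ.bigTheta 1 1 0 0 (0, 0)

/-- None of the theta constants by which the parameters below are divided vanishes. -/
structure Nondegenerate : Prop where
  tw : τ.t ^ 2 - τ.w ^ 2 ≠ 0
  uv : τ.u ^ 2 - τ.v ^ 2 ≠ 0
  tuvw_add : τ.t * τ.u + τ.v * τ.w ≠ 0
  tuvw_sub : τ.t * τ.u - τ.v * τ.w ≠ 0
  tvuw_add : τ.t * τ.v + τ.u * τ.w ≠ 0
  tvuw_sub : τ.t * τ.v - τ.u * τ.w ≠ 0
  sq_one : τ.t ^ 2 + τ.u ^ 2 - τ.v ^ 2 - τ.w ^ 2 ≠ 0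
  sq_two : τ.t ^ 2 - τ.u ^ 2 + τ.v ^ 2 - τ.w ^ 2 ≠ 0

/-! The coefficients of the Kummer quartic relation between `P₁, S₁, P₂, S₂`. -/

noncomputable def E : ℂ :=
  (τ.t ^ 2 * τ.u ^ 2 + τ.t ^ 2 * τ.v ^ 2 + τ.u ^ 2 * τ.w ^ 2 + τ.v ^ 2 * τ.w ^ 2
      + 4 * τ.t * τ.u * τ.v * τ.w)
    / (2 * (τ.t * τ.u + τ.v * τ.w) * (τ.t * τ.v + τ.u * τ.w))

noncomputable def F : ℂ :=
  (τ.t ^ 4 + τ.u ^ 4 + τ.v ^ 4 + τ.w ^ 4 - 2 * τ.t ^ 2 * τ.w ^ 2 - 2 * τ.u ^ 2 * τ.v ^ 2)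
    / ((τ.t ^ 2 + τ.u ^ 2 - τ.v ^ 2 - τ.w ^ 2) * (τ.t ^ 2 - τ.u ^ 2 + τ.v ^ 2 - τ.w ^ 2))

noncomputable def C : ℂ :=
  (τ.t ^ 2 * τ.u ^ 2 + τ.t ^ 2 * τ.v ^ 2 + τ.u ^ 2 * τ.w ^ 2 + τ.v ^ 2 * τ.w ^ 2
      - 4 * τ.t * τ.u * τ.v * τ.w)
    / (2 * (τ.t * τ.u - τ.v * τ.w) * (τ.t * τ.v - τ.u * τ.w))

/-- The square root of `(t² + u² + v² + w²)(t² - u² - v² + w²)(t² w² - u² v²)` that occurs in `D`.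
Its sign is the one for which the Kummer quartic relation between `P₁, S₁, P₂, S₂` holds. -/
noncomputable def rootD : ℂ :=
  -(τ.P₃ (0, 0) * τ.P₀ (0, 0) * τ.S₃ (0, 0) * τ.S₀ (0, 0)) / 2

noncomputable def D : ℂ :=
  ((τ.t ^ 2 - τ.w ^ 2) ^ 2 * (τ.u ^ 2 - τ.v ^ 2) ^ 2 * τ.rootD)
    / ((τ.t ^ 2 + τ.u ^ 2 - τ.v ^ 2 - τ.w ^ 2) * (τ.t ^ 2 - τ.u ^ 2 + τ.v ^ 2 - τ.w ^ 2)
      * (τ.t ^ 2 * τ.u ^ 2 - τ.v ^ 2 * τ.w ^ 2) * (τ.t ^ 2 * τ.v ^ 2 - τ.u ^ 2 * τ.w ^ 2))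

/-- The square root of `(C² - 1)(E² - 1)` used in `b` and `b₁`. -/
noncomputable def rootCE : ℂ :=
  ((τ.t ^ 2 - τ.w ^ 2) ^ 2 * (τ.u ^ 2 - τ.v ^ 2) ^ 2)
    / (4 * (τ.t ^ 2 * τ.u ^ 2 - τ.v ^ 2 * τ.w ^ 2) * (τ.t ^ 2 * τ.v ^ 2 - τ.u ^ 2 * τ.w ^ 2))

noncomputable def b : ℂ := (τ.C * τ.F - τ.E) / τ.rootCE
noncomputable def b₁ : ℂ := τ.D / τ.rootCE

noncomputable def E₁ : ℂ := (τ.C - τ.E - τ.D) / (τ.F - 1)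
noncomputable def E₂ : ℂ := (τ.C + τ.E - τ.D) / (τ.F + 1)

noncomputable def m : ℂ := (τ.E + 1) / (τ.E - 1)
noncomputable def m₁ : ℂ := (τ.E₁ + 1) / (τ.E₁ - 1)
noncomputable def m₂ : ℂ := (τ.E₂ + 1) / (τ.E₂ - 1)

/-- The quintic `f₅(x) = x (1 - x)(1 - m x)(1 - m₁ x)(1 - m₂ x)`. -/
noncomputable def f₅ (x : ℂ) : ℂ :=
  x * (1 - x) * (1 - τ.m * x) * (1 - τ.m₁ * x) * (1 - τ.m₂ * x)

/-! The linear forms `μ` and `ν` in `(u, v)`. -/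

noncomputable def α : ℂ :=
  deriv (fun s : ℂ => τ.bigTheta (1 / 2) (1 / 2) 0 0 (s, 0)
    - τ.bigTheta (-1 / 2) (-1 / 2) 0 0 (s, 0)) 0
noncomputable def β : ℂ :=
  deriv (fun s : ℂ => τ.bigTheta (1 / 2) (-1 / 2) 0 0 (s, 0)
    - τ.bigTheta (-1 / 2) (1 / 2) 0 0 (s, 0)) 0
noncomputable def γ : ℂ :=
  deriv (fun s : ℂ => τ.bigTheta (1 / 2) (1 / 2) 0 0 (0, s)
    - τ.bigTheta (-1 / 2) (-1 / 2) 0 0 (0, s)) 0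
noncomputable def δ : ℂ :=
  deriv (fun s : ℂ => τ.bigTheta (1 / 2) (-1 / 2) 0 0 (0, s)
    - τ.bigTheta (-1 / 2) (1 / 2) 0 0 (0, s)) 0

/-- `μ(u, v) = -i (β u + δ v) / Θ[1/2 -1/2; 0 0](0, 0)`. -/
noncomputable def μ : ℂ × ℂ →L[ℂ] ℂ :=
  (-I / τ.bigTheta (1 / 2) (-1 / 2) 0 0 (0, 0)) •
    (τ.β • ContinuousLinearMap.fst ℂ ℂ ℂ + τ.δ • ContinuousLinearMap.snd ℂ ℂ ℂ)

/-- `ν(u, v) = i (α u + γ v) / Θ[1/2 1/2; 0 0](0, 0)`. -/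
noncomputable def ν : ℂ × ℂ →L[ℂ] ℂ :=
  (I / τ.bigTheta (1 / 2) (1 / 2) 0 0 (0, 0)) •
    (τ.α • ContinuousLinearMap.fst ℂ ℂ ℂ + τ.γ • ContinuousLinearMap.snd ℂ ℂ ℂ)

/-- `Δ(x)² = 1 - 2 E x² + x⁴`. -/
noncomputable def ΔSq (x : ℂ) : ℂ := 1 - 2 * τ.E * x ^ 2 + x ^ 4

/-- The function `x` of `p` and `q`, where `r` is the chosen branch of `Δ(p) Δ(q)`. -/
noncomputable def x (r : ℂ × ℂ → ℂ) (z : ℂ × ℂ) : ℂ :=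
  (τ.E * (1 + τ.p z ^ 2 * τ.q z ^ 2) - (τ.p z ^ 2 + τ.q z ^ 2) - r z)
    / ((τ.E + 1) * (τ.p z * τ.q z + 1) ^ 2)

/-- The function `x'` of `p` and `q`, where `r` is the chosen branch of `Δ(p) Δ(q)`. -/
noncomputable def x' (r : ℂ × ℂ → ℂ) (z : ℂ × ℂ) : ℂ :=
  (τ.E * (1 + τ.p z ^ 2 * τ.q z ^ 2) - (τ.p z ^ 2 + τ.q z ^ 2) + r z)
    / ((τ.E + 1) * (τ.p z * τ.q z + 1) ^ 2)

/-- `r` is a holomorphic branch of `Δ(p) Δ(q)` on the open set `V`, and on `V` all quantities by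
which the inversion system divides are nonzero. -/
structure IsBranch (V : Set (ℂ × ℂ)) (r : ℂ × ℂ → ℂ) : Prop where
  isOpen : IsOpen V
  differentiableOn : DifferentiableOn ℂ r V
  P₁_ne : ∀ z ∈ V, τ.P₁ z ≠ 0
  P₂_ne : ∀ z ∈ V, τ.P₂ z ≠ 0
  one_add_pq_ne : ∀ z ∈ V, τ.p z * τ.q z + 1 ≠ 0
  sq_eq : ∀ z ∈ V, r z ^ 2 = τ.ΔSq (τ.p z) * τ.ΔSq (τ.q z)
  ne_zero : ∀ z ∈ V, r z ≠ 0
  f₅_x_ne : ∀ z ∈ V, τ.f₅ (τ.x r z) ≠ 0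
  f₅_x'_ne : ∀ z ∈ V, τ.f₅ (τ.x' r z) ≠ 0

end Period

/-- On `V`, the functions `X`, `X'` and suitable holomorphic branches `y = √f(X)`, `y' = √f(X')`
satisfy, for both `i`, the identity of differentials
`g i X dX / √f(X) + g i X' dX' / √f(X') = ω i`. -/
def SolvesInversion (f : ℂ → ℂ) (g : Fin 2 → ℂ → ℂ) (ω : Fin 2 → ℂ × ℂ →L[ℂ] ℂ)
    (V : Set (ℂ × ℂ)) (X X' : ℂ × ℂ → ℂ) : Prop :=
  DifferentiableOn ℂ X V ∧ DifferentiableOn ℂ X' V ∧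
  ∃ y y' : ℂ × ℂ → ℂ, DifferentiableOn ℂ y V ∧ DifferentiableOn ℂ y' V ∧
    ∀ z ∈ V, y z ≠ 0 ∧ y' z ≠ 0 ∧ y z ^ 2 = f (X z) ∧ y' z ^ 2 = f (X' z) ∧
      ∀ i, (g i (X z) / y z) • fderiv ℂ X z + (g i (X' z) / y' z) • fderiv ℂ X' z = ω i

/-- `℘₂₂ = X + X'` for a solution `X, X'` of the inversion problem. -/
def wp₂₂ (X X' : ℂ × ℂ → ℂ) (U : ℂ × ℂ) : ℂ := X U + X' U

/-- `℘₁₂ = -X X'` for a solution `X, X'` of the inversion problem. -/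
def wp₁₂ (X X' : ℂ × ℂ → ℂ) (U : ℂ × ℂ) : ℂ := -(X U * X' U)

/-! Everything rests on the addition theorem `theta_mul_theta`, which is the parallelogram law for
the quadratic form in the exponent. At w = 0 it makes the squares of the Pᵢ and Sᵢ linear in four
second-order theta functions, and the products P₀P₃ and S₀S₃ linear in P₁P₂ and S₁S₂. Computing
(P₀P₃)² in both ways gives the Kummer quartic (`Nondegenerate.kummer`). Differentiating in w at w =
0 gives the Wronskians P₁² dp = A ν + A' μ and P₂² dq = A ν − A' μ, with A = `evenν` and A' =
`evenμ` (`Nondegenerate.wronskian₁`, `Nondegenerate.wronskian₂`).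

By Euler's addition theorem dx/√(x(1 − x)(1 − mx)) is a constant multiple of dp/Δ(p) − dq/Δ(q);
reversing the sign of Δ(p)Δ(q) gives the analogue for x' (`deriv_x_eq`, `derivNumerator_sq`). The
two remaining factors of f₅ come from the theta relations. Up to constants, A² is P₁²P₂²(1 + pq)²(1
− m₁x)(1 − m₁x'). The quartic reads P₁⁴Δ(p)² + P₂⁴Δ(q)² = 2P₁²P₂²B, so that (P₂²Δ(q) − P₁²Δ(p))² =
2P₁²P₂²(B − Δ(p)Δ(q)), and B − Δ(p)Δ(q) is a constant times (1 + pq)²(1 − m₂x)(1 − m₁x').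

Hence the coefficient of ν in (m₁ − m₂)(x − x')dx, divided by κ₁(1 − m₁x'), is a square root of
f₅(x). It is holomorphic on V by its formula, so V need not be simply connected. As AA' is a
constant times P₂⁴Δ(q)² − P₁⁴Δ(p)², the coefficient of μ is then determined (`coeff_relation`), and
(m₁ − m₂)(x − x')dx = √f₅(x)·((1 − m₁x')κ₁ν − (1 − m₂x')κ₂μ) (`IsBranch.exists_sqrt`). With the
analogous formula for x', interpolation at the two points gives the inversion system.

Invertibility of the coordinate change is the independence of μ and ν. If both kill e, then P₁, P₂,
S₁, S₂ have the same logarithmic derivative along e near 0; the addition theorem makes it additive,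
hence linear, and the (quasi-)periods of P₁ force e = 0 (`Nondegenerate.eq_zero_of_forms`). -/

open Complex

namespace Period

variable (τ : Period)

/-! ### Convergence and termwise differentiation of the theta series. -/

/-- The general term of the theta series. -/
noncomputable def thetaTerm (a c b d : ℝ) (z : ℂ × ℂ) (k : ℤ × ℤ) : ℂ :=
  exp (Real.pi * I * (τ.τ₁₁ * ((k.1 : ℂ) + a / 2) ^ 2 + τ.τ₂₂ * ((k.2 : ℂ) + c / 2) ^ 2
        + 2 * τ.τ₁₂ * ((k.1 : ℂ) + a / 2) * ((k.2 : ℂ) + c / 2))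
      + 2 * Real.pi * I * (((k.1 : ℂ) + a / 2) * (z.1 + b / 2)
        + ((k.2 : ℂ) + c / 2) * (z.2 + d / 2)))

theorem theta_eq_tsum (a c b d : ℝ) (z : ℂ × ℂ) :
    τ.theta a c b d z = ∑' k, τ.thetaTerm a c b d z k := rfl

/-- Twice the period matrix. -/
noncomputable def double : Period where
  τ₁₁ := 2 * τ.τ₁₁
  τ₂₂ := 2 * τ.τ₂₂
  τ₁₂ := 2 * τ.τ₁₂
  im_pos₁₁ := by simpa using τ.im_pos₁₁
  im_pos₂₂ := by simpa using τ.im_pos₂₂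
  im_det_pos := by
    have := τ.im_det_pos
    simp only [mul_im, re_ofNat, im_ofNat, zero_mul, add_zero]
    nlinarith

theorem bigTheta_eq_double_theta (a c b d : ℝ) (z : ℂ × ℂ) :
    τ.bigTheta a c b d z = τ.double.theta a c b d z := rfl

/-- For Y = Im τ, Cayley–Hamilton gives tr(Y)·Y − det(Y) = Y², so with ε = det/trace the defect,
multiplied by the trace, is the squared length of Y(x, y). -/
theorem exists_quadratic_lower_bound : ∃ ε > 0, ∀ x y : ℝ,
    ε * (x ^ 2 + y ^ 2) ≤ τ.τ₁₁.im * x ^ 2 + τ.τ₂₂.im * y ^ 2 + 2 * τ.τ₁₂.im * x * y := by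
  have h1 := τ.im_pos₁₁
  have h2 := τ.im_pos₂₂
  have h3 := τ.im_det_pos
  refine ⟨(τ.τ₁₁.im * τ.τ₂₂.im - τ.τ₁₂.im ^ 2) / (τ.τ₁₁.im + τ.τ₂₂.im), by positivity, ?_⟩
  intro x y
  rw [div_mul_eq_mul_div, div_le_iff₀ (by positivity)]
  nlinarith [sq_nonneg (τ.τ₁₁.im * x + τ.τ₁₂.im * y), sq_nonneg (τ.τ₁₂.im * x + τ.τ₂₂.im * y)]

theorem norm_thetaTerm (a c b d : ℝ) (z : ℂ × ℂ) (k : ℤ × ℤ) :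
    ‖τ.thetaTerm a c b d z k‖ = Real.exp (-Real.pi * (τ.τ₁₁.im * (k.1 + a / 2) ^ 2
      + τ.τ₂₂.im * (k.2 + c / 2) ^ 2 + 2 * τ.τ₁₂.im * (k.1 + a / 2) * (k.2 + c / 2))
      - 2 * Real.pi * ((k.1 + a / 2) * z.1.im + (k.2 + c / 2) * z.2.im)) := by
  rw [thetaTerm, norm_exp]
  congr 1
  have e1 : ((k.1 : ℂ) + a / 2) = ((k.1 + a / 2 : ℝ) : ℂ) := by push_cast; ring
  have e2 : ((k.2 : ℂ) + c / 2) = ((k.2 + c / 2 : ℝ) : ℂ) := by push_cast; ring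
  have e3 : (b : ℂ) / 2 = ((b / 2 : ℝ) : ℂ) := by push_cast; ring
  have e4 : (d : ℂ) / 2 = ((d / 2 : ℝ) : ℂ) := by push_cast; ring
  rw [e1, e2, e3, e4]
  simp only [← ofReal_pow, add_re, mul_re, mul_im, add_im, ofReal_re, ofReal_im, I_re, I_im,
    re_ofNat, im_ofNat]
  ring

theorem neg_mul_sq_add_mul_abs_le {A : ℝ} (hA : 0 < A) (B s : ℝ) : ∃ C : ℝ, ∀ x : ℝ,
    -A * (x + s) ^ 2 + B * |x + s| ≤ C - |x| := by
  -- One extra unit of linear growth is traded for the decay −|x|; the constant is the maximum of (B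
  -- + 1)y − Ay², corrected for the shift by s.
  refine ⟨(B + 1) ^ 2 / (4 * A) + |s|, fun x => ?_⟩
  have h1 : |x| ≤ |x + s| + |s| := by
    have := abs_sub (x + s) s
    simpa using this
  have h2 : (B + 1) * |x + s| - A * (x + s) ^ 2 ≤ (B + 1) ^ 2 / (4 * A) := by
    rw [le_div_iff₀ (by positivity), ← sq_abs (x + s)]
    nlinarith [sq_nonneg (2 * A * |x + s| - (B + 1))]
  linarith

/-- A bound for the theta series on balls that absorbs exponential weights. -/
theorem exists_thetaTerm_bound (a c b d : ℝ) (R M : ℝ) : ∃ C : ℝ, 0 ≤ C ∧ ∀ z : ℂ × ℂ, ‖z‖ ≤ R →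
    ∀ k : ℤ × ℤ, Real.exp (M * (|k.1 + a / 2| + |k.2 + c / 2|)) * ‖τ.thetaTerm a c b d z k‖
      ≤ C * (Real.exp (-|(k.1 : ℝ)|) * Real.exp (-|(k.2 : ℝ)|)) := by
  obtain ⟨ε, hε, hq⟩ := τ.exists_quadratic_lower_bound
  have hA : 0 < Real.pi * ε := mul_pos Real.pi_pos hε
  obtain ⟨C₁, h₁⟩ := neg_mul_sq_add_mul_abs_le hA (2 * Real.pi * R + M) (a / 2)
  obtain ⟨C₂, h₂⟩ := neg_mul_sq_add_mul_abs_le hA (2 * Real.pi * R + M) (c / 2)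
  refine ⟨Real.exp (C₁ + C₂), (Real.exp_pos _).le, fun z hz k => ?_⟩
  rw [norm_thetaTerm, ← Real.exp_add, ← Real.exp_add, ← Real.exp_add, Real.exp_le_exp]
  have hz1 : |z.1.im| ≤ R := (abs_im_le_norm _).trans ((norm_fst_le z).trans hz)
  have hz2 : |z.2.im| ≤ R := (abs_im_le_norm _).trans ((norm_snd_le z).trans hz)
  have g1 := h₁ k.1
  have g2 := h₂ k.2
  have g3 := hq (k.1 + a / 2) (k.2 + c / 2)
  generalize (k.1 : ℝ) + a / 2 = x at *
  generalize (k.2 : ℝ) + c / 2 = y at *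
  have aux : ∀ x w : ℝ, |w| ≤ R → -(x * w) ≤ R * |x| := fun x w hw => by
    refine (neg_le_abs _).trans ?_
    rw [abs_mul, mul_comm]
    exact mul_le_mul_of_nonneg_right hw (abs_nonneg _)
  have g4 := mul_le_mul_of_nonneg_left (aux x _ hz1) Real.two_pi_pos.le
  have g5 := mul_le_mul_of_nonneg_left (aux y _ hz2) Real.two_pi_pos.le
  have g6 := mul_le_mul_of_nonneg_left g3 Real.pi_pos.le
  nlinarith

theorem summable_exp_neg_abs_int : Summable fun n : ℤ => Real.exp (-|(n : ℝ)|) := by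
  have : Summable fun n : ℕ => Real.exp (-(n : ℝ)) := Real.summable_exp_neg_nat
  apply Summable.of_nat_of_neg <;> simpa

theorem summable_exp_neg_abs_prod :
    Summable fun k : ℤ × ℤ => Real.exp (-|(k.1 : ℝ)|) * Real.exp (-|(k.2 : ℝ)|) :=
  summable_exp_neg_abs_int.mul_of_nonneg summable_exp_neg_abs_int
    (fun _ => (Real.exp_pos _).le) (fun _ => (Real.exp_pos _).le)

theorem summable_norm_weighted_thetaTerm (a c b d : ℝ) (g : ℤ × ℤ → ℂ) (M : ℝ)
    (hg : ∀ k : ℤ × ℤ, ‖g k‖ ≤ Real.exp (M * (|k.1 + a / 2| + |k.2 + c / 2|))) (z : ℂ × ℂ) :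
    Summable fun k => ‖g k * τ.thetaTerm a c b d z k‖ := by
  obtain ⟨C, -, hC⟩ := τ.exists_thetaTerm_bound a c b d ‖z‖ M
  refine Summable.of_nonneg_of_le (fun _ => norm_nonneg _) (fun k => ?_)
    (summable_exp_neg_abs_prod.mul_left C)
  rw [norm_mul]
  exact (mul_le_mul_of_nonneg_right (hg k) (norm_nonneg _)).trans (hC z le_rfl k)

theorem summable_norm_thetaTerm (a c b d : ℝ) (z : ℂ × ℂ) :
    Summable fun k => ‖τ.thetaTerm a c b d z k‖ := by
  simpa using τ.summable_norm_weighted_thetaTerm a c b d (fun _ => 1) 0 (by simp) z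

/-- The linear form whose exponential is the dependence of the `k`-th term on `z`. -/
noncomputable def freq (a c : ℝ) (k : ℤ × ℤ) : ℂ × ℂ →L[ℂ] ℂ :=
  (2 * Real.pi * I) • (((k.1 : ℂ) + a / 2) • ContinuousLinearMap.fst ℂ ℂ ℂ
    + ((k.2 : ℂ) + c / 2) • ContinuousLinearMap.snd ℂ ℂ ℂ)

theorem hasFDerivAt_thetaTerm (a c b d : ℝ) (z : ℂ × ℂ) (k : ℤ × ℤ) :
    HasFDerivAt (fun z => τ.thetaTerm a c b d z k)
      (τ.thetaTerm a c b d z k • freq a c k) z := by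
  unfold thetaTerm
  apply HasFDerivAt.cexp
  have h1 : HasFDerivAt (fun z : ℂ × ℂ => z.1 + (b : ℂ) / 2) (ContinuousLinearMap.fst ℂ ℂ ℂ) z :=
    hasFDerivAt_fst.add_const _
  have h2 : HasFDerivAt (fun z : ℂ × ℂ => z.2 + (d : ℂ) / 2) (ContinuousLinearMap.snd ℂ ℂ ℂ) z :=
    hasFDerivAt_snd.add_const _
  exact (((h1.const_mul _).add (h2.const_mul _)).const_mul _).const_add _

theorem norm_freq_le (a c : ℝ) (k : ℤ × ℤ) :
    ‖freq a c k‖ ≤ Real.exp (7 * (|k.1 + a / 2| + |k.2 + c / 2|)) := by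
  have e1 : ((k.1 : ℂ) + a / 2) = ((k.1 + a / 2 : ℝ) : ℂ) := by push_cast; ring
  have e2 : ((k.2 : ℂ) + c / 2) = ((k.2 + c / 2 : ℝ) : ℂ) := by push_cast; ring
  rw [freq, e1, e2]
  generalize (k.1 : ℝ) + a / 2 = x
  generalize (k.2 : ℝ) + c / 2 = y
  -- 7 is an integer above 2π.
  have h0 : ‖(2 * Real.pi * I : ℂ)‖ ≤ 7 := by
    simp only [norm_mul, norm_I, norm_ofNat, norm_real, Real.norm_eq_abs, abs_of_pos Real.pi_pos]
    linarith [Real.pi_lt_d2]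
  have h1 : ‖(x : ℂ) • ContinuousLinearMap.fst ℂ ℂ ℂ + (y : ℂ) • ContinuousLinearMap.snd ℂ ℂ ℂ‖
      ≤ |x| + |y| := by
    refine (norm_add_le _ _).trans ?_
    rw [norm_smul, norm_smul, norm_real, norm_real, Real.norm_eq_abs, Real.norm_eq_abs]
    exact add_le_add
      (mul_le_of_le_one_right (abs_nonneg _) (ContinuousLinearMap.norm_fst_le ℂ ℂ ℂ))
      (mul_le_of_le_one_right (abs_nonneg _) (ContinuousLinearMap.norm_snd_le ℂ ℂ ℂ))
  rw [norm_smul]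
  have h2 := mul_le_mul h0 h1 (norm_nonneg _) (by norm_num)
  have h3 := Real.add_one_le_exp (7 * (|x| + |y|))
  linarith

/-- Weighted theta series may be differentiated term by term. -/
theorem hasFDerivAt_weighted_theta (a c b d : ℝ) (g : ℤ × ℤ → ℂ) (M : ℝ)
    (hg : ∀ k : ℤ × ℤ, ‖g k‖ ≤ Real.exp (M * (|k.1 + a / 2| + |k.2 + c / 2|))) (z : ℂ × ℂ) :
    HasFDerivAt (fun z => ∑' k, g k * τ.thetaTerm a c b d z k)
      (∑' k, g k • τ.thetaTerm a c b d z k • freq a c k) z := by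
  -- The bound must hold on a neighbourhood of z, hence the larger radius; the additional 7 in the
  -- exponent absorbs the factor `freq` produced by differentiation.
  obtain ⟨C, hC0, hC⟩ := τ.exists_thetaTerm_bound a c b d (‖z‖ + 1) (M + 7)
  refine hasFDerivAt_tsum_of_isPreconnected (x₀ := z) (s := Metric.ball 0 (‖z‖ + 1))
    (summable_exp_neg_abs_prod.mul_left C) Metric.isOpen_ball
    (convex_ball _ _).isPreconnected
    (fun k x _ => (τ.hasFDerivAt_thetaTerm a c b d x k).const_mul (g k)) (fun k x hx => ?_)
    (by simp) (τ.summable_norm_weighted_thetaTerm a c b d g M hg z).of_norm (by simp)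
  have hx' : ‖x‖ ≤ ‖z‖ + 1 := by simpa using (Metric.mem_ball.1 hx).le
  rw [norm_smul, norm_smul]
  refine le_trans ?_ (hC x hx' k)
  rw [add_mul, Real.exp_add, mul_assoc, mul_comm (Real.exp (7 * _))]
  gcongr
  · exact hg k
  · exact norm_freq_le a c k

theorem hasFDerivAt_theta (a c b d : ℝ) (z : ℂ × ℂ) :
    HasFDerivAt (τ.theta a c b d) (∑' k, τ.thetaTerm a c b d z k • freq a c k) z := by
  have h := τ.hasFDerivAt_weighted_theta a c b d (fun _ => 1) 0 (by simp) z
  simp only [one_mul, one_smul] at h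
  exact h

theorem differentiable_theta (a c b d : ℝ) : Differentiable ℂ (τ.theta a c b d) :=
  fun z => (τ.hasFDerivAt_theta a c b d z).differentiableAt

/-- Directional derivatives of theta functions are entire. -/
theorem differentiable_fderiv_theta_apply (a c b d : ℝ) (e : ℂ × ℂ) :
    Differentiable ℂ fun z => fderiv ℂ (τ.theta a c b d) z e := by
  have key : ∀ k : ℤ × ℤ, ‖freq a c k e‖ ≤
      Real.exp (‖e‖) * Real.exp (7 * (|k.1 + a / 2| + |k.2 + c / 2|)) := fun k => by
    refine ((freq a c k).le_opNorm e).trans ?_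
    rw [mul_comm]
    exact mul_le_mul ((by linarith : ‖e‖ ≤ ‖e‖ + 1).trans (Real.add_one_le_exp _))
      (norm_freq_le a c k) (norm_nonneg _) (Real.exp_pos _).le
  have hsum : ∀ z, Summable fun k => τ.thetaTerm a c b d z k • freq a c k := fun z => by
    refine Summable.of_norm_bounded (τ.summable_norm_weighted_thetaTerm a c b d
      (fun k => Real.exp (7 * (|k.1 + a / 2| + |k.2 + c / 2|))) 7 (fun k => ?_) z) (fun k => ?_)
    · rw [norm_real, Real.norm_eq_abs, abs_of_pos (Real.exp_pos _)]
    · rw [norm_smul, norm_mul, norm_real, Real.norm_eq_abs, abs_of_pos (Real.exp_pos _), mul_comm]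
      exact mul_le_mul_of_nonneg_right (norm_freq_le a c k) (norm_nonneg _)
  -- The factor exp(−‖e‖) normalises the weights so that they satisfy the growth hypothesis without
  -- a multiplicative constant.
  have heq : (fun z => fderiv ℂ (τ.theta a c b d) z e) = fun z => Real.exp (‖e‖) *
      ∑' k, (Real.exp (-‖e‖) * freq a c k e) * τ.thetaTerm a c b d z k := by
    ext z
    rw [(τ.hasFDerivAt_theta a c b d z).fderiv, ← tsum_mul_left]
    refine ((ContinuousLinearMap.apply ℂ ℂ e).map_tsum (hsum z)).trans ?_
    refine tsum_congr fun k => ?_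
    have : (Real.exp ‖e‖ : ℂ) * Real.exp (-‖e‖) = 1 := by
      rw [← ofReal_mul, ← Real.exp_add]; simp
    simp only [ContinuousLinearMap.apply_apply, _root_.smul_apply, smul_eq_mul]
    linear_combination (-(freq a c k e) * τ.thetaTerm a c b d z k) * this
  rw [heq]
  refine Differentiable.const_mul (fun z => (τ.hasFDerivAt_weighted_theta a c b d _ 7
    (fun k => ?_) z).differentiableAt) _
  rw [norm_mul, norm_real, Real.norm_eq_abs, abs_of_pos (Real.exp_pos _), Real.exp_neg,
    inv_mul_le_iff₀ (Real.exp_pos _)]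
  exact key k

/-! ### Reflection and integral shifts of the characteristic. -/

theorem theta_neg (a c b d : ℝ) (z : ℂ × ℂ) :
    τ.theta a c b d (-z) = τ.theta (-a) (-c) (-b) (-d) z := by
  rw [theta_eq_tsum, theta_eq_tsum, ← (Equiv.neg (ℤ × ℤ)).tsum_eq]
  refine tsum_congr fun k => ?_
  simp only [thetaTerm, Equiv.neg_apply, Prod.fst_neg, Prod.snd_neg]
  congr 1
  push_cast
  ring

theorem theta_add_two_left (a c b d : ℝ) (z : ℂ × ℂ) :
    τ.theta (a + 2) c b d z = τ.theta a c b d z := by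
  rw [theta_eq_tsum, theta_eq_tsum, ← (Equiv.subRight ((1, 0) : ℤ × ℤ)).tsum_eq]
  refine tsum_congr fun k => ?_
  simp only [thetaTerm, Equiv.subRight_apply, Prod.fst_sub, Prod.snd_sub]
  congr 1
  push_cast
  ring

theorem theta_add_two_right (a c b d : ℝ) (z : ℂ × ℂ) :
    τ.theta a (c + 2) b d z = τ.theta a c b d z := by
  rw [theta_eq_tsum, theta_eq_tsum, ← (Equiv.subRight ((0, 1) : ℤ × ℤ)).tsum_eq]
  refine tsum_congr fun k => ?_
  simp only [thetaTerm, Equiv.subRight_apply, Prod.fst_sub, Prod.snd_sub]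
  congr 1
  push_cast
  ring

theorem theta_shift_fst (a c b d : ℝ) (z : ℂ × ℂ) :
    τ.theta a c (b + 2) d z = exp (Real.pi * I * a) * τ.theta a c b d z := by
  rw [theta_eq_tsum, theta_eq_tsum, ← tsum_mul_left]
  refine tsum_congr fun k => ?_
  rw [thetaTerm, thetaTerm, ← exp_add, exp_eq_exp_iff_exists_int]
  refine ⟨k.1, ?_⟩
  push_cast
  ring

theorem theta_shift_snd (a c b d : ℝ) (z : ℂ × ℂ) :
    τ.theta a c b (d + 2) z = exp (Real.pi * I * c) * τ.theta a c b d z := by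
  rw [theta_eq_tsum, theta_eq_tsum, ← tsum_mul_left]
  refine tsum_congr fun k => ?_
  rw [thetaTerm, thetaTerm, ← exp_add, exp_eq_exp_iff_exists_int]
  refine ⟨k.2, ?_⟩
  push_cast
  ring

/-! ### The addition theorem. -/

/-- `(n, n', σ) ↦ (n + n' + σ, n - n')` with `σ ∈ {0, 1}`. -/
def parityEquiv : (ℤ × ℤ) × Fin 2 ≃ ℤ × ℤ where
  toFun x := (x.1.1 + x.1.2 + (x.2 : ℕ), x.1.1 - x.1.2)
  invFun y := (((y.1 + y.2) / 2, (y.1 - y.2) / 2), if (y.1 + y.2) % 2 = 0 then 0 else 1)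
  left_inv := by
    rintro ⟨⟨n, n'⟩, σ⟩
    fin_cases σ
    · have h : (n + n' + 0 + (n - n')) % 2 = 0 := by omega
      simp only [Fin.zero_eta, Fin.isValue, Nat.cast_zero, h,
        if_true, Prod.mk.injEq, and_true]
      omega
    · have h : ¬ (n + n' + 1 + (n - n')) % 2 = 0 := by omega
      simp only [Fin.mk_one, Fin.isValue, Nat.cast_one, h,
        if_false, Prod.mk.injEq, and_true]
      omega
  right_inv := by
    rintro ⟨k, k'⟩
    by_cases h : (k + k') % 2 = 0
    · simp only [h, if_true, Fin.isValue, Fin.coe_ofNat_eq_mod, Nat.zero_mod, Nat.cast_zero,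
        Prod.mk.injEq]
      omega
    · simp only [h, if_false, Fin.isValue, Fin.coe_ofNat_eq_mod, Nat.mod_succ, Nat.cast_one,
        Prod.mk.injEq]
      omega

/-- The two-dimensional version of `parityEquiv`. -/
def parityEquiv₂ : (Fin 2 × Fin 2) × ((ℤ × ℤ) × (ℤ × ℤ)) ≃ (ℤ × ℤ) × (ℤ × ℤ) where
  toFun x :=
    (((parityEquiv ((x.2.1.1, x.2.2.1), x.1.1)).1, (parityEquiv ((x.2.1.2, x.2.2.2), x.1.2)).1),
      ((parityEquiv ((x.2.1.1, x.2.2.1), x.1.1)).2, (parityEquiv ((x.2.1.2, x.2.2.2), x.1.2)).2))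
  invFun y :=
    (((parityEquiv.symm (y.1.1, y.2.1)).2, (parityEquiv.symm (y.1.2, y.2.2)).2),
      (((parityEquiv.symm (y.1.1, y.2.1)).1.1, (parityEquiv.symm (y.1.2, y.2.2)).1.1),
        ((parityEquiv.symm (y.1.1, y.2.1)).1.2, (parityEquiv.symm (y.1.2, y.2.2)).1.2)))
  left_inv := fun x => by simp
  right_inv := fun y => by simp

/-- Parallelogram law Q(k) + Q(l) = 2Q((k + l)/2) + 2Q((k − l)/2). For two indices n + n' + σ and n
− n' the half sum is n + σ/2 and the half difference n' + σ/2, so the parity σ moves into the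
characteristic. -/
theorem thetaTerm_mul_thetaTerm (a c b d a' c' b' d' : ℝ) (z w : ℂ × ℂ)
    (x : (Fin 2 × Fin 2) × ((ℤ × ℤ) × (ℤ × ℤ))) :
    τ.thetaTerm a c b d (z + w) (parityEquiv₂ x).1
        * τ.thetaTerm a' c' b' d' (z - w) (parityEquiv₂ x).2
      = τ.double.thetaTerm ((a + a') / 2 + (x.1.1 : ℕ)) ((c + c') / 2 + (x.1.2 : ℕ))
          (b + b') (d + d') ((2 : ℂ) • z) x.2.1
        * τ.double.thetaTerm ((a - a') / 2 + (x.1.1 : ℕ)) ((c - c') / 2 + (x.1.2 : ℕ))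
          (b - b') (d - d') ((2 : ℂ) • w) x.2.2 := by
  obtain ⟨⟨σ₁, σ₂⟩, ⟨n, n'⟩, ⟨l, l'⟩⟩ := x
  simp only [thetaTerm, ← exp_add, parityEquiv₂, parityEquiv, Equiv.coe_fn_mk, double,
    Prod.fst_add, Prod.snd_add, Prod.fst_sub, Prod.snd_sub, Prod.smul_fst, Prod.smul_snd,
    smul_eq_mul]
  congr 1
  push_cast
  ring

/-- The addition theorem for theta functions with characteristics. -/
theorem theta_mul_theta (a c b d a' c' b' d' : ℝ) (z w : ℂ × ℂ) :
    τ.theta a c b d (z + w) * τ.theta a' c' b' d' (z - w)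
      = ∑ σ : Fin 2 × Fin 2,
        τ.bigTheta ((a + a') / 2 + (σ.1 : ℕ)) ((c + c') / 2 + (σ.2 : ℕ)) (b + b') (d + d')
          ((2 : ℂ) • z)
        * τ.bigTheta ((a - a') / 2 + (σ.1 : ℕ)) ((c - c') / 2 + (σ.2 : ℕ)) (b - b') (d - d')
          ((2 : ℂ) • w) := by
  have h1 := τ.summable_norm_thetaTerm a c b d (z + w)
  have h2 := τ.summable_norm_thetaTerm a' c' b' d' (z - w)
  rw [theta_eq_tsum, theta_eq_tsum, tsum_mul_tsum_of_summable_norm h1 h2,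
    ← parityEquiv₂.tsum_eq]
  have h3 := (parityEquiv₂.summable_iff.2 (h1.mul_norm h2)).of_norm
  simp only [thetaTerm_mul_thetaTerm] at h3 ⊢
  rw [h3.tsum_prod, tsum_fintype]
  refine Finset.sum_congr rfl fun σ _ => ?_
  rw [bigTheta_eq_double_theta, bigTheta_eq_double_theta, theta_eq_tsum, theta_eq_tsum,
    tsum_mul_tsum_of_summable_norm (τ.double.summable_norm_thetaTerm _ _ _ _ _)
      (τ.double.summable_norm_thetaTerm _ _ _ _ _)]

/-! ### Special characteristics: squares, products and half characteristics. -/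

theorem bigTheta_two_left (c b d : ℝ) (z : ℂ × ℂ) :
    τ.bigTheta 2 c b d z = τ.bigTheta 0 c b d z := by
  have h := τ.double.theta_add_two_left 0 c b d z
  rwa [zero_add] at h

theorem bigTheta_two_right (a b d : ℝ) (z : ℂ × ℂ) :
    τ.bigTheta a 2 b d z = τ.bigTheta a 0 b d z := by
  have h := τ.double.theta_add_two_right a 0 b d z
  rwa [zero_add] at h

theorem bigTheta_three_halves_left (c b d : ℝ) (z : ℂ × ℂ) :
    τ.bigTheta (3 / 2) c b d z = τ.bigTheta (-1 / 2) c b d z := by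
  rw [show (3 / 2 : ℝ) = -1 / 2 + 2 by norm_num]
  exact τ.double.theta_add_two_left _ c b d z

theorem bigTheta_three_halves_right (a b d : ℝ) (z : ℂ × ℂ) :
    τ.bigTheta a (3 / 2) b d z = τ.bigTheta a (-1 / 2) b d z := by
  rw [show (3 / 2 : ℝ) = -1 / 2 + 2 by norm_num]
  exact τ.double.theta_add_two_right a _ b d z

theorem bigTheta_two_fst (a c d : ℝ) (z : ℂ × ℂ) :
    τ.bigTheta a c 2 d z = exp (Real.pi * I * a) * τ.bigTheta a c 0 d z := by
  have h := τ.double.theta_shift_fst a c 0 d z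
  rwa [zero_add] at h

theorem bigTheta_two_snd (a c b : ℝ) (z : ℂ × ℂ) :
    τ.bigTheta a c b 2 z = exp (Real.pi * I * c) * τ.bigTheta a c b 0 z := by
  have h := τ.double.theta_shift_snd a c b 0 z
  rwa [zero_add] at h

theorem bigTheta_zero_neg_one (c d : ℝ) (z : ℂ × ℂ) :
    τ.bigTheta 0 c (-1) d z = τ.bigTheta 0 c 1 d z := by
  have h := τ.double.theta_shift_fst 0 c (-1) d z
  norm_num only at h
  simpa [bigTheta_eq_double_theta] using h.symm

theorem bigTheta_one_neg_one (c d : ℝ) (z : ℂ × ℂ) :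
    τ.bigTheta 1 c (-1) d z = -τ.bigTheta 1 c 1 d z := by
  have h := τ.double.theta_shift_fst 1 c (-1) d z
  norm_num only at h
  simp [bigTheta_eq_double_theta, h]

/-- The characteristic is odd: reflecting it and shifting back to the original one changes the sign.
-/
theorem bigTheta_one_zero_one_one : τ.bigTheta 1 0 1 1 0 = 0 := by
  have h := τ.double.theta_neg 1 0 1 1 0
  have h1 := τ.double.theta_add_two_left (-1) 0 (-1) (-1) 0
  have h2 := τ.double.theta_shift_fst 1 0 (-1) (-1) 0
  have h3 := τ.double.theta_shift_snd 1 0 1 (-1) 0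
  norm_num at h h1 h2 h3
  rw [bigTheta_eq_double_theta]
  linear_combination (1 / 2 : ℂ) * (h - h1 + h2 + h3)

theorem bigTheta_zero_one_one_one : τ.bigTheta 0 1 1 1 0 = 0 := by
  have h := τ.double.theta_neg 0 1 1 1 0
  have h1 := τ.double.theta_add_two_right 0 (-1) (-1) (-1) 0
  have h2 := τ.double.theta_shift_fst 0 1 (-1) (-1) 0
  have h3 := τ.double.theta_shift_snd 0 1 1 (-1) 0
  norm_num at h h1 h2 h3
  rw [bigTheta_eq_double_theta]
  linear_combination (1 / 2 : ℂ) * (h - h1 - h2 + h3)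

theorem exp_pi_I_zero : exp (Real.pi * I * (0 : ℝ)) = 1 := by simp

theorem exp_pi_I_one : exp (Real.pi * I * (1 : ℝ)) = -1 := by simp

theorem exp_pi_I_half : exp (Real.pi * I * ((1 / 2 : ℝ) : ℂ)) = I := by
  rw [show (Real.pi * I * ((1 / 2 : ℝ) : ℂ)) = Real.pi / 2 * I by push_cast; ring,
    exp_pi_div_two_mul_I]

theorem exp_pi_I_two : exp (Real.pi * I * (2 : ℝ)) = 1 := by
  rw [← exp_two_pi_mul_I]
  congr 1
  push_cast
  ring

theorem exp_pi_I_three_halves : exp (Real.pi * I * ((3 / 2 : ℝ) : ℂ)) = -I := by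
  rw [show (Real.pi * I * ((3 / 2 : ℝ) : ℂ)) = Real.pi * I + Real.pi / 2 * I by push_cast; ring,
    exp_add, exp_pi_mul_I, exp_pi_div_two_mul_I]
  ring

/-- The addition theorem at w = 0 with equal characteristics; the second factors become the theta
constants, which makes each square linear in the functions `X₀`, …, `X₃`. -/
theorem theta_zero_mul (a c b d : ℝ) (z : ℂ × ℂ) :
    τ.theta a c b d z * τ.theta a c b d z
      = τ.bigTheta a c (b + b) (d + d) ((2 : ℂ) • z) * τ.t
        + τ.bigTheta a (c + 1) (b + b) (d + d) ((2 : ℂ) • z) * τ.v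
        + τ.bigTheta (a + 1) c (b + b) (d + d) ((2 : ℂ) • z) * τ.u
        + τ.bigTheta (a + 1) (c + 1) (b + b) (d + d) ((2 : ℂ) • z) * τ.w := by
  have h := τ.theta_mul_theta a c b d a c b d z 0
  simp only [Fintype.sum_prod_type, Fin.sum_univ_two] at h
  rw [add_zero, sub_zero] at h
  rw [h, t, u, v, w]
  simp only [add_self_div_two, sub_self, zero_div, Fin.isValue, Fin.coe_ofNat_eq_mod,
    Nat.zero_mod, Nat.cast_zero, Nat.mod_succ, Nat.cast_one, add_zero, zero_add, smul_zero,
    Prod.mk_zero_zero]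
  ring

noncomputable def X₀ (z : ℂ × ℂ) : ℂ := τ.bigTheta 0 0 0 0 ((2 : ℂ) • z)
noncomputable def X₁ (z : ℂ × ℂ) : ℂ := τ.bigTheta 1 0 0 0 ((2 : ℂ) • z)
noncomputable def X₂ (z : ℂ × ℂ) : ℂ := τ.bigTheta 0 1 0 0 ((2 : ℂ) • z)
noncomputable def X₃ (z : ℂ × ℂ) : ℂ := τ.bigTheta 1 1 0 0 ((2 : ℂ) • z)

theorem P₀_sq (z : ℂ × ℂ) : τ.P₀ z ^ 2
    = τ.t * τ.X₀ z - τ.u * τ.X₁ z - τ.v * τ.X₂ z + τ.w * τ.X₃ z := by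
  rw [sq, P₀, theta_zero_mul, X₀, X₁, X₂, X₃]
  norm_num only [bigTheta_two_left, bigTheta_two_right, bigTheta_two_fst, bigTheta_two_snd,
    exp_pi_I_zero, exp_pi_I_one, exp_pi_I_two]
  ring

theorem P₁_sq (z : ℂ × ℂ) : τ.P₁ z ^ 2
    = τ.t * τ.X₀ z + τ.u * τ.X₁ z - τ.v * τ.X₂ z - τ.w * τ.X₃ z := by
  rw [sq, P₁, theta_zero_mul, X₀, X₁, X₂, X₃]
  norm_num only [bigTheta_two_left, bigTheta_two_right, bigTheta_two_fst, bigTheta_two_snd,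
    exp_pi_I_zero, exp_pi_I_one, exp_pi_I_two]
  ring

theorem P₂_sq (z : ℂ × ℂ) : τ.P₂ z ^ 2
    = τ.t * τ.X₀ z - τ.u * τ.X₁ z + τ.v * τ.X₂ z - τ.w * τ.X₃ z := by
  rw [sq, P₂, theta_zero_mul, X₀, X₁, X₂, X₃]
  norm_num only [bigTheta_two_left, bigTheta_two_right, bigTheta_two_fst, bigTheta_two_snd,
    exp_pi_I_zero, exp_pi_I_one, exp_pi_I_two]
  ring

theorem P₃_sq (z : ℂ × ℂ) : τ.P₃ z ^ 2
    = τ.t * τ.X₀ z + τ.u * τ.X₁ z + τ.v * τ.X₂ z + τ.w * τ.X₃ z := by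
  rw [sq, P₃, theta_zero_mul, X₀, X₁, X₂, X₃]
  norm_num only [bigTheta_two_left, bigTheta_two_right, bigTheta_two_fst, bigTheta_two_snd,
    exp_pi_I_zero, exp_pi_I_one, exp_pi_I_two]
  ring

theorem S₀_sq (z : ℂ × ℂ) : τ.S₀ z ^ 2
    = τ.w * τ.X₀ z - τ.v * τ.X₁ z - τ.u * τ.X₂ z + τ.t * τ.X₃ z := by
  rw [sq, S₀, theta_zero_mul, X₀, X₁, X₂, X₃]
  norm_num only [bigTheta_two_left, bigTheta_two_right, bigTheta_two_fst, bigTheta_two_snd,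
    exp_pi_I_zero, exp_pi_I_one, exp_pi_I_two]
  ring

theorem S₁_sq (z : ℂ × ℂ) : τ.S₁ z ^ 2
    = τ.w * τ.X₀ z + τ.v * τ.X₁ z - τ.u * τ.X₂ z - τ.t * τ.X₃ z := by
  rw [sq, S₁, theta_zero_mul, X₀, X₁, X₂, X₃]
  norm_num only [bigTheta_two_left, bigTheta_two_right, bigTheta_two_fst, bigTheta_two_snd,
    exp_pi_I_zero, exp_pi_I_one, exp_pi_I_two]
  ring

theorem S₂_sq (z : ℂ × ℂ) : τ.S₂ z ^ 2
    = τ.w * τ.X₀ z - τ.v * τ.X₁ z + τ.u * τ.X₂ z - τ.t * τ.X₃ z := by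
  rw [sq, S₂, theta_zero_mul, X₀, X₁, X₂, X₃]
  norm_num only [bigTheta_two_left, bigTheta_two_right, bigTheta_two_fst, bigTheta_two_snd,
    exp_pi_I_zero, exp_pi_I_one, exp_pi_I_two]
  ring

theorem S₃_sq (z : ℂ × ℂ) : τ.S₃ z ^ 2
    = τ.w * τ.X₀ z + τ.v * τ.X₁ z + τ.u * τ.X₂ z + τ.t * τ.X₃ z := by
  rw [sq, S₃, theta_zero_mul, X₀, X₁, X₂, X₃]
  norm_num only [bigTheta_two_left, bigTheta_two_right, bigTheta_two_fst, bigTheta_two_snd,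
    exp_pi_I_zero, exp_pi_I_one, exp_pi_I_two]
  ring

/-- The common core of the products `P₀P₃`, `P₁P₂`, `S₀S₃`, `S₁S₂`. -/
noncomputable def G₀ (z : ℂ × ℂ) : ℂ := τ.bigTheta 0 0 1 1 ((2 : ℂ) • z)
noncomputable def G₁ (z : ℂ × ℂ) : ℂ := τ.bigTheta 1 1 1 1 ((2 : ℂ) • z)

/-- Two of the four terms of the addition theorem carry constants with odd characteristic and
vanish. All four products of this kind therefore lie in one two-dimensional space. -/
theorem P₀_mul_P₃ (z : ℂ × ℂ) : τ.P₀ z * τ.P₃ z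
    = τ.G₀ 0 * τ.G₀ z + τ.G₁ 0 * τ.G₁ z := by
  have h := τ.theta_mul_theta 0 0 1 1 0 0 0 0 z 0
  simp only [Fintype.sum_prod_type, Fin.sum_univ_two, add_zero, sub_zero] at h
  rw [P₀, P₃, h, G₀, G₁, G₀, G₁]
  norm_num [bigTheta_two_left, bigTheta_two_right, bigTheta_one_zero_one_one,
    bigTheta_zero_one_one_one, bigTheta_zero_neg_one, bigTheta_one_neg_one]
  ring

theorem S₀_mul_S₃ (z : ℂ × ℂ) : τ.S₀ z * τ.S₃ z
    = τ.G₁ 0 * τ.G₀ z + τ.G₀ 0 * τ.G₁ z := by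
  have h := τ.theta_mul_theta 1 1 1 1 1 1 0 0 z 0
  simp only [Fintype.sum_prod_type, Fin.sum_univ_two, add_zero, sub_zero] at h
  rw [S₀, S₃, h, G₀, G₁, G₀, G₁]
  norm_num [bigTheta_two_left, bigTheta_two_right, bigTheta_one_zero_one_one,
    bigTheta_zero_one_one_one, bigTheta_zero_neg_one, bigTheta_one_neg_one]
  ring

theorem P₁_mul_P₂ (z : ℂ × ℂ) : τ.P₁ z * τ.P₂ z
    = τ.G₀ 0 * τ.G₀ z - τ.G₁ 0 * τ.G₁ z := by
  have h := τ.theta_mul_theta 0 0 0 1 0 0 1 0 z 0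
  simp only [Fintype.sum_prod_type, Fin.sum_univ_two, add_zero, sub_zero] at h
  rw [P₁, P₂, h, G₀, G₁, G₀, G₁]
  norm_num [bigTheta_two_left, bigTheta_two_right, bigTheta_one_zero_one_one,
    bigTheta_zero_one_one_one, bigTheta_zero_neg_one, bigTheta_one_neg_one]
  ring

theorem S₁_mul_S₂ (z : ℂ × ℂ) : τ.S₁ z * τ.S₂ z
    = -τ.G₁ 0 * τ.G₀ z + τ.G₀ 0 * τ.G₁ z := by
  have h := τ.theta_mul_theta 1 1 0 1 1 1 1 0 z 0
  simp only [Fintype.sum_prod_type, Fin.sum_univ_two, add_zero, sub_zero] at h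
  rw [S₁, S₂, h, G₀, G₁, G₀, G₁]
  norm_num [bigTheta_two_left, bigTheta_two_right, bigTheta_one_zero_one_one,
    bigTheta_zero_one_one_one, bigTheta_zero_neg_one, bigTheta_one_neg_one]
  ring

/-- Together with the three formulas that follow, this is used at w = 0 for the even combinations
(indices 0 and 3) and differentiated at w = 0 for the Wronskians (indices 1 and 2). -/
theorem S₀_add_mul_P₀_sub (z w : ℂ × ℂ) : τ.S₀ (z + w) * τ.P₀ (z - w)
    = (-τ.bigTheta (1 / 2) (1 / 2) 0 0 ((2 : ℂ) • z) * τ.bigTheta (1 / 2) (1 / 2) 0 0 ((2 : ℂ) • w)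
        + τ.bigTheta (-1 / 2) (1 / 2) 0 0 ((2 : ℂ) • z) * τ.bigTheta (-1 / 2) (1 / 2) 0 0 ((2 : ℂ) • w)
        + τ.bigTheta (1 / 2) (-1 / 2) 0 0 ((2 : ℂ) • z) * τ.bigTheta (1 / 2) (-1 / 2) 0 0 ((2 : ℂ) • w)
        - τ.bigTheta (-1 / 2) (-1 / 2) 0 0 ((2 : ℂ) • z) * τ.bigTheta (-1 / 2) (-1 / 2) 0 0 ((2 : ℂ) • w)) := by
  rw [S₀, P₀, theta_mul_theta]
  simp only [Fintype.sum_prod_type, Fin.sum_univ_two, Fin.isValue, Fin.coe_ofNat_eq_mod,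
    Nat.zero_mod, Nat.cast_zero, Nat.mod_succ, Nat.cast_one]
  norm_num only [bigTheta_three_halves_left, bigTheta_three_halves_right, bigTheta_two_fst,
    bigTheta_two_snd, exp_pi_I_zero, exp_pi_I_half, exp_pi_I_three_halves]
  ring_nf
  simp only [I_sq]
  ring_nf

theorem S₁_add_mul_P₁_sub (z w : ℂ × ℂ) : τ.S₁ (z + w) * τ.P₁ (z - w)
    = I * (τ.bigTheta (1 / 2) (1 / 2) 0 0 ((2 : ℂ) • z) * τ.bigTheta (1 / 2) (1 / 2) 0 0 ((2 : ℂ) • w)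
        + τ.bigTheta (-1 / 2) (1 / 2) 0 0 ((2 : ℂ) • z) * τ.bigTheta (-1 / 2) (1 / 2) 0 0 ((2 : ℂ) • w)
        - τ.bigTheta (1 / 2) (-1 / 2) 0 0 ((2 : ℂ) • z) * τ.bigTheta (1 / 2) (-1 / 2) 0 0 ((2 : ℂ) • w)
        - τ.bigTheta (-1 / 2) (-1 / 2) 0 0 ((2 : ℂ) • z) * τ.bigTheta (-1 / 2) (-1 / 2) 0 0 ((2 : ℂ) • w)) := by
  rw [S₁, P₁, theta_mul_theta]
  simp only [Fintype.sum_prod_type, Fin.sum_univ_two, Fin.isValue, Fin.coe_ofNat_eq_mod,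
    Nat.zero_mod, Nat.cast_zero, Nat.mod_succ, Nat.cast_one]
  norm_num only [bigTheta_three_halves_left, bigTheta_three_halves_right, bigTheta_two_fst,
    bigTheta_two_snd, exp_pi_I_zero, exp_pi_I_half, exp_pi_I_three_halves]
  ring

theorem S₂_add_mul_P₂_sub (z w : ℂ × ℂ) : τ.S₂ (z + w) * τ.P₂ (z - w)
    = I * (τ.bigTheta (1 / 2) (1 / 2) 0 0 ((2 : ℂ) • z) * τ.bigTheta (1 / 2) (1 / 2) 0 0 ((2 : ℂ) • w)
        - τ.bigTheta (-1 / 2) (1 / 2) 0 0 ((2 : ℂ) • z) * τ.bigTheta (-1 / 2) (1 / 2) 0 0 ((2 : ℂ) • w)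
        + τ.bigTheta (1 / 2) (-1 / 2) 0 0 ((2 : ℂ) • z) * τ.bigTheta (1 / 2) (-1 / 2) 0 0 ((2 : ℂ) • w)
        - τ.bigTheta (-1 / 2) (-1 / 2) 0 0 ((2 : ℂ) • z) * τ.bigTheta (-1 / 2) (-1 / 2) 0 0 ((2 : ℂ) • w)) := by
  rw [S₂, P₂, theta_mul_theta]
  simp only [Fintype.sum_prod_type, Fin.sum_univ_two, Fin.isValue, Fin.coe_ofNat_eq_mod,
    Nat.zero_mod, Nat.cast_zero, Nat.mod_succ, Nat.cast_one]
  norm_num only [bigTheta_three_halves_left, bigTheta_three_halves_right, bigTheta_two_fst,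
    bigTheta_two_snd, exp_pi_I_zero, exp_pi_I_half, exp_pi_I_three_halves]
  ring

theorem S₃_add_mul_P₃_sub (z w : ℂ × ℂ) : τ.S₃ (z + w) * τ.P₃ (z - w)
    = (τ.bigTheta (1 / 2) (1 / 2) 0 0 ((2 : ℂ) • z) * τ.bigTheta (1 / 2) (1 / 2) 0 0 ((2 : ℂ) • w)
        + τ.bigTheta (-1 / 2) (1 / 2) 0 0 ((2 : ℂ) • z) * τ.bigTheta (-1 / 2) (1 / 2) 0 0 ((2 : ℂ) • w)
        + τ.bigTheta (1 / 2) (-1 / 2) 0 0 ((2 : ℂ) • z) * τ.bigTheta (1 / 2) (-1 / 2) 0 0 ((2 : ℂ) • w)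
        + τ.bigTheta (-1 / 2) (-1 / 2) 0 0 ((2 : ℂ) • z) * τ.bigTheta (-1 / 2) (-1 / 2) 0 0 ((2 : ℂ) • w)) := by
  rw [S₃, P₃, theta_mul_theta]
  simp only [Fintype.sum_prod_type, Fin.sum_univ_two, Fin.isValue, Fin.coe_ofNat_eq_mod,
    Nat.zero_mod, Nat.cast_zero, Nat.mod_succ, Nat.cast_one]
  norm_num only [bigTheta_three_halves_left, bigTheta_three_halves_right, bigTheta_two_fst,
    bigTheta_two_snd, exp_pi_I_zero, exp_pi_I_half, exp_pi_I_three_halves]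
  ring

theorem P₁_add_mul_P₁_sub (z w : ℂ × ℂ) : τ.P₁ (z + w) * τ.P₁ (z - w)
    = τ.X₀ z * τ.X₀ w + τ.X₁ z * τ.X₁ w - τ.X₂ z * τ.X₂ w - τ.X₃ z * τ.X₃ w := by
  rw [P₁, P₁, theta_mul_theta]
  simp only [Fintype.sum_prod_type, Fin.sum_univ_two, Fin.isValue, Fin.coe_ofNat_eq_mod,
    Nat.zero_mod, Nat.cast_zero, Nat.mod_succ, Nat.cast_one, X₀, X₁, X₂, X₃]
  norm_num only [bigTheta_two_snd, exp_pi_I_zero, exp_pi_I_one]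
  ring

/-! ### Values at the origin, the even coefficients, and the forms ν and μ. -/

theorem differentiable_bigTheta (a c b d : ℝ) : Differentiable ℂ (τ.bigTheta a c b d) :=
  τ.double.differentiable_theta a c b d

theorem differentiable_P₀ : Differentiable ℂ τ.P₀ := τ.differentiable_theta _ _ _ _
theorem differentiable_P₁ : Differentiable ℂ τ.P₁ := τ.differentiable_theta _ _ _ _
theorem differentiable_P₂ : Differentiable ℂ τ.P₂ := τ.differentiable_theta _ _ _ _
theorem differentiable_P₃ : Differentiable ℂ τ.P₃ := τ.differentiable_theta _ _ _ _
theorem differentiable_S₀ : Differentiable ℂ τ.S₀ := τ.differentiable_theta _ _ _ _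
theorem differentiable_S₁ : Differentiable ℂ τ.S₁ := τ.differentiable_theta _ _ _ _
theorem differentiable_S₂ : Differentiable ℂ τ.S₂ := τ.differentiable_theta _ _ _ _
theorem differentiable_S₃ : Differentiable ℂ τ.S₃ := τ.differentiable_theta _ _ _ _

theorem X₀_zero : τ.X₀ 0 = τ.t := by
  rw [X₀, t, smul_zero, Prod.mk_zero_zero]
theorem X₁_zero : τ.X₁ 0 = τ.u := by
  rw [X₁, u, smul_zero, Prod.mk_zero_zero]
theorem X₂_zero : τ.X₂ 0 = τ.v := by
  rw [X₂, v, smul_zero, Prod.mk_zero_zero]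
theorem X₃_zero : τ.X₃ 0 = τ.w := by
  rw [X₃, w, smul_zero, Prod.mk_zero_zero]

theorem P₀_zero_sq : τ.P₀ 0 ^ 2 = τ.t ^ 2 - τ.u ^ 2 - τ.v ^ 2 + τ.w ^ 2 := by
  rw [P₀_sq, X₀_zero, X₁_zero, X₂_zero, X₃_zero]; ring
theorem P₁_zero_sq : τ.P₁ 0 ^ 2 = τ.t ^ 2 + τ.u ^ 2 - τ.v ^ 2 - τ.w ^ 2 := by
  rw [P₁_sq, X₀_zero, X₁_zero, X₂_zero, X₃_zero]; ring
theorem P₂_zero_sq : τ.P₂ 0 ^ 2 = τ.t ^ 2 - τ.u ^ 2 + τ.v ^ 2 - τ.w ^ 2 := by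
  rw [P₂_sq, X₀_zero, X₁_zero, X₂_zero, X₃_zero]; ring
theorem P₃_zero_sq : τ.P₃ 0 ^ 2 = τ.t ^ 2 + τ.u ^ 2 + τ.v ^ 2 + τ.w ^ 2 := by
  rw [P₃_sq, X₀_zero, X₁_zero, X₂_zero, X₃_zero]; ring
theorem S₀_zero_sq : τ.S₀ 0 ^ 2 = 2 * (τ.t * τ.w - τ.u * τ.v) := by
  rw [S₀_sq, X₀_zero, X₁_zero, X₂_zero, X₃_zero]; ring
theorem S₁_zero : τ.S₁ 0 = 0 := by
  rw [← sq_eq_zero_iff, S₁_sq, X₀_zero, X₁_zero, X₂_zero, X₃_zero]; ring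
theorem S₂_zero : τ.S₂ 0 = 0 := by
  rw [← sq_eq_zero_iff, S₂_sq, X₀_zero, X₁_zero, X₂_zero, X₃_zero]; ring
theorem S₃_zero_sq : τ.S₃ 0 ^ 2 = 2 * (τ.t * τ.w + τ.u * τ.v) := by
  rw [S₃_sq, X₀_zero, X₁_zero, X₂_zero, X₃_zero]; ring

theorem bigTheta_neg_half_neg_half (z : ℂ × ℂ) :
    τ.bigTheta (-1 / 2) (-1 / 2) 0 0 z = τ.bigTheta (1 / 2) (1 / 2) 0 0 (-z) := by
  rw [bigTheta_eq_double_theta, bigTheta_eq_double_theta, theta_neg]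
  norm_num

theorem bigTheta_neg_half_half (z : ℂ × ℂ) :
    τ.bigTheta (-1 / 2) (1 / 2) 0 0 z = τ.bigTheta (1 / 2) (-1 / 2) 0 0 (-z) := by
  rw [bigTheta_eq_double_theta, bigTheta_eq_double_theta, theta_neg]
  norm_num

/-- The even combination of `S₃P₃` and `S₀P₀` that is proportional to the coefficient of `ν`. -/
noncomputable def evenν (z : ℂ × ℂ) : ℂ := (τ.S₃ z * τ.P₃ z - τ.S₀ z * τ.P₀ z) / 2

/-- The even combination of `S₃P₃` and `S₀P₀` that is proportional to the coefficient of `μ`. -/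
noncomputable def evenμ (z : ℂ × ℂ) : ℂ := (τ.S₃ z * τ.P₃ z + τ.S₀ z * τ.P₀ z) / 2

theorem differentiable_evenν : Differentiable ℂ τ.evenν := by
  change Differentiable ℂ fun z => (τ.S₃ z * τ.P₃ z - τ.S₀ z * τ.P₀ z) / 2
  simp only [div_eq_mul_inv]
  exact ((τ.differentiable_S₃.mul τ.differentiable_P₃).sub
    (τ.differentiable_S₀.mul τ.differentiable_P₀)).mul_const _

/-- Opposite half characteristics have equal values at the origin, so at w = 0 the terms pair up and
half the difference of the two products isolates one pair. -/
theorem evenν_eq (z : ℂ × ℂ) : τ.evenν z = τ.bigTheta (1 / 2) (1 / 2) 0 0 (0, 0) *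
    (τ.bigTheta (1 / 2) (1 / 2) 0 0 ((2 : ℂ) • z)
      + τ.bigTheta (-1 / 2) (-1 / 2) 0 0 ((2 : ℂ) • z)) := by
  have h3 := τ.S₃_add_mul_P₃_sub z 0
  have h0 := τ.S₀_add_mul_P₀_sub z 0
  have e1 := τ.bigTheta_neg_half_neg_half 0
  have e2 := τ.bigTheta_neg_half_half 0
  simp only [add_zero, sub_zero, smul_zero, neg_zero] at h3 h0 e1 e2
  rw [e1, e2] at h3 h0
  rw [evenν, h3, h0, Prod.mk_zero_zero]
  ring

theorem evenμ_eq (z : ℂ × ℂ) : τ.evenμ z = τ.bigTheta (1 / 2) (-1 / 2) 0 0 (0, 0) *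
    (τ.bigTheta (1 / 2) (-1 / 2) 0 0 ((2 : ℂ) • z)
      + τ.bigTheta (-1 / 2) (1 / 2) 0 0 ((2 : ℂ) • z)) := by
  have h3 := τ.S₃_add_mul_P₃_sub z 0
  have h0 := τ.S₀_add_mul_P₀_sub z 0
  have e1 := τ.bigTheta_neg_half_neg_half 0
  have e2 := τ.bigTheta_neg_half_half 0
  simp only [add_zero, sub_zero, smul_zero, neg_zero] at h3 h0 e1 e2
  rw [e1, e2] at h3 h0
  rw [evenμ, h3, h0, Prod.mk_zero_zero]
  ring

/-- This guarantees that the theta constants by which ν and μ are divided do not vanish: the right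
side is a product of two quantities assumed nonzero. -/
theorem evenν_zero_mul_evenμ_zero : τ.evenν 0 * τ.evenμ 0
    = (τ.t * τ.u + τ.v * τ.w) * (τ.t * τ.v + τ.u * τ.w) := by
  rw [evenν, evenμ]
  linear_combination (1 / 4 : ℂ) * (τ.S₃ 0 ^ 2 * τ.P₃_zero_sq
    + (τ.t ^ 2 + τ.u ^ 2 + τ.v ^ 2 + τ.w ^ 2) * τ.S₃_zero_sq - τ.S₀ 0 ^ 2 * τ.P₀_zero_sq
    - (τ.t ^ 2 - τ.u ^ 2 - τ.v ^ 2 + τ.w ^ 2) * τ.S₀_zero_sq)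

variable {τ}

theorem Nondegenerate.evenν_zero_ne (h : τ.Nondegenerate) : τ.evenν 0 ≠ 0 := fun h0 => by
  have h1 := τ.evenν_zero_mul_evenμ_zero
  rw [h0, zero_mul] at h1
  exact mul_ne_zero h.tuvw_add h.tvuw_add h1.symm

theorem Nondegenerate.evenμ_zero_ne (h : τ.Nondegenerate) : τ.evenμ 0 ≠ 0 := fun h0 => by
  have h1 := τ.evenν_zero_mul_evenμ_zero
  rw [h0, mul_zero] at h1
  exact mul_ne_zero h.tuvw_add h.tvuw_add h1.symm

theorem Nondegenerate.bigTheta_half_half_ne (h : τ.Nondegenerate) :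
    τ.bigTheta (1 / 2) (1 / 2) 0 0 (0, 0) ≠ 0 :=
  left_ne_zero_of_mul (τ.evenν_eq 0 ▸ h.evenν_zero_ne)

theorem Nondegenerate.bigTheta_half_neg_half_ne (h : τ.Nondegenerate) :
    τ.bigTheta (1 / 2) (-1 / 2) 0 0 (0, 0) ≠ 0 :=
  left_ne_zero_of_mul (τ.evenμ_eq 0 ▸ h.evenμ_zero_ne)

theorem Nondegenerate.P₁_zero_ne (h : τ.Nondegenerate) : τ.P₁ 0 ≠ 0 := fun h0 => by
  have h1 := τ.P₁_zero_sq
  rw [h0] at h1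
  exact h.sq_one (by linear_combination -h1)

theorem Nondegenerate.P₂_zero_ne (h : τ.Nondegenerate) : τ.P₂ 0 ≠ 0 := fun h0 => by
  have h1 := τ.P₂_zero_sq
  rw [h0] at h1
  exact h.sq_two (by linear_combination -h1)

theorem hasFDerivAt_reflect {f g : ℂ × ℂ → ℂ} (hf : Differentiable ℂ f)
    (hg : ∀ z, g z = f (-z)) : HasFDerivAt g (-fderiv ℂ f 0) 0 := by
  have h0 : HasFDerivAt f (fderiv ℂ f 0) (-(0 : ℂ × ℂ)) := by
    rw [neg_zero]; exact (hf 0).hasFDerivAt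
  have h1 := h0.comp (0 : ℂ × ℂ) (hasFDerivAt_id (𝕜 := ℂ) (0 : ℂ × ℂ)).neg
  have h2 : g = f ∘ Neg.neg := funext hg
  rw [h2]
  exact h1.congr_fderiv (by ext <;> simp)

theorem deriv_sub_reflect {f g : ℂ × ℂ → ℂ} (hf : Differentiable ℂ f)
    (hg : ∀ z, g z = f (-z)) (e : ℂ × ℂ) (l : ℂ → ℂ × ℂ) (hl : ∀ s, l s = s • e) :
    deriv (fun s : ℂ => f (l s) - g (l s)) 0 = 2 * fderiv ℂ f 0 e := by
  obtain rfl : l = fun s => s • e := funext hl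
  have hl' : HasDerivAt (fun s : ℂ => s • e) e 0 := by
    simpa using (hasDerivAt_id (0 : ℂ)).smul_const e
  have h1 : HasFDerivAt f (fderiv ℂ f 0) ((0 : ℂ) • e) := by
    rw [zero_smul]; exact (hf 0).hasFDerivAt
  have h2 : HasFDerivAt g (-fderiv ℂ f 0) ((0 : ℂ) • e) := by
    rw [zero_smul]; exact hasFDerivAt_reflect hf hg
  have := (h1.comp_hasDerivAt (0 : ℂ) hl').sub (h2.comp_hasDerivAt (0 : ℂ) hl')
  refine this.deriv.trans ?_
  rw [neg_apply]
  ring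

theorem apply_eq_fst_add_snd (φ : ℂ × ℂ →L[ℂ] ℂ) (e : ℂ × ℂ) :
    φ e = φ (1, 0) * e.1 + φ (0, 1) * e.2 := by
  conv_lhs => rw [show e = e.1 • ((1 : ℂ), (0 : ℂ)) + e.2 • ((0 : ℂ), (1 : ℂ)) by ext <;> simp]
  rw [map_add, map_smul, map_smul, smul_eq_mul, smul_eq_mul]
  ring

variable (τ)

theorem fderiv_bigTheta_half_half (e : ℂ × ℂ) :
    2 * fderiv ℂ (τ.bigTheta (1 / 2) (1 / 2) 0 0) 0 e = τ.α * e.1 + τ.γ * e.2 := by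
  have hd := τ.differentiable_bigTheta (1 / 2) (1 / 2) 0 0
  have h1 := deriv_sub_reflect hd τ.bigTheta_neg_half_neg_half (1, 0) (fun s => (s, 0)) (by simp)
  have h2 := deriv_sub_reflect hd τ.bigTheta_neg_half_neg_half (0, 1) (fun s => (0, s)) (by simp)
  rw [α, γ, h1, h2, apply_eq_fst_add_snd]
  ring

theorem fderiv_bigTheta_half_neg_half (e : ℂ × ℂ) :
    2 * fderiv ℂ (τ.bigTheta (1 / 2) (-1 / 2) 0 0) 0 e = τ.β * e.1 + τ.δ * e.2 := by
  have hd := τ.differentiable_bigTheta (1 / 2) (-1 / 2) 0 0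
  have h1 := deriv_sub_reflect hd τ.bigTheta_neg_half_half (1, 0) (fun s => (s, 0)) (by simp)
  have h2 := deriv_sub_reflect hd τ.bigTheta_neg_half_half (0, 1) (fun s => (0, s)) (by simp)
  rw [β, δ, h1, h2, apply_eq_fst_add_snd]
  ring

theorem ν_apply (e : ℂ × ℂ) (h : τ.bigTheta (1 / 2) (1 / 2) 0 0 (0, 0) ≠ 0) :
    τ.bigTheta (1 / 2) (1 / 2) 0 0 (0, 0) * τ.ν e
      = 2 * I * fderiv ℂ (τ.bigTheta (1 / 2) (1 / 2) 0 0) 0 e := by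
  have h1 := τ.fderiv_bigTheta_half_half e
  simp only [ν, _root_.smul_apply, _root_.add_apply, smul_eq_mul,
    ContinuousLinearMap.coe_fst', ContinuousLinearMap.coe_snd']
  rw [← mul_assoc, mul_div_cancel₀ _ h]
  linear_combination -I * h1

theorem μ_apply (e : ℂ × ℂ) (h : τ.bigTheta (1 / 2) (-1 / 2) 0 0 (0, 0) ≠ 0) :
    τ.bigTheta (1 / 2) (-1 / 2) 0 0 (0, 0) * τ.μ e
      = -2 * I * fderiv ℂ (τ.bigTheta (1 / 2) (-1 / 2) 0 0) 0 e := by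
  have h1 := τ.fderiv_bigTheta_half_neg_half e
  simp only [μ, _root_.smul_apply, _root_.add_apply, smul_eq_mul,
    ContinuousLinearMap.coe_fst', ContinuousLinearMap.coe_snd']
  rw [← mul_assoc, mul_div_cancel₀ _ h]
  linear_combination I * h1

/-! ### The Wronskians of S₁, P₁ and of S₂, P₂. -/

theorem hasFDerivAt_add_mul_sub {f g : ℂ × ℂ → ℂ} (hf : Differentiable ℂ f)
    (hg : Differentiable ℂ g) (z : ℂ × ℂ) :
    HasFDerivAt (fun w => f (z + w) * g (z - w)) (g z • fderiv ℂ f z - f z • fderiv ℂ g z) 0 := by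
  have hf1 : HasFDerivAt f (fderiv ℂ f z) (z + id 0) := by simpa using (hf z).hasFDerivAt
  have hg1 : HasFDerivAt g (fderiv ℂ g z) (z - id 0) := by simpa using (hg z).hasFDerivAt
  have h1 := hf1.comp 0 ((hasFDerivAt_id (𝕜 := ℂ) (0 : ℂ × ℂ)).const_add z)
  have h2 := hg1.comp 0 ((hasFDerivAt_id (𝕜 := ℂ) (0 : ℂ × ℂ)).const_sub z)
  have h3 := h1.mul h2
  refine h3.congr_fderiv ?_
  ext <;> simp <;> ring

theorem hasFDerivAt_double {f : ℂ × ℂ → ℂ} {f' : ℂ × ℂ →L[ℂ] ℂ} (hf : HasFDerivAt f f' 0) :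
    HasFDerivAt (fun w : ℂ × ℂ => f ((2 : ℂ) • w)) ((2 : ℂ) • f') 0 := by
  have hf1 : HasFDerivAt f f' ((2 : ℂ) • id (0 : ℂ × ℂ)) := by simpa using hf
  have h1 := hf1.comp 0 ((hasFDerivAt_id (𝕜 := ℂ) (0 : ℂ × ℂ)).const_smul (2 : ℂ))
  refine h1.congr_fderiv ?_
  ext <;> simp

variable {τ}

/-- Both sides of the addition formula are differentiated in w at w = 0. Opposite half
characteristics have opposite gradients there, so each gradient is multiplied by an even sum of
theta functions at 2z. -/
theorem Nondegenerate.wronskian₁ (h : τ.Nondegenerate) (z e : ℂ × ℂ) :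
    τ.P₁ z * fderiv ℂ τ.S₁ z e - τ.S₁ z * fderiv ℂ τ.P₁ z e
      = τ.evenν z * τ.ν e + τ.evenμ z * τ.μ e := by
  have h1 := hasFDerivAt_add_mul_sub τ.differentiable_S₁ τ.differentiable_P₁ z
  have hp := τ.differentiable_bigTheta (1 / 2) (1 / 2) 0 0
  have hm := τ.differentiable_bigTheta (1 / 2) (-1 / 2) 0 0
  have d1 := hasFDerivAt_double (hp 0).hasFDerivAt
  have d2 := hasFDerivAt_double (hm 0).hasFDerivAt
  have d3 := hasFDerivAt_double (hasFDerivAt_reflect hp τ.bigTheta_neg_half_neg_half)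
  have d4 := hasFDerivAt_double (hasFDerivAt_reflect hm τ.bigTheta_neg_half_half)
  have h2 := (((((d1.const_mul (τ.bigTheta (1 / 2) (1 / 2) 0 0 ((2 : ℂ) • z))).add
    (d4.const_mul (τ.bigTheta (-1 / 2) (1 / 2) 0 0 ((2 : ℂ) • z)))).sub
    (d2.const_mul (τ.bigTheta (1 / 2) (-1 / 2) 0 0 ((2 : ℂ) • z)))).sub
    (d3.const_mul (τ.bigTheta (-1 / 2) (-1 / 2) 0 0 ((2 : ℂ) • z)))).const_mul I)
  simp only [τ.S₁_add_mul_P₁_sub] at h1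
  have h3 := congrArg (fun φ : ℂ × ℂ →L[ℂ] ℂ => φ e) (h1.unique h2)
  simp only [_root_.smul_apply, _root_.add_apply, _root_.sub_apply, _root_.neg_apply,
    smul_eq_mul] at h3
  rw [h3, evenν_eq, evenμ_eq]
  linear_combination
    -(τ.bigTheta (1 / 2) (1 / 2) 0 0 ((2 : ℂ) • z)
      + τ.bigTheta (-1 / 2) (-1 / 2) 0 0 ((2 : ℂ) • z)) * τ.ν_apply e h.bigTheta_half_half_ne
    - (τ.bigTheta (1 / 2) (-1 / 2) 0 0 ((2 : ℂ) • z)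
      + τ.bigTheta (-1 / 2) (1 / 2) 0 0 ((2 : ℂ) • z)) * τ.μ_apply e h.bigTheta_half_neg_half_ne

theorem Nondegenerate.wronskian₂ (h : τ.Nondegenerate) (z e : ℂ × ℂ) :
    τ.P₂ z * fderiv ℂ τ.S₂ z e - τ.S₂ z * fderiv ℂ τ.P₂ z e
      = τ.evenν z * τ.ν e - τ.evenμ z * τ.μ e := by
  have h1 := hasFDerivAt_add_mul_sub τ.differentiable_S₂ τ.differentiable_P₂ z
  have hp := τ.differentiable_bigTheta (1 / 2) (1 / 2) 0 0
  have hm := τ.differentiable_bigTheta (1 / 2) (-1 / 2) 0 0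
  have d1 := hasFDerivAt_double (hp 0).hasFDerivAt
  have d2 := hasFDerivAt_double (hm 0).hasFDerivAt
  have d3 := hasFDerivAt_double (hasFDerivAt_reflect hp τ.bigTheta_neg_half_neg_half)
  have d4 := hasFDerivAt_double (hasFDerivAt_reflect hm τ.bigTheta_neg_half_half)
  have h2 := (((((d1.const_mul (τ.bigTheta (1 / 2) (1 / 2) 0 0 ((2 : ℂ) • z))).sub
    (d4.const_mul (τ.bigTheta (-1 / 2) (1 / 2) 0 0 ((2 : ℂ) • z)))).add
    (d2.const_mul (τ.bigTheta (1 / 2) (-1 / 2) 0 0 ((2 : ℂ) • z)))).sub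
    (d3.const_mul (τ.bigTheta (-1 / 2) (-1 / 2) 0 0 ((2 : ℂ) • z)))).const_mul I)
  simp only [τ.S₂_add_mul_P₂_sub] at h1
  have h3 := congrArg (fun φ : ℂ × ℂ →L[ℂ] ℂ => φ e) (h1.unique h2)
  simp only [_root_.smul_apply, _root_.add_apply, _root_.sub_apply, _root_.neg_apply,
    smul_eq_mul] at h3
  rw [h3, evenν_eq, evenμ_eq]
  linear_combination
    -(τ.bigTheta (1 / 2) (1 / 2) 0 0 ((2 : ℂ) • z)
      + τ.bigTheta (-1 / 2) (-1 / 2) 0 0 ((2 : ℂ) • z)) * τ.ν_apply e h.bigTheta_half_half_ne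
    + (τ.bigTheta (1 / 2) (-1 / 2) 0 0 ((2 : ℂ) • z)
      + τ.bigTheta (-1 / 2) (1 / 2) 0 0 ((2 : ℂ) • z)) * τ.μ_apply e h.bigTheta_half_neg_half_ne

end Period

/-! ### Polynomial identities behind the Kummer quartic. -/

section Generic

variable {T U a b s α β γ δ p₁ p₂ s₁ s₂ π₀ σ₀ : ℂ}

/-- The quartic relation with all denominators cleared. -/
theorem kummer_cleared
    (hα : 4 * (T ^ 2 - 4 * a ^ 2) * α ^ 2
      = (T * (p₁ ^ 2 + p₂ ^ 2) - 2 * a * (s₁ ^ 2 + s₂ ^ 2)) ^ 2)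
    (hβ : 4 * (U ^ 2 - 4 * b ^ 2) * β ^ 2
      = (U * (p₁ ^ 2 - p₂ ^ 2) - 2 * b * (s₁ ^ 2 - s₂ ^ 2)) ^ 2)
    (hπ : (T ^ 2 - 4 * a ^ 2 - (U ^ 2 - 4 * b ^ 2)) * (α ^ 2 - β ^ 2)
      = (T ^ 2 - U ^ 2) * (p₁ * p₂) ^ 2 + 4 * (a ^ 2 - b ^ 2) * (s₁ * s₂) ^ 2
        - 4 * s * (p₁ * p₂ * s₁ * s₂)) :
    (T ^ 2 - 4 * a ^ 2 - (U ^ 2 - 4 * b ^ 2)) *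
      ((U ^ 2 - 4 * b ^ 2) * (T * (p₁ ^ 2 + p₂ ^ 2) - 2 * a * (s₁ ^ 2 + s₂ ^ 2)) ^ 2
        - (T ^ 2 - 4 * a ^ 2) * (U * (p₁ ^ 2 - p₂ ^ 2) - 2 * b * (s₁ ^ 2 - s₂ ^ 2)) ^ 2)
      = 4 * (T ^ 2 - 4 * a ^ 2) * (U ^ 2 - 4 * b ^ 2) *
        ((T ^ 2 - U ^ 2) * (p₁ * p₂) ^ 2 + 4 * (a ^ 2 - b ^ 2) * (s₁ * s₂) ^ 2
        - 4 * s * (p₁ * p₂ * s₁ * s₂)) := by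
  rw [← hα, ← hβ, ← hπ]
  ring

/-- In the application T = t² + w², U = u² + v², a = tw, b = uv and s is `rootD`; T² − 4a² and U² −
4b² are then the squares of t² − w² and u² − v². Multiplying the quartic by a nonzero constant and
inserting the four coefficient formulas turns it into the cleared relation `h`. -/
theorem kummer_quartic_generic {E F C D : ℂ}
    (hE : E * (2 * (b * T + a * U)) = U * T + 4 * a * b)
    (hC : C * (2 * (b * T - a * U)) = U * T - 4 * a * b)
    (hF : F * (T ^ 2 - 4 * a ^ 2 - (U ^ 2 - 4 * b ^ 2))
      = T ^ 2 - 4 * a ^ 2 + (U ^ 2 - 4 * b ^ 2))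
    (hD : D * ((T ^ 2 - 4 * a ^ 2 - (U ^ 2 - 4 * b ^ 2)) * (b ^ 2 * T ^ 2 - a ^ 2 * U ^ 2))
      = (T ^ 2 - 4 * a ^ 2) * (U ^ 2 - 4 * b ^ 2) * s)
    (hc : T ^ 2 - 4 * a ^ 2 - (U ^ 2 - 4 * b ^ 2) ≠ 0) (hN : b ^ 2 * T ^ 2 - a ^ 2 * U ^ 2 ≠ 0)
    (h : (T ^ 2 - 4 * a ^ 2 - (U ^ 2 - 4 * b ^ 2)) *
      ((U ^ 2 - 4 * b ^ 2) * (T * (p₁ ^ 2 + p₂ ^ 2) - 2 * a * (s₁ ^ 2 + s₂ ^ 2)) ^ 2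
        - (T ^ 2 - 4 * a ^ 2) * (U * (p₁ ^ 2 - p₂ ^ 2) - 2 * b * (s₁ ^ 2 - s₂ ^ 2)) ^ 2)
      = 4 * (T ^ 2 - 4 * a ^ 2) * (U ^ 2 - 4 * b ^ 2) *
        ((T ^ 2 - U ^ 2) * (p₁ * p₂) ^ 2 + 4 * (a ^ 2 - b ^ 2) * (s₁ * s₂) ^ 2
        - 4 * s * (p₁ * p₂ * s₁ * s₂))) :
    p₁ ^ 4 + s₁ ^ 4 + p₂ ^ 4 + s₂ ^ 4 - 2 * E * (p₁ ^ 2 * s₁ ^ 2 + p₂ ^ 2 * s₂ ^ 2)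
      - 2 * F * (p₁ ^ 2 * p₂ ^ 2 + s₁ ^ 2 * s₂ ^ 2) + 2 * C * (p₁ ^ 2 * s₂ ^ 2 + p₂ ^ 2 * s₁ ^ 2)
      - 4 * D * (p₁ * p₂ * s₁ * s₂) = 0 := by
  have h4 : (-4 : ℂ) * ((T ^ 2 - 4 * a ^ 2 - (U ^ 2 - 4 * b ^ 2))
      * (b ^ 2 * T ^ 2 - a ^ 2 * U ^ 2)) ≠ 0 := mul_ne_zero (by norm_num) (mul_ne_zero hc hN)
  refine (mul_eq_zero.1 ?_).resolve_left h4
  linear_combination h + 4 * (T ^ 2 - 4 * a ^ 2 - (U ^ 2 - 4 * b ^ 2)) * (b * T - a * U)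
      * (p₁ ^ 2 * s₁ ^ 2 + p₂ ^ 2 * s₂ ^ 2) * hE
    + 8 * (b ^ 2 * T ^ 2 - a ^ 2 * U ^ 2) * (p₁ ^ 2 * p₂ ^ 2 + s₁ ^ 2 * s₂ ^ 2) * hF
    - 4 * (T ^ 2 - 4 * a ^ 2 - (U ^ 2 - 4 * b ^ 2)) * (b * T + a * U)
      * (p₁ ^ 2 * s₂ ^ 2 + p₂ ^ 2 * s₁ ^ 2) * hC
    + 16 * (p₁ * p₂ * s₁ * s₂) * hD

/-- With P₃² = α + β, P₀² = α − β, S₃² = γ + δ and S₀² = γ − δ, the left side is the square of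
`evenν`. The products αγ and βδ contain fourth powers of the pᵢ and sᵢ; a multiple of the cleared
quartic relation removes them. -/
theorem evenν_sq_generic {B n E₁ Q : ℂ}
    (hs : s ^ 2 = (T ^ 2 - U ^ 2) * (a ^ 2 - b ^ 2))
    (hB : B * (T ^ 2 - 4 * a ^ 2 - (U ^ 2 - 4 * b ^ 2)) = 4 * (a * T + b * U + s))
    (hn : n * (b * T - a * U) = b * T + a * U)
    (hE₁ : E₁ * (2 * (b ^ 2 * T ^ 2 - a ^ 2 * U ^ 2))
      = a * T * (T ^ 2 - 4 * a ^ 2 - (U ^ 2 - 4 * b ^ 2)) - (T ^ 2 - 4 * a ^ 2) * s)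
    (hc : T ^ 2 - 4 * a ^ 2 - (U ^ 2 - 4 * b ^ 2) ≠ 0) (hN : b ^ 2 * T ^ 2 - a ^ 2 * U ^ 2 ≠ 0)
    (hA : T ^ 2 - 4 * a ^ 2 ≠ 0) (hB' : U ^ 2 - 4 * b ^ 2 ≠ 0)
    (hαγ : 4 * (T ^ 2 - 4 * a ^ 2) * (α * γ) = (T * (p₁ ^ 2 + p₂ ^ 2) - 2 * a * (s₁ ^ 2 + s₂ ^ 2))
      * (2 * a * (p₁ ^ 2 + p₂ ^ 2) - T * (s₁ ^ 2 + s₂ ^ 2)))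
    (hβδ : 4 * (U ^ 2 - 4 * b ^ 2) * (β * δ) = (U * (p₁ ^ 2 - p₂ ^ 2) - 2 * b * (s₁ ^ 2 - s₂ ^ 2))
      * (2 * b * (p₁ ^ 2 - p₂ ^ 2) - U * (s₁ ^ 2 - s₂ ^ 2)))
    (hQ : (T ^ 2 - 4 * a ^ 2 - (U ^ 2 - 4 * b ^ 2)) * Q = -2 * s * ((p₁ * p₂) ^ 2 + (s₁ * s₂) ^ 2)
      + (T ^ 2 - U ^ 2 + 4 * a ^ 2 - 4 * b ^ 2) * (p₁ * p₂ * s₁ * s₂))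
    (h : (T ^ 2 - 4 * a ^ 2 - (U ^ 2 - 4 * b ^ 2)) *
      ((U ^ 2 - 4 * b ^ 2) * (T * (p₁ ^ 2 + p₂ ^ 2) - 2 * a * (s₁ ^ 2 + s₂ ^ 2)) ^ 2
        - (T ^ 2 - 4 * a ^ 2) * (U * (p₁ ^ 2 - p₂ ^ 2) - 2 * b * (s₁ ^ 2 - s₂ ^ 2)) ^ 2)
      = 4 * (T ^ 2 - 4 * a ^ 2) * (U ^ 2 - 4 * b ^ 2) *
        ((T ^ 2 - U ^ 2) * (p₁ * p₂) ^ 2 + 4 * (a ^ 2 - b ^ 2) * (s₁ * s₂) ^ 2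
        - 4 * s * (p₁ * p₂ * s₁ * s₂))) :
    (α * γ + β * δ - Q) / 2 = B / 4 * ((p₁ * p₂) ^ 2 + (s₁ * s₂) ^ 2)
      - n / 4 * ((s₁ * p₂) ^ 2 + (s₂ * p₁) ^ 2)
      + (n - B * E₁) / 2 * (p₁ * p₂ * s₁ * s₂) := by
  have hBE : B * E₁ * ((T ^ 2 - 4 * a ^ 2 - (U ^ 2 - 4 * b ^ 2))
      * (b ^ 2 * T ^ 2 - a ^ 2 * U ^ 2)) = 2 * ((a * T + b * U) * a * T
        * (T ^ 2 - 4 * a ^ 2 - (U ^ 2 - 4 * b ^ 2))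
        + s * (a * T * (T ^ 2 - 4 * a ^ 2 - (U ^ 2 - 4 * b ^ 2))
          - (T ^ 2 - 4 * a ^ 2) * (a * T + b * U))
        - (T ^ 2 - 4 * a ^ 2) * ((T ^ 2 - U ^ 2) * (a ^ 2 - b ^ 2))) := by
    linear_combination E₁ * (b ^ 2 * T ^ 2 - a ^ 2 * U ^ 2) * hB
      + 2 * (a * T + b * U + s) * hE₁ - 2 * (T ^ 2 - 4 * a ^ 2) * hs
  have h4 : (8 : ℂ) * ((T ^ 2 - 4 * a ^ 2) * (U ^ 2 - 4 * b ^ 2)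
      * ((T ^ 2 - 4 * a ^ 2 - (U ^ 2 - 4 * b ^ 2)) * (b ^ 2 * T ^ 2 - a ^ 2 * U ^ 2))) ≠ 0 :=
    mul_ne_zero (by norm_num) (mul_ne_zero (mul_ne_zero hA hB') (mul_ne_zero hc hN))
  refine mul_left_cancel₀ h4 ?_
  generalize hA2 : T ^ 2 - 4 * a ^ 2 = A₂ at *
  generalize hB2 : U ^ 2 - 4 * b ^ 2 = B₂ at *
  subst hA2 hB2
  linear_combination
    (U ^ 2 - 4 * b ^ 2) * ((T ^ 2 - 4 * a ^ 2 - (U ^ 2 - 4 * b ^ 2))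
      * (b ^ 2 * T ^ 2 - a ^ 2 * U ^ 2)) * hαγ
    + (T ^ 2 - 4 * a ^ 2) * ((T ^ 2 - 4 * a ^ 2 - (U ^ 2 - 4 * b ^ 2))
      * (b ^ 2 * T ^ 2 - a ^ 2 * U ^ 2)) * hβδ
    - 4 * (T ^ 2 - 4 * a ^ 2) * (U ^ 2 - 4 * b ^ 2) * (b ^ 2 * T ^ 2 - a ^ 2 * U ^ 2) * hQ
    - 2 * (T ^ 2 - 4 * a ^ 2) * (U ^ 2 - 4 * b ^ 2) * (b ^ 2 * T ^ 2 - a ^ 2 * U ^ 2)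
      * ((p₁ * p₂) ^ 2 + (s₁ * s₂) ^ 2) * hB
    + (2 * (T ^ 2 - 4 * a ^ 2) * (U ^ 2 - 4 * b ^ 2)
      * (T ^ 2 - 4 * a ^ 2 - (U ^ 2 - 4 * b ^ 2)) * (b * T + a * U)
      * ((s₁ * p₂) ^ 2 + (s₂ * p₁) ^ 2 - 2 * (p₁ * p₂ * s₁ * s₂))) * hn
    + 4 * (T ^ 2 - 4 * a ^ 2) * (U ^ 2 - 4 * b ^ 2) * (p₁ * p₂ * s₁ * s₂) * hBE
    - (b * T + a * U) * (U * T - 4 * a * b) / 2 * h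

/-- Each product pairs a form in sums (index 1 plus index 2) with a form in differences (index 1
minus index 2), and the mixed terms cancel between the two products. No quartic relation is needed,
so the constant is explicit and not just known up to sign. -/
theorem evenν_mul_evenμ_generic {A B E : ℂ} (hA : A ≠ 0) (hB : B ≠ 0)
    (hE : E * (2 * (b * T + a * U)) = U * T + 4 * a * b)
    (hα : 2 * A * α = T * (p₁ ^ 2 + p₂ ^ 2) - 2 * a * (s₁ ^ 2 + s₂ ^ 2))
    (hγ : 2 * A * γ = 2 * a * (p₁ ^ 2 + p₂ ^ 2) - T * (s₁ ^ 2 + s₂ ^ 2))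
    (hβ : 2 * B * β = U * (p₁ ^ 2 - p₂ ^ 2) - 2 * b * (s₁ ^ 2 - s₂ ^ 2))
    (hδ : 2 * B * δ = 2 * b * (p₁ ^ 2 - p₂ ^ 2) - U * (s₁ ^ 2 - s₂ ^ 2)) :
    (α * δ + β * γ) / 2 = -(b * T + a * U) / (4 * A * B) *
      ((p₂ ^ 4 - 2 * E * p₂ ^ 2 * s₂ ^ 2 + s₂ ^ 4) - (p₁ ^ 4 - 2 * E * p₁ ^ 2 * s₁ ^ 2 + s₁ ^ 4)) := by
  have h1 : (2 * A * α) * (2 * B * δ) + (2 * B * β) * (2 * A * γ) = -2 * (b * T + a * U) *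
      ((p₂ ^ 4 - 2 * E * p₂ ^ 2 * s₂ ^ 2 + s₂ ^ 4)
        - (p₁ ^ 4 - 2 * E * p₁ ^ 2 * s₁ ^ 2 + s₁ ^ 4)) := by
    rw [hα, hγ, hβ, hδ]
    linear_combination -2 * (p₂ ^ 2 * s₂ ^ 2 - p₁ ^ 2 * s₁ ^ 2) * hE
  rw [div_mul_eq_mul_div, div_eq_div_iff two_ne_zero
    (mul_ne_zero (mul_ne_zero (by norm_num) hA) hB)]
  linear_combination h1

/-- The classical relation between the coefficients of a Kummer quartic. It factors in several ways,
for instance (CF − E)² − D² = (C² − 1)(F² − 1), and thereby controls which parameter combinations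
can vanish. -/
theorem discriminant_generic {E F C D : ℂ}
    (hs : s ^ 2 = (T ^ 2 - U ^ 2) * (a ^ 2 - b ^ 2))
    (hE : E * (2 * (b * T + a * U)) = U * T + 4 * a * b)
    (hC : C * (2 * (b * T - a * U)) = U * T - 4 * a * b)
    (hF : F * (T ^ 2 - 4 * a ^ 2 - (U ^ 2 - 4 * b ^ 2))
      = T ^ 2 - 4 * a ^ 2 + (U ^ 2 - 4 * b ^ 2))
    (hD : D * ((T ^ 2 - 4 * a ^ 2 - (U ^ 2 - 4 * b ^ 2)) * (b ^ 2 * T ^ 2 - a ^ 2 * U ^ 2))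
      = (T ^ 2 - 4 * a ^ 2) * (U ^ 2 - 4 * b ^ 2) * s)
    (hc : T ^ 2 - 4 * a ^ 2 - (U ^ 2 - 4 * b ^ 2) ≠ 0)
    (hN : b ^ 2 * T ^ 2 - a ^ 2 * U ^ 2 ≠ 0) :
    D ^ 2 = C ^ 2 + E ^ 2 + F ^ 2 - 2 * C * E * F - 1 := by
  have h4 : (4 : ℂ) * ((T ^ 2 - 4 * a ^ 2 - (U ^ 2 - 4 * b ^ 2)) ^ 2
      * (b ^ 2 * T ^ 2 - a ^ 2 * U ^ 2) ^ 2) ≠ 0 :=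
    mul_ne_zero (by norm_num) (mul_ne_zero (pow_ne_zero 2 hc) (pow_ne_zero 2 hN))
  have hD2 : (D * ((T ^ 2 - 4 * a ^ 2 - (U ^ 2 - 4 * b ^ 2)) * (b ^ 2 * T ^ 2 - a ^ 2 * U ^ 2))) ^ 2
      = ((T ^ 2 - 4 * a ^ 2) * (U ^ 2 - 4 * b ^ 2)) ^ 2
        * ((T ^ 2 - U ^ 2) * (a ^ 2 - b ^ 2)) := by
    rw [hD, mul_pow, hs]
  have hE2 := congrArg (fun x => x ^ 2) hE
  have hC2 := congrArg (fun x => x ^ 2) hC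
  have hF2 := congrArg (fun x => x ^ 2) hF
  have hCEF : (C * (2 * (b * T - a * U))) * (E * (2 * (b * T + a * U)))
      * (F * (T ^ 2 - 4 * a ^ 2 - (U ^ 2 - 4 * b ^ 2)))
      = (U * T - 4 * a * b) * (U * T + 4 * a * b)
        * (T ^ 2 - 4 * a ^ 2 + (U ^ 2 - 4 * b ^ 2)) := by rw [hC, hE, hF]
  refine mul_left_cancel₀ h4 ?_
  linear_combination 4 * hD2
    - (b * T + a * U) ^ 2 * (T ^ 2 - 4 * a ^ 2 - (U ^ 2 - 4 * b ^ 2)) ^ 2 * hC2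
    - (b * T - a * U) ^ 2 * (T ^ 2 - 4 * a ^ 2 - (U ^ 2 - 4 * b ^ 2)) ^ 2 * hE2
    - 4 * (b ^ 2 * T ^ 2 - a ^ 2 * U ^ 2) ^ 2 * hF2
    + 2 * (b ^ 2 * T ^ 2 - a ^ 2 * U ^ 2) * (T ^ 2 - 4 * a ^ 2 - (U ^ 2 - 4 * b ^ 2)) * hCEF

theorem sub_mul_generic {E F C : ℂ}
    (hE : E * (2 * (b * T + a * U)) = U * T + 4 * a * b)
    (hC : C * (2 * (b * T - a * U)) = U * T - 4 * a * b)
    (hF : F * (T ^ 2 - 4 * a ^ 2 - (U ^ 2 - 4 * b ^ 2))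
      = T ^ 2 - 4 * a ^ 2 + (U ^ 2 - 4 * b ^ 2)) :
    (C * F - E) * ((T ^ 2 - 4 * a ^ 2 - (U ^ 2 - 4 * b ^ 2)) * (b ^ 2 * T ^ 2 - a ^ 2 * U ^ 2))
      = (T ^ 2 - 4 * a ^ 2) * (U ^ 2 - 4 * b ^ 2) * (a * T + b * U) := by
  have hCF : (C * (2 * (b * T - a * U))) * (F * (T ^ 2 - 4 * a ^ 2 - (U ^ 2 - 4 * b ^ 2)))
      = (U * T - 4 * a * b) * (T ^ 2 - 4 * a ^ 2 + (U ^ 2 - 4 * b ^ 2)) := by rw [hC, hF]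
  linear_combination (b * T + a * U) / 2 * hCF
    - (b * T - a * U) / 2 * (T ^ 2 - 4 * a ^ 2 - (U ^ 2 - 4 * b ^ 2)) * hE

end Generic

/-! ### The parameters and the branch points of f₅. -/

namespace Period

variable {τ : Period}

theorem sq_sub_sq_eq (x y : ℂ) :
    (x ^ 2 + y ^ 2) ^ 2 - 4 * (x * y) ^ 2 = (x ^ 2 - y ^ 2) ^ 2 := by ring

section Parameters

theorem Nondegenerate.n₁_ne (h : τ.Nondegenerate) : τ.u * τ.v * (τ.t ^ 2 + τ.w ^ 2)
    + τ.t * τ.w * (τ.u ^ 2 + τ.v ^ 2) ≠ 0 := by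
  have := mul_ne_zero h.tuvw_add h.tvuw_add
  contrapose! this
  linear_combination this

theorem Nondegenerate.n₂_ne (h : τ.Nondegenerate) : τ.u * τ.v * (τ.t ^ 2 + τ.w ^ 2)
    - τ.t * τ.w * (τ.u ^ 2 + τ.v ^ 2) ≠ 0 := by
  have := mul_ne_zero h.tuvw_sub h.tvuw_sub
  contrapose! this
  linear_combination this

theorem Nondegenerate.N_ne (h : τ.Nondegenerate) : (τ.u * τ.v) ^ 2 * (τ.t ^ 2 + τ.w ^ 2) ^ 2
    - (τ.t * τ.w) ^ 2 * (τ.u ^ 2 + τ.v ^ 2) ^ 2 ≠ 0 := by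
  have := mul_ne_zero h.n₁_ne h.n₂_ne
  contrapose! this
  linear_combination this

theorem Nondegenerate.A_ne (h : τ.Nondegenerate) :
    (τ.t ^ 2 + τ.w ^ 2) ^ 2 - 4 * (τ.t * τ.w) ^ 2 ≠ 0 := by
  rw [sq_sub_sq_eq]
  exact pow_ne_zero 2 h.tw

theorem Nondegenerate.B_ne (h : τ.Nondegenerate) :
    (τ.u ^ 2 + τ.v ^ 2) ^ 2 - 4 * (τ.u * τ.v) ^ 2 ≠ 0 := by
  rw [sq_sub_sq_eq]
  exact pow_ne_zero 2 h.uv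

theorem Nondegenerate.c_ne (h : τ.Nondegenerate) : (τ.t ^ 2 + τ.w ^ 2) ^ 2 - 4 * (τ.t * τ.w) ^ 2
    - ((τ.u ^ 2 + τ.v ^ 2) ^ 2 - 4 * (τ.u * τ.v) ^ 2) ≠ 0 := by
  have := mul_ne_zero h.sq_one h.sq_two
  contrapose! this
  linear_combination this

variable (τ) in
theorem rootD_sq : τ.rootD ^ 2 = ((τ.t ^ 2 + τ.w ^ 2) ^ 2 - (τ.u ^ 2 + τ.v ^ 2) ^ 2)
    * ((τ.t * τ.w) ^ 2 - (τ.u * τ.v) ^ 2) := by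
  rw [rootD, Prod.mk_zero_zero, div_pow, neg_sq, mul_pow, mul_pow, mul_pow, P₃_zero_sq, P₀_zero_sq,
    S₃_zero_sq, S₀_zero_sq]
  ring

theorem Nondegenerate.E_mul (h : τ.Nondegenerate) :
    τ.E * (2 * (τ.u * τ.v * (τ.t ^ 2 + τ.w ^ 2) + τ.t * τ.w * (τ.u ^ 2 + τ.v ^ 2)))
      = (τ.u ^ 2 + τ.v ^ 2) * (τ.t ^ 2 + τ.w ^ 2) + 4 * (τ.t * τ.w) * (τ.u * τ.v) := by
  have h0 : 2 * (τ.t * τ.u + τ.v * τ.w) * (τ.t * τ.v + τ.u * τ.w) ≠ 0 :=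
    mul_ne_zero (mul_ne_zero two_ne_zero h.tuvw_add) h.tvuw_add
  have h1 := div_mul_cancel₀ (τ.t ^ 2 * τ.u ^ 2 + τ.t ^ 2 * τ.v ^ 2 + τ.u ^ 2 * τ.w ^ 2
    + τ.v ^ 2 * τ.w ^ 2 + 4 * τ.t * τ.u * τ.v * τ.w) h0
  rw [← E] at h1
  linear_combination h1

theorem Nondegenerate.C_mul (h : τ.Nondegenerate) :
    τ.C * (2 * (τ.u * τ.v * (τ.t ^ 2 + τ.w ^ 2) - τ.t * τ.w * (τ.u ^ 2 + τ.v ^ 2)))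
      = (τ.u ^ 2 + τ.v ^ 2) * (τ.t ^ 2 + τ.w ^ 2) - 4 * (τ.t * τ.w) * (τ.u * τ.v) := by
  have h0 : 2 * (τ.t * τ.u - τ.v * τ.w) * (τ.t * τ.v - τ.u * τ.w) ≠ 0 :=
    mul_ne_zero (mul_ne_zero two_ne_zero h.tuvw_sub) h.tvuw_sub
  have h1 := div_mul_cancel₀ (τ.t ^ 2 * τ.u ^ 2 + τ.t ^ 2 * τ.v ^ 2 + τ.u ^ 2 * τ.w ^ 2
    + τ.v ^ 2 * τ.w ^ 2 - 4 * τ.t * τ.u * τ.v * τ.w) h0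
  rw [← C] at h1
  linear_combination h1

theorem Nondegenerate.F_mul (h : τ.Nondegenerate) :
    τ.F * ((τ.t ^ 2 + τ.w ^ 2) ^ 2 - 4 * (τ.t * τ.w) ^ 2
      - ((τ.u ^ 2 + τ.v ^ 2) ^ 2 - 4 * (τ.u * τ.v) ^ 2))
      = (τ.t ^ 2 + τ.w ^ 2) ^ 2 - 4 * (τ.t * τ.w) ^ 2
      + ((τ.u ^ 2 + τ.v ^ 2) ^ 2 - 4 * (τ.u * τ.v) ^ 2) := by
  have h1 := div_mul_cancel₀ (τ.t ^ 4 + τ.u ^ 4 + τ.v ^ 4 + τ.w ^ 4 - 2 * τ.t ^ 2 * τ.w ^ 2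
    - 2 * τ.u ^ 2 * τ.v ^ 2) (mul_ne_zero h.sq_one h.sq_two)
  rw [← F] at h1
  linear_combination h1

theorem Nondegenerate.D_mul (h : τ.Nondegenerate) :
    τ.D * (((τ.t ^ 2 + τ.w ^ 2) ^ 2 - 4 * (τ.t * τ.w) ^ 2
      - ((τ.u ^ 2 + τ.v ^ 2) ^ 2 - 4 * (τ.u * τ.v) ^ 2))
      * ((τ.u * τ.v) ^ 2 * (τ.t ^ 2 + τ.w ^ 2) ^ 2 - (τ.t * τ.w) ^ 2 * (τ.u ^ 2 + τ.v ^ 2) ^ 2))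
      = ((τ.t ^ 2 + τ.w ^ 2) ^ 2 - 4 * (τ.t * τ.w) ^ 2)
      * ((τ.u ^ 2 + τ.v ^ 2) ^ 2 - 4 * (τ.u * τ.v) ^ 2) * τ.rootD := by
  have hc : (τ.t ^ 2 + τ.w ^ 2) ^ 2 - 4 * (τ.t * τ.w) ^ 2
      - ((τ.u ^ 2 + τ.v ^ 2) ^ 2 - 4 * (τ.u * τ.v) ^ 2)
      = (τ.t ^ 2 + τ.u ^ 2 - τ.v ^ 2 - τ.w ^ 2) * (τ.t ^ 2 - τ.u ^ 2 + τ.v ^ 2 - τ.w ^ 2) := by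
    ring
  have hN : (τ.u * τ.v) ^ 2 * (τ.t ^ 2 + τ.w ^ 2) ^ 2 - (τ.t * τ.w) ^ 2 * (τ.u ^ 2 + τ.v ^ 2) ^ 2
      = (τ.t ^ 2 * τ.u ^ 2 - τ.v ^ 2 * τ.w ^ 2) * (τ.t ^ 2 * τ.v ^ 2 - τ.u ^ 2 * τ.w ^ 2) := by
    ring
  have h0 := mul_ne_zero h.c_ne h.N_ne
  rw [hc, hN, ← mul_assoc] at h0
  rw [hc, hN, ← mul_assoc ((_ - _ - _) * _) (_ - _), D, sq_sub_sq_eq, sq_sub_sq_eq, div_mul_cancel₀ _ h0]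

theorem Nondegenerate.rootCE_mul (h : τ.Nondegenerate) :
    τ.rootCE * (4 * ((τ.u * τ.v) ^ 2 * (τ.t ^ 2 + τ.w ^ 2) ^ 2
      - (τ.t * τ.w) ^ 2 * (τ.u ^ 2 + τ.v ^ 2) ^ 2))
      = ((τ.t ^ 2 + τ.w ^ 2) ^ 2 - 4 * (τ.t * τ.w) ^ 2)
      * ((τ.u ^ 2 + τ.v ^ 2) ^ 2 - 4 * (τ.u * τ.v) ^ 2) := by
  have hN : 4 * ((τ.u * τ.v) ^ 2 * (τ.t ^ 2 + τ.w ^ 2) ^ 2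
      - (τ.t * τ.w) ^ 2 * (τ.u ^ 2 + τ.v ^ 2) ^ 2)
      = 4 * (τ.t ^ 2 * τ.u ^ 2 - τ.v ^ 2 * τ.w ^ 2) * (τ.t ^ 2 * τ.v ^ 2 - τ.u ^ 2 * τ.w ^ 2) := by
    ring
  have h0 := mul_ne_zero (show (4 : ℂ) ≠ 0 by norm_num) h.N_ne
  rw [hN] at h0
  rw [hN, rootCE, sq_sub_sq_eq, sq_sub_sq_eq, div_mul_cancel₀ _ h0]

theorem Nondegenerate.rootCE_ne (h : τ.Nondegenerate) : τ.rootCE ≠ 0 :=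
  left_ne_zero_of_mul (h.rootCE_mul ▸ mul_ne_zero h.A_ne h.B_ne)

theorem Nondegenerate.D_sq (h : τ.Nondegenerate) :
    τ.D ^ 2 = τ.C ^ 2 + τ.E ^ 2 + τ.F ^ 2 - 2 * τ.C * τ.E * τ.F - 1 :=
  discriminant_generic τ.rootD_sq h.E_mul h.C_mul h.F_mul h.D_mul h.c_ne h.N_ne

/-- The numerator of E − 1 is the square of (u − v)(t − w), whose factors divide u² − v² and t² −
w². The numbers E + 1 and C ∓ 1 differ only in the signs. -/
theorem Nondegenerate.E_sub_one_ne (h : τ.Nondegenerate) : τ.E - 1 ≠ 0 := by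
  intro h0
  have h1 : (τ.t ^ 2 - τ.w ^ 2) * (τ.u ^ 2 - τ.v ^ 2) = 0 := by
    have h2 : ((τ.u - τ.v) * (τ.t - τ.w)) ^ 2 = 0 := by
      linear_combination h0 * (2 * (τ.u * τ.v * (τ.t ^ 2 + τ.w ^ 2)
        + τ.t * τ.w * (τ.u ^ 2 + τ.v ^ 2))) - h.E_mul
    linear_combination (τ.u + τ.v) * (τ.t + τ.w) * (sq_eq_zero_iff.1 h2)
  exact mul_ne_zero h.tw h.uv h1

theorem Nondegenerate.E_add_one_ne (h : τ.Nondegenerate) : τ.E + 1 ≠ 0 := by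
  intro h0
  have h1 : (τ.t ^ 2 - τ.w ^ 2) * (τ.u ^ 2 - τ.v ^ 2) = 0 := by
    have h2 : ((τ.u + τ.v) * (τ.t + τ.w)) ^ 2 = 0 := by
      linear_combination h0 * (2 * (τ.u * τ.v * (τ.t ^ 2 + τ.w ^ 2)
        + τ.t * τ.w * (τ.u ^ 2 + τ.v ^ 2))) - h.E_mul
    linear_combination (τ.u - τ.v) * (τ.t - τ.w) * (sq_eq_zero_iff.1 h2)
  exact mul_ne_zero h.tw h.uv h1

theorem Nondegenerate.C_sub_one_ne (h : τ.Nondegenerate) : τ.C - 1 ≠ 0 := by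
  intro h0
  have h1 : (τ.t ^ 2 - τ.w ^ 2) * (τ.u ^ 2 - τ.v ^ 2) = 0 := by
    have h2 : ((τ.u - τ.v) * (τ.t + τ.w)) ^ 2 = 0 := by
      linear_combination h0 * (2 * (τ.u * τ.v * (τ.t ^ 2 + τ.w ^ 2)
        - τ.t * τ.w * (τ.u ^ 2 + τ.v ^ 2))) - h.C_mul
    linear_combination (τ.u + τ.v) * (τ.t - τ.w) * (sq_eq_zero_iff.1 h2)
  exact mul_ne_zero h.tw h.uv h1

theorem Nondegenerate.C_add_one_ne (h : τ.Nondegenerate) : τ.C + 1 ≠ 0 := by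
  intro h0
  have h1 : (τ.t ^ 2 - τ.w ^ 2) * (τ.u ^ 2 - τ.v ^ 2) = 0 := by
    have h2 : ((τ.u + τ.v) * (τ.t - τ.w)) ^ 2 = 0 := by
      linear_combination h0 * (2 * (τ.u * τ.v * (τ.t ^ 2 + τ.w ^ 2)
        - τ.t * τ.w * (τ.u ^ 2 + τ.v ^ 2))) - h.C_mul
    linear_combination (τ.u - τ.v) * (τ.t + τ.w) * (sq_eq_zero_iff.1 h2)
  exact mul_ne_zero h.tw h.uv h1

theorem Nondegenerate.F_sub_one_ne (h : τ.Nondegenerate) : τ.F - 1 ≠ 0 := by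
  intro h0
  have h1 : 2 * ((τ.u ^ 2 + τ.v ^ 2) ^ 2 - 4 * (τ.u * τ.v) ^ 2) = 0 := by
    linear_combination h0 * ((τ.t ^ 2 + τ.w ^ 2) ^ 2 - 4 * (τ.t * τ.w) ^ 2
      - ((τ.u ^ 2 + τ.v ^ 2) ^ 2 - 4 * (τ.u * τ.v) ^ 2)) - h.F_mul
  exact mul_ne_zero two_ne_zero h.B_ne h1

theorem Nondegenerate.F_add_one_ne (h : τ.Nondegenerate) : τ.F + 1 ≠ 0 := by
  intro h0
  have h1 : 2 * ((τ.t ^ 2 + τ.w ^ 2) ^ 2 - 4 * (τ.t * τ.w) ^ 2) = 0 := by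
    linear_combination h0 * ((τ.t ^ 2 + τ.w ^ 2) ^ 2 - 4 * (τ.t * τ.w) ^ 2
      - ((τ.u ^ 2 + τ.v ^ 2) ^ 2 - 4 * (τ.u * τ.v) ^ 2)) - h.F_mul
  exact mul_ne_zero two_ne_zero h.A_ne h1

theorem Nondegenerate.E₁_mul (h : τ.Nondegenerate) : τ.E₁ * (τ.F - 1) = τ.C - τ.E - τ.D :=
  div_mul_cancel₀ _ h.F_sub_one_ne

theorem Nondegenerate.E₂_mul (h : τ.Nondegenerate) : τ.E₂ * (τ.F + 1) = τ.C + τ.E - τ.D :=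
  div_mul_cancel₀ _ h.F_add_one_ne

theorem Nondegenerate.b_mul (h : τ.Nondegenerate) : τ.b * τ.rootCE = τ.C * τ.F - τ.E :=
  div_mul_cancel₀ _ h.rootCE_ne

theorem Nondegenerate.b₁_mul (h : τ.Nondegenerate) : τ.b₁ * τ.rootCE = τ.D :=
  div_mul_cancel₀ _ h.rootCE_ne

theorem Nondegenerate.b_add_b₁_mul (h : τ.Nondegenerate) :
    (τ.b + τ.b₁) * ((τ.t ^ 2 + τ.w ^ 2) ^ 2 - 4 * (τ.t * τ.w) ^ 2
      - ((τ.u ^ 2 + τ.v ^ 2) ^ 2 - 4 * (τ.u * τ.v) ^ 2))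
    = 4 * (τ.t * τ.w * (τ.t ^ 2 + τ.w ^ 2) + τ.u * τ.v * (τ.u ^ 2 + τ.v ^ 2) + τ.rootD) := by
  refine mul_left_cancel₀ (mul_ne_zero h.A_ne h.B_ne) ?_
  have h1 := sub_mul_generic h.E_mul h.C_mul h.F_mul
  have h2 := h.D_mul
  rw [← h.b_mul] at h1
  rw [← h.b₁_mul] at h2
  have h3 := h.rootCE_mul
  generalize τ.t ^ 2 + τ.w ^ 2 = T at *
  generalize τ.u ^ 2 + τ.v ^ 2 = U at *
  generalize τ.t * τ.w = a at *
  generalize τ.u * τ.v = b at *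
  linear_combination 4 * h1 + 4 * h2
    - (τ.b + τ.b₁) * (T ^ 2 - 4 * a ^ 2 - (U ^ 2 - 4 * b ^ 2)) * h3

/-- The product of the two square roots that enter `κ₁` and `κ₂`. -/
theorem Nondegenerate.b_add_mul_b_sub (h : τ.Nondegenerate) :
    (τ.b + τ.b₁) * (τ.b - τ.b₁) * (τ.E ^ 2 - 1) = τ.F ^ 2 - 1 := by
  have hr : τ.rootCE ^ 2 = (τ.C ^ 2 - 1) * (τ.E ^ 2 - 1) := by
    have hE := h.E_mul
    have hC := h.C_mul
    have hR := h.rootCE_mul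
    have h0 := mul_ne_zero (show (16 : ℂ) ≠ 0 by norm_num) (pow_ne_zero 2 h.N_ne)
    refine mul_left_cancel₀ h0 ?_
    generalize τ.t ^ 2 + τ.w ^ 2 = T at *
    generalize τ.u ^ 2 + τ.v ^ 2 = U at *
    generalize τ.t * τ.w = a at *
    generalize τ.u * τ.v = b at *
    have e1 : (τ.E ^ 2 - 1) * (4 * (b * T + a * U) ^ 2)
        = (T ^ 2 - 4 * a ^ 2) * (U ^ 2 - 4 * b ^ 2) := by
      linear_combination (τ.E * (2 * (b * T + a * U)) + (U * T + 4 * a * b)) * hE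
    have e2 : (τ.C ^ 2 - 1) * (4 * (b * T - a * U) ^ 2)
        = (T ^ 2 - 4 * a ^ 2) * (U ^ 2 - 4 * b ^ 2) := by
      linear_combination (τ.C * (2 * (b * T - a * U)) + (U * T - 4 * a * b)) * hC
    have e3 := congrArg₂ (· * ·) e1 e2
    have e4 := congrArg (fun x => x ^ 2) hR
    linear_combination e4 - e3
  -- The coefficient relation in factored form; C² − 1 will cancel against the square of `rootCE`.
  have h1 : (τ.C * τ.F - τ.E) ^ 2 - τ.D ^ 2 = (τ.C ^ 2 - 1) * (τ.F ^ 2 - 1) := by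
    rw [h.D_sq]; ring
  have h2 : τ.C ^ 2 - 1 ≠ 0 := by
    have := mul_ne_zero h.C_sub_one_ne h.C_add_one_ne
    contrapose! this
    linear_combination this
  refine mul_left_cancel₀ h2 ?_
  have h3 : (τ.b + τ.b₁) * (τ.b - τ.b₁) * τ.rootCE ^ 2 = (τ.C * τ.F - τ.E) ^ 2 - τ.D ^ 2 := by
    rw [← h.b_mul, ← h.b₁_mul]; ring
  rw [hr, h1] at h3
  linear_combination h3

theorem Nondegenerate.E_sq_sub_one_ne (h : τ.Nondegenerate) : τ.E ^ 2 - 1 ≠ 0 := by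
  have := mul_ne_zero h.E_sub_one_ne h.E_add_one_ne
  contrapose! this
  linear_combination this

theorem Nondegenerate.F_sq_sub_one_ne (h : τ.Nondegenerate) : τ.F ^ 2 - 1 ≠ 0 := by
  have := mul_ne_zero h.F_sub_one_ne h.F_add_one_ne
  contrapose! this
  linear_combination this

/-- The coefficient relation says (EF − C + D)(EF − C − D) = (E² − 1)(F² − 1). The first factor
equals (F − 1)(E − E₁) and also (F + 1)(E − E₂), so its nonvanishing separates E from E₁ and E₂. -/
theorem Nondegenerate.EF_sub_C_add_D_ne (h : τ.Nondegenerate) : τ.E * τ.F - τ.C + τ.D ≠ 0 := by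
  intro h0
  refine mul_ne_zero h.E_sq_sub_one_ne h.F_sq_sub_one_ne ?_
  linear_combination (τ.E * τ.F - τ.C - τ.D) * h0 + h.D_sq

theorem Nondegenerate.E_sub_E₁_ne (h : τ.Nondegenerate) : τ.E - τ.E₁ ≠ 0 := by
  intro h0
  refine h.EF_sub_C_add_D_ne ?_
  linear_combination (τ.F - 1) * h0 + h.E₁_mul

theorem Nondegenerate.E_sub_E₂_ne (h : τ.Nondegenerate) : τ.E - τ.E₂ ≠ 0 := by
  intro h0
  refine h.EF_sub_C_add_D_ne ?_
  linear_combination (τ.F + 1) * h0 + h.E₂_mul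

theorem Nondegenerate.E₂_sub_E₁_mul (h : τ.Nondegenerate) :
    (τ.E₂ - τ.E₁) * (τ.F + 1) = 2 * (τ.E - τ.E₁) := by
  refine mul_left_cancel₀ h.F_sub_one_ne ?_
  linear_combination (τ.F - 1) * h.E₂_mul - (τ.F + 1) * h.E₁_mul + 2 * h.E₁_mul

theorem Nondegenerate.E₂_sub_E₁_ne (h : τ.Nondegenerate) : τ.E₂ - τ.E₁ ≠ 0 := by
  intro h0
  refine h.E_sub_E₁_ne ?_
  linear_combination (τ.F + 1) / 2 * h0 - h.E₂_sub_E₁_mul / 2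

/-- This and the next two identities recover F, C, D from E, E₁, E₂. In that form the mixed part of
the quartic can be recognised as a product of factors of f₅. -/
theorem Nondegenerate.F_eq (h : τ.Nondegenerate) :
    τ.F * (τ.E₂ - τ.E₁) = 2 * τ.E - τ.E₁ - τ.E₂ := by
  linear_combination h.E₂_sub_E₁_mul

theorem Nondegenerate.C_eq (h : τ.Nondegenerate) :
    τ.C * (τ.E₂ - τ.E₁) = 1 - τ.E₁ * τ.E₂ := by
  refine mul_left_cancel₀ h.F_sq_sub_one_ne ?_
  linear_combination τ.C * ((τ.F - 1) * h.E₂_mul - (τ.F + 1) * h.E₁_mul)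
    + τ.E₂ * (τ.F + 1) * h.E₁_mul + (τ.C - τ.E - τ.D) * h.E₂_mul + h.D_sq

theorem Nondegenerate.D_eq (h : τ.Nondegenerate) :
    τ.D * (τ.E₂ - τ.E₁) = τ.E₁ * τ.E₂ - τ.E * (τ.E₁ + τ.E₂) + 1 := by
  refine mul_left_cancel₀ h.F_sq_sub_one_ne ?_
  linear_combination τ.D * ((τ.F - 1) * h.E₂_mul - (τ.F + 1) * h.E₁_mul)
    - τ.E₂ * (τ.F + 1) * h.E₁_mul - (τ.C - τ.E - τ.D) * h.E₂_mul
    + τ.E * ((τ.F + 1) * h.E₁_mul + (τ.F - 1) * h.E₂_mul) + h.D_sq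

/-- `E₁ = ± 1` and `E₂ = ± 1` are excluded because these products do not vanish. -/
theorem Nondegenerate.E₁_sub_one_ne (h : τ.Nondegenerate) : τ.E₁ - 1 ≠ 0 := by
  intro h0
  refine mul_ne_zero (mul_ne_zero h.C_add_one_ne h.E_sub_one_ne) h.F_sub_one_ne ?_
  have h1 : τ.D = τ.C - τ.E - τ.F + 1 := by
    linear_combination h.E₁_mul - (τ.F - 1) * h0
  linear_combination (1 / 2 : ℂ) * h.D_sq - (τ.D + (τ.C - τ.E - τ.F + 1)) / 2 * h1

theorem Nondegenerate.E₁_add_one_ne (h : τ.Nondegenerate) : τ.E₁ + 1 ≠ 0 := by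
  intro h0
  refine mul_ne_zero (mul_ne_zero h.C_sub_one_ne h.E_add_one_ne) h.F_sub_one_ne ?_
  have h1 : τ.D = τ.C - τ.E + τ.F - 1 := by
    linear_combination h.E₁_mul - (τ.F - 1) * h0
  linear_combination (1 / 2 : ℂ) * h.D_sq - (τ.D + (τ.C - τ.E + τ.F - 1)) / 2 * h1

theorem Nondegenerate.E₂_sub_one_ne (h : τ.Nondegenerate) : τ.E₂ - 1 ≠ 0 := by
  intro h0
  refine mul_ne_zero (mul_ne_zero h.C_sub_one_ne h.E_sub_one_ne) h.F_add_one_ne ?_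
  have h1 : τ.D = τ.C + τ.E - τ.F - 1 := by
    linear_combination h.E₂_mul - (τ.F + 1) * h0
  linear_combination (1 / 2 : ℂ) * h.D_sq - (τ.D + (τ.C + τ.E - τ.F - 1)) / 2 * h1

theorem Nondegenerate.E₂_add_one_ne (h : τ.Nondegenerate) : τ.E₂ + 1 ≠ 0 := by
  intro h0
  refine mul_ne_zero (mul_ne_zero h.C_add_one_ne h.E_add_one_ne) h.F_add_one_ne ?_
  have h1 : τ.D = τ.C + τ.E + τ.F + 1 := by
    linear_combination h.E₂_mul - (τ.F + 1) * h0
  linear_combination (1 / 2 : ℂ) * h.D_sq - (τ.D + (τ.C + τ.E + τ.F + 1)) / 2 * h1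

theorem Nondegenerate.b_add_b₁_ne (h : τ.Nondegenerate) : τ.b + τ.b₁ ≠ 0 := by
  refine left_ne_zero_of_mul (b := τ.b - τ.b₁) (left_ne_zero_of_mul (b := τ.E ^ 2 - 1) ?_)
  rw [h.b_add_mul_b_sub]
  exact h.F_sq_sub_one_ne

theorem Nondegenerate.b_sub_b₁_ne (h : τ.Nondegenerate) : τ.b - τ.b₁ ≠ 0 := by
  refine right_ne_zero_of_mul (a := τ.b + τ.b₁) (left_ne_zero_of_mul (b := τ.E ^ 2 - 1) ?_)
  rw [h.b_add_mul_b_sub]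
  exact h.F_sq_sub_one_ne

theorem Nondegenerate.m_mul (h : τ.Nondegenerate) : τ.m * (τ.E - 1) = τ.E + 1 :=
  div_mul_cancel₀ _ h.E_sub_one_ne

theorem Nondegenerate.m₁_mul (h : τ.Nondegenerate) : τ.m₁ * (τ.E₁ - 1) = τ.E₁ + 1 :=
  div_mul_cancel₀ _ h.E₁_sub_one_ne

theorem Nondegenerate.m₂_mul (h : τ.Nondegenerate) : τ.m₂ * (τ.E₂ - 1) = τ.E₂ + 1 :=
  div_mul_cancel₀ _ h.E₂_sub_one_ne

theorem Nondegenerate.m₁_sub_m₂_mul (h : τ.Nondegenerate) :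
    (τ.m₁ - τ.m₂) * ((τ.E₁ - 1) * (τ.E₂ - 1)) = 2 * (τ.E₂ - τ.E₁) := by
  linear_combination (τ.E₂ - 1) * h.m₁_mul - (τ.E₁ - 1) * h.m₂_mul

theorem Nondegenerate.m₁_ne_m₂ (h : τ.Nondegenerate) : τ.m₁ ≠ τ.m₂ := fun h0 => by
  have h1 := h.m₁_sub_m₂_mul
  rw [h0, sub_self, zero_mul] at h1
  exact mul_ne_zero two_ne_zero h.E₂_sub_E₁_ne h1.symm

theorem Nondegenerate.m_ne_m₁ (h : τ.Nondegenerate) : τ.m ≠ τ.m₁ := fun h0 => by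
  refine h.E_sub_E₁_ne ?_
  linear_combination (-1 / 2 : ℂ) * ((τ.E - 1) * h.m₁_mul - (τ.E₁ - 1) * h.m_mul
    + (τ.E - 1) * (τ.E₁ - 1) * h0)

theorem Nondegenerate.m_ne_m₂ (h : τ.Nondegenerate) : τ.m ≠ τ.m₂ := fun h0 => by
  refine h.E_sub_E₂_ne ?_
  linear_combination (-1 / 2 : ℂ) * ((τ.E - 1) * h.m₂_mul - (τ.E₂ - 1) * h.m_mul
    + (τ.E - 1) * (τ.E₂ - 1) * h0)

theorem mobius_ne_one {e : ℂ} (he : e - 1 ≠ 0) : (e + 1) / (e - 1) ≠ 1 := by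
  rw [Ne, div_eq_one_iff_eq he]
  intro h
  have : (2 : ℂ) = 0 := by linear_combination h
  exact two_ne_zero this

/-- The roots of `f₅` are simple. -/
theorem Nondegenerate.m_simple (h : τ.Nondegenerate) :
    (τ.m ≠ 0 ∧ τ.m₁ ≠ 0 ∧ τ.m₂ ≠ 0) ∧ (τ.m ≠ 1 ∧ τ.m₁ ≠ 1 ∧ τ.m₂ ≠ 1) ∧
      (τ.m ≠ τ.m₁ ∧ τ.m ≠ τ.m₂ ∧ τ.m₁ ≠ τ.m₂) :=
  ⟨⟨div_ne_zero h.E_add_one_ne h.E_sub_one_ne, div_ne_zero h.E₁_add_one_ne h.E₁_sub_one_ne,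
    div_ne_zero h.E₂_add_one_ne h.E₂_sub_one_ne⟩,
    ⟨mobius_ne_one h.E_sub_one_ne, mobius_ne_one h.E₁_sub_one_ne, mobius_ne_one h.E₂_sub_one_ne⟩,
    h.m_ne_m₁, h.m_ne_m₂, h.m₁_ne_m₂⟩

end Parameters

end Period

/-! ### The Kummer quartic and the even coefficients in terms of P₁, P₂, S₁, S₂. -/

namespace Period

variable (τ : Period)

/-- Elimination of `G₀` and `G₁` from the product formulas; the coefficients are the same products
at the origin. -/
theorem P₀P₃_eq (z : ℂ × ℂ) : τ.P₁ 0 * τ.P₂ 0 * (τ.P₀ z * τ.P₃ z)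
    = τ.P₀ 0 * τ.P₃ 0 * (τ.P₁ z * τ.P₂ z) + τ.S₀ 0 * τ.S₃ 0 * (τ.S₁ z * τ.S₂ z) := by
  simp only [P₀_mul_P₃, P₁_mul_P₂, S₀_mul_S₃, S₁_mul_S₂]
  ring

theorem S₀S₃_eq (z : ℂ × ℂ) : τ.P₁ 0 * τ.P₂ 0 * (τ.S₀ z * τ.S₃ z)
    = τ.S₀ 0 * τ.S₃ 0 * (τ.P₁ z * τ.P₂ z) + τ.P₀ 0 * τ.P₃ 0 * (τ.S₁ z * τ.S₂ z) := by
  simp only [P₀_mul_P₃, P₁_mul_P₂, S₀_mul_S₃, S₁_mul_S₂]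
  ring

theorem P₁P₂_zero_sq : (τ.P₁ 0 * τ.P₂ 0) ^ 2
    = (τ.t ^ 2 + τ.w ^ 2) ^ 2 - 4 * (τ.t * τ.w) ^ 2
      - ((τ.u ^ 2 + τ.v ^ 2) ^ 2 - 4 * (τ.u * τ.v) ^ 2) := by
  rw [mul_pow, P₁_zero_sq, P₂_zero_sq]; ring

theorem P₀P₃_zero_sq : (τ.P₀ 0 * τ.P₃ 0) ^ 2
    = (τ.t ^ 2 + τ.w ^ 2) ^ 2 - (τ.u ^ 2 + τ.v ^ 2) ^ 2 := by
  rw [mul_pow, P₀_zero_sq, P₃_zero_sq]; ring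

theorem S₀S₃_zero_sq : (τ.S₀ 0 * τ.S₃ 0) ^ 2
    = 4 * ((τ.t * τ.w) ^ 2 - (τ.u * τ.v) ^ 2) := by
  rw [mul_pow, S₀_zero_sq, S₃_zero_sq]; ring

theorem P₀P₃S₀S₃_zero : τ.P₀ 0 * τ.P₃ 0 * (τ.S₀ 0 * τ.S₃ 0) = -2 * τ.rootD := by
  rw [rootD, Prod.mk_zero_zero]; ring

/-- The squares of P₁, P₂, S₁, S₂ form a linear system in the `Xᵢ` that splits into two 2 × 2
blocks. Solving it, here and in the next three identities, removes the functions with indices 0 and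
3. -/
theorem α_sum (z : ℂ × ℂ) : 2 * (τ.t ^ 2 - τ.w ^ 2) * (τ.t * τ.X₀ z + τ.w * τ.X₃ z)
    = (τ.t ^ 2 + τ.w ^ 2) * (τ.P₁ z ^ 2 + τ.P₂ z ^ 2)
      - 2 * (τ.t * τ.w) * (τ.S₁ z ^ 2 + τ.S₂ z ^ 2) := by
  rw [P₁_sq, P₂_sq, S₁_sq, S₂_sq]; ring

theorem γ_sum (z : ℂ × ℂ) : 2 * (τ.t ^ 2 - τ.w ^ 2) * (τ.w * τ.X₀ z + τ.t * τ.X₃ z)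
    = 2 * (τ.t * τ.w) * (τ.P₁ z ^ 2 + τ.P₂ z ^ 2)
      - (τ.t ^ 2 + τ.w ^ 2) * (τ.S₁ z ^ 2 + τ.S₂ z ^ 2) := by
  rw [P₁_sq, P₂_sq, S₁_sq, S₂_sq]; ring

theorem β_sum (z : ℂ × ℂ) : 2 * (τ.u ^ 2 - τ.v ^ 2) * (τ.u * τ.X₁ z + τ.v * τ.X₂ z)
    = (τ.u ^ 2 + τ.v ^ 2) * (τ.P₁ z ^ 2 - τ.P₂ z ^ 2)
      - 2 * (τ.u * τ.v) * (τ.S₁ z ^ 2 - τ.S₂ z ^ 2) := by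
  rw [P₁_sq, P₂_sq, S₁_sq, S₂_sq]; ring

theorem δ_sum (z : ℂ × ℂ) : 2 * (τ.u ^ 2 - τ.v ^ 2) * (τ.v * τ.X₁ z + τ.u * τ.X₂ z)
    = 2 * (τ.u * τ.v) * (τ.P₁ z ^ 2 - τ.P₂ z ^ 2)
      - (τ.u ^ 2 + τ.v ^ 2) * (τ.S₁ z ^ 2 - τ.S₂ z ^ 2) := by
  rw [P₁_sq, P₂_sq, S₁_sq, S₂_sq]; ring

variable {τ}

variable (τ) in
theorem theta_kummer_cleared (z : ℂ × ℂ) :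
    ((τ.t ^ 2 + τ.w ^ 2) ^ 2 - 4 * (τ.t * τ.w) ^ 2
      - ((τ.u ^ 2 + τ.v ^ 2) ^ 2 - 4 * (τ.u * τ.v) ^ 2)) *
      (((τ.u ^ 2 + τ.v ^ 2) ^ 2 - 4 * (τ.u * τ.v) ^ 2)
        * ((τ.t ^ 2 + τ.w ^ 2) * (τ.P₁ z ^ 2 + τ.P₂ z ^ 2)
          - 2 * (τ.t * τ.w) * (τ.S₁ z ^ 2 + τ.S₂ z ^ 2)) ^ 2
        - ((τ.t ^ 2 + τ.w ^ 2) ^ 2 - 4 * (τ.t * τ.w) ^ 2)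
        * ((τ.u ^ 2 + τ.v ^ 2) * (τ.P₁ z ^ 2 - τ.P₂ z ^ 2)
          - 2 * (τ.u * τ.v) * (τ.S₁ z ^ 2 - τ.S₂ z ^ 2)) ^ 2)
      = 4 * ((τ.t ^ 2 + τ.w ^ 2) ^ 2 - 4 * (τ.t * τ.w) ^ 2)
        * ((τ.u ^ 2 + τ.v ^ 2) ^ 2 - 4 * (τ.u * τ.v) ^ 2) *
        (((τ.t ^ 2 + τ.w ^ 2) ^ 2 - (τ.u ^ 2 + τ.v ^ 2) ^ 2) * (τ.P₁ z * τ.P₂ z) ^ 2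
        + 4 * ((τ.t * τ.w) ^ 2 - (τ.u * τ.v) ^ 2) * (τ.S₁ z * τ.S₂ z) ^ 2
        - 4 * τ.rootD * (τ.P₁ z * τ.P₂ z * τ.S₁ z * τ.S₂ z)) :=
  kummer_cleared (α := τ.t * τ.X₀ z + τ.w * τ.X₃ z) (β := τ.u * τ.X₁ z + τ.v * τ.X₂ z)
    (by rw [← τ.α_sum, sq_sub_sq_eq]; ring) (by rw [← τ.β_sum, sq_sub_sq_eq]; ring)
    (by
      -- The square of P₀P₃ is computed twice: from the linear relation with P₁P₂ and S₁S₂, and from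
      -- the formulas for P₀² and P₃². The sign of `rootD` enters through the cross term.
      have h1 := congrArg (fun x => x ^ 2) (τ.P₀P₃_eq z)
      have h2 : (τ.P₀ z * τ.P₃ z) ^ 2 = (τ.t * τ.X₀ z + τ.w * τ.X₃ z) ^ 2
          - (τ.u * τ.X₁ z + τ.v * τ.X₂ z) ^ 2 := by rw [mul_pow, P₀_sq, P₃_sq]; ring
      rw [← h2, ← P₁P₂_zero_sq]
      linear_combination h1 + (τ.P₁ z * τ.P₂ z) ^ 2 * τ.P₀P₃_zero_sq
        + (τ.S₁ z * τ.S₂ z) ^ 2 * τ.S₀S₃_zero_sq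
        + 2 * (τ.P₁ z * τ.P₂ z * τ.S₁ z * τ.S₂ z) * τ.P₀P₃S₀S₃_zero)

/-- The Kummer quartic relation between `P₁, S₁, P₂, S₂`. -/
theorem Nondegenerate.kummer (h : τ.Nondegenerate) (z : ℂ × ℂ) :
    τ.P₁ z ^ 4 + τ.S₁ z ^ 4 + τ.P₂ z ^ 4 + τ.S₂ z ^ 4
      - 2 * τ.E * (τ.P₁ z ^ 2 * τ.S₁ z ^ 2 + τ.P₂ z ^ 2 * τ.S₂ z ^ 2)
      - 2 * τ.F * (τ.P₁ z ^ 2 * τ.P₂ z ^ 2 + τ.S₁ z ^ 2 * τ.S₂ z ^ 2)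
      + 2 * τ.C * (τ.P₁ z ^ 2 * τ.S₂ z ^ 2 + τ.P₂ z ^ 2 * τ.S₁ z ^ 2)
      - 4 * τ.D * (τ.P₁ z * τ.P₂ z * τ.S₁ z * τ.S₂ z) = 0 :=
  kummer_quartic_generic h.E_mul h.C_mul h.F_mul h.D_mul h.c_ne h.N_ne
    (τ.theta_kummer_cleared z)

theorem Nondegenerate.E₁_mul_N (h : τ.Nondegenerate) :
    τ.E₁ * (2 * ((τ.u * τ.v) ^ 2 * (τ.t ^ 2 + τ.w ^ 2) ^ 2
      - (τ.t * τ.w) ^ 2 * (τ.u ^ 2 + τ.v ^ 2) ^ 2))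
      = τ.t * τ.w * (τ.t ^ 2 + τ.w ^ 2) * ((τ.t ^ 2 + τ.w ^ 2) ^ 2 - 4 * (τ.t * τ.w) ^ 2
        - ((τ.u ^ 2 + τ.v ^ 2) ^ 2 - 4 * (τ.u * τ.v) ^ 2))
        - ((τ.t ^ 2 + τ.w ^ 2) ^ 2 - 4 * (τ.t * τ.w) ^ 2) * τ.rootD := by
  refine mul_left_cancel₀ h.B_ne ?_
  have hE := h.E_mul
  have hC := h.C_mul
  have hF := h.F_mul
  have hD := h.D_mul
  have h1 := h.E₁_mul
  generalize τ.t ^ 2 + τ.w ^ 2 = T at *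
  generalize τ.u ^ 2 + τ.v ^ 2 = U at *
  generalize τ.t * τ.w = a at *
  generalize τ.u * τ.v = b at *
  linear_combination (b ^ 2 * T ^ 2 - a ^ 2 * U ^ 2) * (T ^ 2 - 4 * a ^ 2 - (U ^ 2 - 4 * b ^ 2)) * h1
    - τ.E₁ * (b ^ 2 * T ^ 2 - a ^ 2 * U ^ 2) * hF - hD
    + (T ^ 2 - 4 * a ^ 2 - (U ^ 2 - 4 * b ^ 2)) / 2
      * ((b * T + a * U) * hC - (b * T - a * U) * hE)

/-- The relation that determines `E₁` from `b + b₁`. -/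
theorem Nondegenerate.n_mul (h : τ.Nondegenerate) :
    -((τ.b + τ.b₁) * (τ.E₁ ^ 2 - 1)) / (2 * (τ.E - τ.E₁))
      * (τ.u * τ.v * (τ.t ^ 2 + τ.w ^ 2) - τ.t * τ.w * (τ.u ^ 2 + τ.v ^ 2))
      = τ.u * τ.v * (τ.t ^ 2 + τ.w ^ 2) + τ.t * τ.w * (τ.u ^ 2 + τ.v ^ 2) := by
  have h1 : (τ.E₁ ^ 2 - 1) * (τ.F ^ 2 - 1) = -2 * (τ.E - τ.E₁) * (τ.C * τ.F - τ.E - τ.D) := by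
    refine mul_left_cancel₀ h.F_sub_one_ne ?_
    linear_combination
      ((τ.F + 1) * (τ.E₁ * (τ.F - 1) + τ.C - τ.E - τ.D)
        - 2 * (τ.C * τ.F - τ.E - τ.D)) * h.E₁_mul + (τ.F - 1) * h.D_sq
  have h2 : (τ.b + τ.b₁) * (τ.C * τ.F - τ.E - τ.D) * (τ.E ^ 2 - 1)
      = (τ.F ^ 2 - 1) * τ.rootCE := by
    rw [← h.b_mul, ← h.b₁_mul]
    linear_combination τ.rootCE * h.b_add_mul_b_sub
  have h3 : τ.rootCE * (τ.u * τ.v * (τ.t ^ 2 + τ.w ^ 2) - τ.t * τ.w * (τ.u ^ 2 + τ.v ^ 2))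
      = (τ.E ^ 2 - 1)
        * (τ.u * τ.v * (τ.t ^ 2 + τ.w ^ 2) + τ.t * τ.w * (τ.u ^ 2 + τ.v ^ 2)) := by
    have hE := h.E_mul
    have hR := h.rootCE_mul
    refine mul_left_cancel₀ (mul_ne_zero (show (4 : ℂ) ≠ 0 by norm_num) h.n₁_ne) ?_
    generalize τ.t ^ 2 + τ.w ^ 2 = T at *
    generalize τ.u ^ 2 + τ.v ^ 2 = U at *
    generalize τ.t * τ.w = a at *
    generalize τ.u * τ.v = b at *
    linear_combination hR - (τ.E * (2 * (b * T + a * U)) + (U * T + 4 * a * b)) * hE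
  generalize τ.u * τ.v * (τ.t ^ 2 + τ.w ^ 2) - τ.t * τ.w * (τ.u ^ 2 + τ.v ^ 2) = n₂ at *
  generalize τ.u * τ.v * (τ.t ^ 2 + τ.w ^ 2) + τ.t * τ.w * (τ.u ^ 2 + τ.v ^ 2) = n₁ at *
  rw [div_mul_eq_mul_div, div_eq_iff (mul_ne_zero two_ne_zero h.E_sub_E₁_ne)]
  refine mul_left_cancel₀ (mul_ne_zero h.E_sq_sub_one_ne h.F_sq_sub_one_ne) ?_
  linear_combination -(τ.b + τ.b₁) * n₂ * (τ.E ^ 2 - 1) * h1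
    + 2 * (τ.E - τ.E₁) * n₂ * h2 + 2 * (τ.E - τ.E₁) * (τ.F ^ 2 - 1) * h3

/-- Expanding the square leaves S₃²P₃² + S₀²P₀², known from the formulas for squares, and the cross
term P₀P₃S₀S₃, a quadratic form in P₁P₂ and S₁S₂. The resulting form is the one that
`one_sub_mul_one_sub` identifies with (1 − m₁x)(1 − m₁x'). -/
theorem Nondegenerate.evenν_sq (h : τ.Nondegenerate) (z : ℂ × ℂ) :
    τ.evenν z ^ 2 = (τ.b + τ.b₁) / (8 * (τ.E - τ.E₁)) *
      (2 * (τ.E - τ.E₁) * ((τ.P₁ z * τ.P₂ z) ^ 2 + (τ.S₁ z * τ.S₂ z) ^ 2)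
        + (τ.E₁ ^ 2 - 1) * ((τ.S₁ z * τ.P₂ z) ^ 2 + (τ.S₂ z * τ.P₁ z) ^ 2)
        + 2 * (τ.E₁ ^ 2 - 2 * τ.E * τ.E₁ + 1) * (τ.P₁ z * τ.P₂ z * τ.S₁ z * τ.S₂ z)) := by
  have hQ : ((τ.t ^ 2 + τ.w ^ 2) ^ 2 - 4 * (τ.t * τ.w) ^ 2
      - ((τ.u ^ 2 + τ.v ^ 2) ^ 2 - 4 * (τ.u * τ.v) ^ 2)) * (τ.P₀ z * τ.P₃ z * (τ.S₀ z * τ.S₃ z))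
      = -2 * τ.rootD * ((τ.P₁ z * τ.P₂ z) ^ 2 + (τ.S₁ z * τ.S₂ z) ^ 2)
      + ((τ.t ^ 2 + τ.w ^ 2) ^ 2 - (τ.u ^ 2 + τ.v ^ 2) ^ 2 + 4 * (τ.t * τ.w) ^ 2
        - 4 * (τ.u * τ.v) ^ 2) * (τ.P₁ z * τ.P₂ z * τ.S₁ z * τ.S₂ z) := by
    rw [← P₁P₂_zero_sq]
    have e := congrArg₂ (· * ·) (τ.P₀P₃_eq z) (τ.S₀S₃_eq z)
    linear_combination e + (τ.P₁ z * τ.P₂ z * τ.S₁ z * τ.S₂ z)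
        * (τ.P₀P₃_zero_sq + τ.S₀S₃_zero_sq)
      + ((τ.P₁ z * τ.P₂ z) ^ 2 + (τ.S₁ z * τ.S₂ z) ^ 2) * τ.P₀P₃S₀S₃_zero
  have key := evenν_sq_generic (p₁ := τ.P₁ z) (p₂ := τ.P₂ z) (s₁ := τ.S₁ z) (s₂ := τ.S₂ z)
    (α := τ.t * τ.X₀ z + τ.w * τ.X₃ z) (β := τ.u * τ.X₁ z + τ.v * τ.X₂ z)
    (γ := τ.w * τ.X₀ z + τ.t * τ.X₃ z) (δ := τ.v * τ.X₁ z + τ.u * τ.X₂ z)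
    τ.rootD_sq h.b_add_b₁_mul h.n_mul h.E₁_mul_N h.c_ne h.N_ne h.A_ne h.B_ne
    (by rw [← τ.α_sum, ← τ.γ_sum, sq_sub_sq_eq]; ring)
    (by rw [← τ.β_sum, ← τ.δ_sum, sq_sub_sq_eq]; ring) hQ (τ.theta_kummer_cleared z)
  have hl : τ.evenν z ^ 2 = ((τ.t * τ.X₀ z + τ.w * τ.X₃ z) * (τ.w * τ.X₀ z + τ.t * τ.X₃ z)
      + (τ.u * τ.X₁ z + τ.v * τ.X₂ z) * (τ.v * τ.X₁ z + τ.u * τ.X₂ z)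
      - τ.P₀ z * τ.P₃ z * (τ.S₀ z * τ.S₃ z)) / 2 := by
    have e : τ.evenν z ^ 2 = (τ.S₃ z ^ 2 * τ.P₃ z ^ 2 + τ.S₀ z ^ 2 * τ.P₀ z ^ 2
        - 2 * (τ.P₀ z * τ.P₃ z * (τ.S₀ z * τ.S₃ z))) / 4 := by rw [evenν]; ring
    rw [e, P₀_sq, P₃_sq, S₀_sq, S₃_sq]
    ring
  rw [hl, key]
  have hne := h.E_sub_E₁_ne
  field_simp
  ring

theorem Nondegenerate.evenν_mul_evenμ (h : τ.Nondegenerate) (z : ℂ × ℂ) :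
    τ.evenν z * τ.evenμ z = -(τ.u * τ.v * (τ.t ^ 2 + τ.w ^ 2) + τ.t * τ.w * (τ.u ^ 2 + τ.v ^ 2))
        / (4 * (τ.t ^ 2 - τ.w ^ 2) * (τ.u ^ 2 - τ.v ^ 2)) *
      ((τ.P₂ z ^ 4 - 2 * τ.E * τ.P₂ z ^ 2 * τ.S₂ z ^ 2 + τ.S₂ z ^ 4)
        - (τ.P₁ z ^ 4 - 2 * τ.E * τ.P₁ z ^ 2 * τ.S₁ z ^ 2 + τ.S₁ z ^ 4)) := by
  rw [← evenν_mul_evenμ_generic h.tw h.uv h.E_mul (τ.α_sum z) (τ.γ_sum z) (τ.β_sum z) (τ.δ_sum z)]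
  have e : τ.evenν z * τ.evenμ z = (τ.S₃ z ^ 2 * τ.P₃ z ^ 2 - τ.S₀ z ^ 2 * τ.P₀ z ^ 2) / 4 := by
    rw [evenν, evenμ]; ring
  rw [e, P₀_sq, P₃_sq, S₀_sq, S₃_sq]
  ring

/-- The constant in `evenν_mul_evenμ` is a square root of `1 / (64 (E² - 1))`. -/
theorem Nondegenerate.K_sq (h : τ.Nondegenerate) :
    (-(τ.u * τ.v * (τ.t ^ 2 + τ.w ^ 2) + τ.t * τ.w * (τ.u ^ 2 + τ.v ^ 2))
        / (4 * (τ.t ^ 2 - τ.w ^ 2) * (τ.u ^ 2 - τ.v ^ 2))) ^ 2 * (64 * (τ.E ^ 2 - 1)) = 1 := by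
  rw [div_pow, div_mul_eq_mul_div, div_eq_one_iff_eq (pow_ne_zero 2
    (mul_ne_zero (mul_ne_zero (by norm_num) h.tw) h.uv))]
  have hE := h.E_mul
  linear_combination (16 : ℂ) * (τ.E * (2 * (τ.u * τ.v * (τ.t ^ 2 + τ.w ^ 2)
    + τ.t * τ.w * (τ.u ^ 2 + τ.v ^ 2))) + ((τ.u ^ 2 + τ.v ^ 2) * (τ.t ^ 2 + τ.w ^ 2) + 4 * (τ.t * τ.w) * (τ.u * τ.v))) * hE

end Period

/-! ### Algebra of x and x' as functions of p and q. -/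

section Algebra

/-- `Δ(s)²` as a function of `E` and `s`. -/
def quarticΔ (E s : ℂ) : ℂ := 1 - 2 * E * s ^ 2 + s ^ 4

/-- The numerator of the derivative of `x` with respect to `p`, where `r` is the value of
`Δ(p) Δ(q)`. -/
def derivNumerator (E p q r : ℂ) : ℂ :=
  r * (q + E * p - E * p ^ 2 * q - p ^ 3) - quarticΔ E p * (p + E * q - E * q ^ 2 * p - q ^ 3)

variable {E E₁ E₂ F C D m m₁ m₂ p q r x x' : ℂ}

/-- The product of the two conjugate numerators is (E² − 1)(1 − p²q²)², because the square of E(1 +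
p²q²) − (p² + q²) differs from Δ(p)²Δ(q)² by exactly this. -/
theorem mul_conj_eq (hr : r ^ 2 = quarticΔ E p * quarticΔ E q) (hE : E + 1 ≠ 0)
    (h : p * q + 1 ≠ 0)
    (hx : (E + 1) * (p * q + 1) ^ 2 * x = E * (1 + p ^ 2 * q ^ 2) - (p ^ 2 + q ^ 2) - r)
    (hx' : (E + 1) * (p * q + 1) ^ 2 * x' = E * (1 + p ^ 2 * q ^ 2) - (p ^ 2 + q ^ 2) + r) :
    (E + 1) * (p * q + 1) ^ 2 * (x * x') = (E - 1) * (1 - p * q) ^ 2 := by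
  refine mul_left_cancel₀ (mul_ne_zero hE (pow_ne_zero 2 h)) ?_
  rw [quarticΔ, quarticΔ] at hr
  linear_combination (E + 1) * (p * q + 1) ^ 2 * x' * hx
    + (E * (1 + p ^ 2 * q ^ 2) - (p ^ 2 + q ^ 2) - r) * hx' - hr

theorem one_sub_mul_one_sub (hm₁ : m₁ * (E₁ - 1) = E₁ + 1)
    (hx : (E + 1) * (p * q + 1) ^ 2 * x = E * (1 + p ^ 2 * q ^ 2) - (p ^ 2 + q ^ 2) - r)
    (hx' : (E + 1) * (p * q + 1) ^ 2 * x' = E * (1 + p ^ 2 * q ^ 2) - (p ^ 2 + q ^ 2) + r)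
    (hxx' : (E + 1) * (p * q + 1) ^ 2 * (x * x') = (E - 1) * (1 - p * q) ^ 2) :
    (E₁ - 1) ^ 2 * (E + 1) * (p * q + 1) ^ 2 * ((1 - m₁ * x) * (1 - m₁ * x'))
      = 2 * (2 * (E - E₁) * (1 + p ^ 2 * q ^ 2) + (E₁ ^ 2 - 1) * (p ^ 2 + q ^ 2)
        + 2 * (E₁ ^ 2 - 2 * E * E₁ + 1) * (p * q)) := by
  have e : (E₁ - 1) ^ 2 * (E + 1) * (p * q + 1) ^ 2 * ((1 - m₁ * x) * (1 - m₁ * x'))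
      = (E + 1) * (p * q + 1) ^ 2 * (((E₁ - 1) - m₁ * (E₁ - 1) * x)
        * ((E₁ - 1) - m₁ * (E₁ - 1) * x')) := by ring
  rw [e, hm₁]
  linear_combination -(E₁ ^ 2 - 1) * (hx + hx') + (E₁ + 1) ^ 2 * hxx'

/-- Mixing m₁ and m₂ leaves a term linear in r. The rational part is the mixed part of the Kummer
quartic, which is what ties the branch points 1/m₁ and 1/m₂ to F, C and D. -/
theorem one_sub_mul_one_sub' (hm₁ : m₁ * (E₁ - 1) = E₁ + 1) (hm₂ : m₂ * (E₂ - 1) = E₂ + 1)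
    (h₁ : E₁ - 1 ≠ 0) (h₂ : E₂ - 1 ≠ 0)
    (hF : F * (E₂ - E₁) = 2 * E - E₁ - E₂) (hC : C * (E₂ - E₁) = 1 - E₁ * E₂)
    (hD : D * (E₂ - E₁) = E₁ * E₂ - E * (E₁ + E₂) + 1)
    (hx : (E + 1) * (p * q + 1) ^ 2 * x = E * (1 + p ^ 2 * q ^ 2) - (p ^ 2 + q ^ 2) - r)
    (hx' : (E + 1) * (p * q + 1) ^ 2 * x' = E * (1 + p ^ 2 * q ^ 2) - (p ^ 2 + q ^ 2) + r)
    (hxx' : (E + 1) * (p * q + 1) ^ 2 * (x * x') = (E - 1) * (1 - p * q) ^ 2) :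
    (E + 1) * (p * q + 1) ^ 2 * ((1 - m₂ * x) * (1 - m₁ * x'))
      = (m₁ - m₂) * (F * (1 + p ^ 2 * q ^ 2) - C * (p ^ 2 + q ^ 2) + 2 * D * (p * q) - r) := by
  refine mul_left_cancel₀ (mul_ne_zero h₁ h₂) ?_
  have e : (E₁ - 1) * (E₂ - 1)
      * ((E + 1) * (p * q + 1) ^ 2 * ((1 - m₂ * x) * (1 - m₁ * x')))
      = (E + 1) * (p * q + 1) ^ 2 * (((E₂ - 1) - m₂ * (E₂ - 1) * x)
        * ((E₁ - 1) - m₁ * (E₁ - 1) * x')) := by ring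
  have e' : (E₁ - 1) * (E₂ - 1) * ((m₁ - m₂)
      * (F * (1 + p ^ 2 * q ^ 2) - C * (p ^ 2 + q ^ 2) + 2 * D * (p * q) - r))
      = (m₁ * (E₁ - 1) * (E₂ - 1) - m₂ * (E₂ - 1) * (E₁ - 1))
      * (F * (1 + p ^ 2 * q ^ 2) - C * (p ^ 2 + q ^ 2) + 2 * D * (p * q) - r) := by ring
  rw [e, e', hm₁, hm₂]
  linear_combination -(E₂ + 1) * (E₁ - 1) * hx - (E₁ + 1) * (E₂ - 1) * hx'
    + (E₁ + 1) * (E₂ + 1) * hxx' - 2 * (1 + p ^ 2 * q ^ 2) * hF + 2 * (p ^ 2 + q ^ 2) * hC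
    - 4 * (p * q) * hD

/-- This supplies three of the five factors of f₅. With `deriv_x_eq` it is Euler's addition theorem
in a form that uses only the product Δ(p)Δ(q) and no separate branches of Δ(p) and Δ(q). -/
theorem derivNumerator_sq (hr : r ^ 2 = quarticΔ E p * quarticΔ E q)
    (hm : m * (E - 1) = E + 1)
    (hx : (E + 1) * (p * q + 1) ^ 2 * x = E * (1 + p ^ 2 * q ^ 2) - (p ^ 2 + q ^ 2) - r) :
    derivNumerator E p q r ^ 2 = -((E ^ 2 - 1) * (E + 1)) / 2 * quarticΔ E p
      * (x * (1 - x) * (1 - m * x)) * (p * q + 1) ^ 6 := by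
  have e : -((E ^ 2 - 1) * (E + 1)) / 2 * quarticΔ E p
      * (x * (1 - x) * (1 - m * x)) * (p * q + 1) ^ 6 = -(1 / 2) * quarticΔ E p
      * ((E + 1) * (p * q + 1) ^ 2 * x)
      * ((E + 1) * (p * q + 1) ^ 2 - (E + 1) * (p * q + 1) ^ 2 * x)
      * ((E - 1) * (p * q + 1) ^ 2 - (E + 1) * (p * q + 1) ^ 2 * x) := by
    linear_combination (E + 1) ^ 2 / 2 * quarticΔ E p * x ^ 2 * (1 - x) * (p * q + 1) ^ 6 * hm
  rw [e, hx, derivNumerator]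
  rw [quarticΔ, quarticΔ] at *
  linear_combination ((q + E * p - E * p ^ 2 * q - p ^ 3) ^ 2
    + (1 - 2 * E * p ^ 2 + p ^ 4) / 2 * (-2 * E * (p * q + 1) ^ 2
      + 3 * (E * (1 + p ^ 2 * q ^ 2) - (p ^ 2 + q ^ 2)) - r)) * hr

theorem deriv_x_eq {p' q' r' dx : ℂ} (hr : r ^ 2 = quarticΔ E p * quarticΔ E q)
    (hr' : 2 * r * r' = (-4 * E * p + 4 * p ^ 3) * p' * quarticΔ E q
      + quarticΔ E p * ((-4 * E * q + 4 * q ^ 3) * q'))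
    (hE : E + 1 ≠ 0) (h : p * q + 1 ≠ 0) (hr0 : r ≠ 0) (hp : quarticΔ E p ≠ 0)
    (hx : (E + 1) * (p * q + 1) ^ 2 * x = E * (1 + p ^ 2 * q ^ 2) - (p ^ 2 + q ^ 2) - r)
    (hdx : (E + 1) * (2 * (p * q + 1) * (p' * q + p * q') * x + (p * q + 1) ^ 2 * dx)
      = E * (2 * p * p' * q ^ 2 + 2 * p ^ 2 * q * q') - (2 * p * p' + 2 * q * q') - r') :
    dx = 2 * derivNumerator E p q r / ((E + 1) * (p * q + 1) ^ 3 * quarticΔ E p)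
      * (p' - quarticΔ E p / r * q') := by
  have h1 : (E + 1) * (p * q + 1) ^ 3 * (r * quarticΔ E p) * dx
      = 2 * derivNumerator E p q r * (r * p' - quarticΔ E p * q') := by
    rw [derivNumerator]
    have e : (E + 1) * (p * q + 1) ^ 3 * dx
        = (E * (2 * p * p' * q ^ 2 + 2 * p ^ 2 * q * q') - (2 * p * p' + 2 * q * q') - r')
          * (p * q + 1) - 2 * (p' * q + p * q')
          * (E * (1 + p ^ 2 * q ^ 2) - (p ^ 2 + q ^ 2) - r) := by
      linear_combination (p * q + 1) * hdx - 2 * (p' * q + p * q') * hx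
    rw [quarticΔ, quarticΔ] at *
    linear_combination r * (1 - 2 * E * p ^ 2 + p ^ 4) * e
      - (1 - 2 * E * p ^ 2 + p ^ 4) / 2 * (p * q + 1) * hr'
      + (2 * (1 - 2 * E * p ^ 2 + p ^ 4) * (p' * q + p * q')
        - 2 * (q + E * p - E * p ^ 2 * q - p ^ 3) * p') * hr
  have h2 : (E + 1) * (p * q + 1) ^ 3 * (r * quarticΔ E p) ≠ 0 :=
    mul_ne_zero (mul_ne_zero hE (pow_ne_zero 3 h)) (mul_ne_zero hr0 hp)
  refine mul_left_cancel₀ h2 (h1.trans ?_)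
  field_simp

/-- W is the coefficient of ν in dx. Its factor rP₂² − Δp P₁² has a square proportional to B − r:
the cross term comes from r² = ΔpΔq and the sum of the squares from the Kummer relation. -/
theorem coeff_sq {W J A f g B K c h P₁ P₂ Δp Δq : ℂ} (hE : E + 1 ≠ 0) (hh : h ≠ 0) (hp : Δp ≠ 0)
    (hr0 : r ≠ 0) (hP₁ : P₁ ≠ 0) (hP₂ : P₂ ≠ 0) (hr : r ^ 2 = Δp * Δq)
    (hW : W = 2 * J / ((E + 1) * h ^ 3 * Δp) * ((1 / P₁ ^ 2 - Δp / (r * P₂ ^ 2)) * A))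
    (hJ : J ^ 2 = -((E ^ 2 - 1) * (E + 1)) / 2 * Δp * f * h ^ 6)
    (hA : A ^ 2 = K / 2 * (P₁ * P₂) ^ 2 * (c * (E + 1) * h ^ 2 * g))
    (hk : P₁ ^ 4 * Δp + P₂ ^ 4 * Δq = 2 * (P₁ * P₂) ^ 2 * B) :
    W ^ 2 * r ^ 2 = -2 * (E ^ 2 - 1) * f * (B - r) * K * c * h ^ 2 * g := by
  have hu : (r * P₂ ^ 2 - Δp * P₁ ^ 2) ^ 2 = 2 * Δp * (P₁ * P₂) ^ 2 * (B - r) := by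
    linear_combination P₂ ^ 4 * hr + Δp * hk
  have e : W * r * ((E + 1) * h ^ 3 * Δp * (P₁ * P₂) ^ 2)
      = 2 * J * A * (r * P₂ ^ 2 - Δp * P₁ ^ 2) := by
    rw [hW]
    field_simp
  have h0 : ((E + 1) * h ^ 3 * Δp * (P₁ * P₂) ^ 2) ^ 2 ≠ 0 :=
    pow_ne_zero 2 (mul_ne_zero (mul_ne_zero (mul_ne_zero hE (pow_ne_zero 3 hh)) hp)
      (pow_ne_zero 2 (mul_ne_zero hP₁ hP₂)))
  refine mul_right_cancel₀ h0 ?_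
  have e2 := congrArg (fun x => x ^ 2) e
  have e3 : (2 * J * A * (r * P₂ ^ 2 - Δp * P₁ ^ 2)) ^ 2
      = 4 * (J ^ 2) * (A ^ 2) * (r * P₂ ^ 2 - Δp * P₁ ^ 2) ^ 2 := by ring
  rw [hJ, hA, hu] at e3
  linear_combination e2 + e3

/-- V and W are the coefficients of μ and ν in dx. They contain the conjugate factors rP₂² ± Δp P₁²,
whose product is Δp times the difference appearing in AA'. After multiplication by the nonzero
factor of W, that difference occurs squared and becomes a multiple of (B − r)(B + r). -/
theorem coeff_relation {W V J A A' g B K K₃ c h P₁ P₂ Δp Δq κ₁ κ₂ d l l' : ℂ} (hE : E + 1 ≠ 0)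
    (hh : h ≠ 0) (hp : Δp ≠ 0) (hr0 : r ≠ 0) (hP₁ : P₁ ≠ 0) (hP₂ : P₂ ≠ 0)
    (hr : r ^ 2 = Δp * Δq)
    (hW : W = 2 * J / ((E + 1) * h ^ 3 * Δp) * ((1 / P₁ ^ 2 - Δp / (r * P₂ ^ 2)) * A))
    (hV : V = 2 * J / ((E + 1) * h ^ 3 * Δp) * ((1 / P₁ ^ 2 + Δp / (r * P₂ ^ 2)) * A'))
    (hA : A ^ 2 = K / 2 * (P₁ * P₂) ^ 2 * (c * (E + 1) * h ^ 2 * (g * l)))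
    (hAA' : A * A' = K₃ * (P₂ ^ 4 * Δq - P₁ ^ 4 * Δp))
    (hk : P₁ ^ 4 * Δp + P₂ ^ 4 * Δq = 2 * (P₁ * P₂) ^ 2 * B)
    (hB : (E + 1) * h ^ 2 * (l' * g) = d * (B + r))
    (hκ : κ₂ * (K * c * d) = -4 * κ₁ * K₃) (hW0 : W ≠ 0) :
    V * (κ₁ * l) = -κ₂ * l' * W := by
  have eW : W * ((E + 1) * h ^ 3 * Δp * (r * (P₁ * P₂) ^ 2))
      = 2 * J * (A * (r * P₂ ^ 2 - Δp * P₁ ^ 2)) := by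
    rw [hW]
    field_simp
  have eV : V * ((E + 1) * h ^ 3 * Δp * (r * (P₁ * P₂) ^ 2))
      = 2 * J * (A' * (r * P₂ ^ 2 + Δp * P₁ ^ 2)) := by
    rw [hV]
    field_simp
  have h0 : (E + 1) * h ^ 3 * Δp * (r * (P₁ * P₂) ^ 2) ≠ 0 :=
    mul_ne_zero (mul_ne_zero (mul_ne_zero hE (pow_ne_zero 3 hh)) hp)
      (mul_ne_zero hr0 (pow_ne_zero 2 (mul_ne_zero hP₁ hP₂)))
  have hu0 : A * (r * P₂ ^ 2 - Δp * P₁ ^ 2) ≠ 0 :=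
    right_ne_zero_of_mul (eW ▸ mul_ne_zero hW0 h0)
  have hu : (r * P₂ ^ 2 - Δp * P₁ ^ 2) ^ 2 = 2 * Δp * (P₁ * P₂) ^ 2 * (B - r) := by
    linear_combination P₂ ^ 4 * hr + Δp * hk
  have hv : (P₂ ^ 4 * Δq - P₁ ^ 4 * Δp) ^ 2 = 4 * (P₁ * P₂) ^ 4 * ((B - r) * (B + r)) := by
    linear_combination (P₁ ^ 4 * Δp + P₂ ^ 4 * Δq + 2 * (P₁ * P₂) ^ 2 * B) * hk
      + 4 * (P₁ * P₂) ^ 4 * hr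
  have key : A' * (r * P₂ ^ 2 + Δp * P₁ ^ 2) * (κ₁ * l)
      = -κ₂ * l' * (A * (r * P₂ ^ 2 - Δp * P₁ ^ 2)) := by
    refine mul_left_cancel₀ hu0 ?_
    have e1 : (A * (r * P₂ ^ 2 - Δp * P₁ ^ 2)) * (A' * (r * P₂ ^ 2 + Δp * P₁ ^ 2) * (κ₁ * l))
        = κ₁ * l * K₃ * Δp * (P₂ ^ 4 * Δq - P₁ ^ 4 * Δp) ^ 2 := by
      linear_combination κ₁ * l * (r ^ 2 * P₂ ^ 4 - Δp ^ 2 * P₁ ^ 4) * hAA'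
        + κ₁ * l * P₂ ^ 4 * K₃ * (P₂ ^ 4 * Δq - P₁ ^ 4 * Δp) * hr
    have e2 : (A * (r * P₂ ^ 2 - Δp * P₁ ^ 2)) * (-κ₂ * l' * (A * (r * P₂ ^ 2 - Δp * P₁ ^ 2)))
        = -κ₂ * l' * (A ^ 2 * (r * P₂ ^ 2 - Δp * P₁ ^ 2) ^ 2) := by ring
    rw [e1, e2, hv, hA, hu]
    linear_combination (κ₂ * K * c * l * (P₁ * P₂) ^ 4 * Δp * (B - r)) * hB
      + l * Δp * (P₁ * P₂) ^ 4 * (B - r) * (B + r) * hκ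
  refine mul_left_cancel₀ h0 ?_
  linear_combination κ₁ * l * eV + κ₂ * l' * eW + 2 * J * key

end Algebra

/-! ### Quasi-periodicity and the independence of μ and ν. -/

namespace Period

variable (τ : Period)

theorem theta_zero_add_fst (b d : ℝ) (z : ℂ × ℂ) :
    τ.theta 0 0 b d (z + (1, 0)) = τ.theta 0 0 b d z := by
  have h := τ.theta_shift_fst 0 0 b d z
  rw [exp_pi_I_zero, one_mul] at h
  rw [← h, theta_eq_tsum, theta_eq_tsum]
  refine tsum_congr fun k => ?_
  simp only [thetaTerm, Prod.fst_add, Prod.snd_add]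
  congr 1
  push_cast
  ring

theorem theta_zero_add_snd (b d : ℝ) (z : ℂ × ℂ) :
    τ.theta 0 0 b d (z + (0, 1)) = τ.theta 0 0 b d z := by
  have h := τ.theta_shift_snd 0 0 b d z
  rw [exp_pi_I_zero, one_mul] at h
  rw [← h, theta_eq_tsum, theta_eq_tsum]
  refine tsum_congr fun k => ?_
  simp only [thetaTerm, Prod.fst_add, Prod.snd_add]
  congr 1
  push_cast
  ring

theorem theta_add_period_fst (a c b d : ℝ) (z : ℂ × ℂ) :
    τ.theta a c b d z = τ.theta a c b d (z + (τ.τ₁₁, τ.τ₁₂))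
      * exp (2 * Real.pi * I * (τ.τ₁₁ / 2 + b / 2 + z.1)) := by
  rw [theta_eq_tsum, theta_eq_tsum, ← tsum_mul_right,
    ← (Equiv.addRight ((1, 0) : ℤ × ℤ)).tsum_eq]
  refine tsum_congr fun k => ?_
  simp only [thetaTerm, Equiv.coe_addRight, Prod.fst_add, Prod.snd_add, ← exp_add]
  congr 1
  push_cast
  ring

theorem theta_add_period_snd (a c b d : ℝ) (z : ℂ × ℂ) :
    τ.theta a c b d z = τ.theta a c b d (z + (τ.τ₁₂, τ.τ₂₂))
      * exp (2 * Real.pi * I * (τ.τ₂₂ / 2 + d / 2 + z.2)) := by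
  rw [theta_eq_tsum, theta_eq_tsum, ← tsum_mul_right,
    ← (Equiv.addRight ((0, 1) : ℤ × ℤ)).tsum_eq]
  refine tsum_congr fun k => ?_
  simp only [thetaTerm, Equiv.coe_addRight, Prod.fst_add, Prod.snd_add, ← exp_add]
  congr 1
  push_cast
  ring

theorem P₁_neg (z : ℂ × ℂ) : τ.P₁ (-z) = τ.P₁ z := by
  have h1 := τ.theta_neg 0 0 0 1 z
  have h2 := τ.theta_shift_snd 0 0 0 (-1) z
  rw [exp_pi_I_zero, one_mul] at h2
  norm_num at h1 h2
  rw [P₁, P₁, h1, h2]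

/-- A theta function whose directional derivative is a linear form times the function itself
has a vanishing direction. -/
theorem eq_zero_of_fderiv_theta {b d : ℝ} {e : ℂ × ℂ} (l : ℂ × ℂ →L[ℂ] ℂ)
    (h0 : τ.theta 0 0 b d 0 ≠ 0)
    (h : ∀ z, fderiv ℂ (τ.theta 0 0 b d) z e = l z * τ.theta 0 0 b d z) : e = 0 := by
  have hd := τ.differentiable_theta 0 0 b d
  -- At a period w the derivative equals the one at 0, where l vanishes; hence l(w) times the
  -- nonzero theta constant is 0. The periods (1, 0) and (0, 1) already span the plane.
  have hper : ∀ w : ℂ × ℂ, (∀ z, τ.theta 0 0 b d (z + w) = τ.theta 0 0 b d z) → l w = 0 := by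
    intro w hw
    have h1 := (hd (0 + w)).hasFDerivAt.comp (0 : ℂ × ℂ) ((hasFDerivAt_id (𝕜 := ℂ) 0).add_const w)
    have h2 : (τ.theta 0 0 b d ∘ fun z => id z + w) = τ.theta 0 0 b d := funext hw
    rw [h2] at h1
    have h3 := congrArg (fun φ : ℂ × ℂ →L[ℂ] ℂ => φ e) (h1.unique (hd 0).hasFDerivAt)
    simp only [ContinuousLinearMap.comp_id] at h3
    rw [h, h, hw, map_add, map_zero, zero_mul, zero_add] at h3
    exact (mul_eq_zero.1 h3).resolve_right h0
  have hl : ∀ z, l z = 0 := fun z => by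
    rw [apply_eq_fst_add_snd, hper _ (τ.theta_zero_add_fst b d), hper _ (τ.theta_zero_add_snd b d)]
    ring
  have hz : ∀ z, fderiv ℂ (τ.theta 0 0 b d) z e = 0 := fun z => by rw [h, hl, zero_mul]
  -- The derivative of theta along e is now zero everywhere, so differentiating a quasi-periodicity
  -- relation leaves only the derivative 2πi φ(e) of the exponent.
  have hq : ∀ (w : ℂ × ℂ) (c : ℂ) (φ : ℂ × ℂ →L[ℂ] ℂ),
      (∀ z, τ.theta 0 0 b d z = τ.theta 0 0 b d (z + w) * exp (2 * Real.pi * I * (c + φ z))) →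
      φ e = 0 := by
    intro w c φ hw
    have h1 := (hd (0 + w)).hasFDerivAt.comp (0 : ℂ × ℂ) ((hasFDerivAt_id (𝕜 := ℂ) 0).add_const w)
    have h2 := ((φ.hasFDerivAt (x := (0 : ℂ × ℂ))).const_add c).const_mul (2 * Real.pi * I)
    have h3 := (h1.mul h2.cexp).congr_of_eventuallyEq (Filter.Eventually.of_forall hw)
    have h4 := congrArg (fun φ : ℂ × ℂ →L[ℂ] ℂ => φ e) (h3.unique (hd 0).hasFDerivAt)
    simp only [ContinuousLinearMap.comp_id, _root_.add_apply, _root_.smul_apply, smul_eq_mul,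
      hz, mul_zero, add_zero, Function.comp_apply, id] at h4
    have h5 := hw 0
    rw [h5] at h0
    have h6 : (2 * Real.pi * I : ℂ) ≠ 0 := two_pi_I_ne_zero
    have h7 := left_ne_zero_of_mul h0
    rw [zero_add] at h7
    simpa [h7, h6, exp_ne_zero] using h4
  exact Prod.ext
    (hq (τ.τ₁₁, τ.τ₁₂) (τ.τ₁₁ / 2 + b / 2) (ContinuousLinearMap.fst ℂ ℂ ℂ)
      (τ.theta_add_period_fst 0 0 b d))
    (hq (τ.τ₁₂, τ.τ₂₂) (τ.τ₂₂ / 2 + d / 2) (ContinuousLinearMap.snd ℂ ℂ ℂ)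
      (τ.theta_add_period_snd 0 0 b d))

variable {τ}

theorem Nondegenerate.P₁_zero_pow_ne (h : τ.Nondegenerate) : τ.P₁ 0 ^ 4 - τ.P₂ 0 ^ 4 ≠ 0 := by
  have h1 : τ.P₁ 0 ^ 4 - τ.P₂ 0 ^ 4
      = 4 * ((τ.t ^ 2 - τ.w ^ 2) * (τ.u ^ 2 - τ.v ^ 2)) := by
    linear_combination (τ.P₁ 0 ^ 2 + (τ.t ^ 2 + τ.u ^ 2 - τ.v ^ 2 - τ.w ^ 2)) * τ.P₁_zero_sq
      - (τ.P₂ 0 ^ 2 + (τ.t ^ 2 - τ.u ^ 2 + τ.v ^ 2 - τ.w ^ 2)) * τ.P₂_zero_sq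
  rw [h1]
  exact mul_ne_zero (by norm_num) (mul_ne_zero h.tw h.uv)

/-- `P₁(z + a) P₁(z - a)` is a combination of `P₁²`, `P₂²`, `S₁²`, `S₂²`. -/
theorem Nondegenerate.exists_P₁_add_mul_P₁_sub (h : τ.Nondegenerate) (a : ℂ × ℂ) :
    ∃ c₁ c₂ c₃ c₄ : ℂ, ∀ z, τ.P₁ (z + a) * τ.P₁ (z - a)
      = c₁ * τ.P₁ z ^ 2 + c₂ * τ.P₂ z ^ 2 + c₃ * τ.S₁ z ^ 2 + c₄ * τ.S₂ z ^ 2 := by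
  have h1 := h.tw
  have h2 := h.uv
  refine ⟨(τ.t * τ.X₀ a - τ.w * τ.X₃ a) / (2 * (τ.t ^ 2 - τ.w ^ 2))
      + (τ.u * τ.X₁ a - τ.v * τ.X₂ a) / (2 * (τ.u ^ 2 - τ.v ^ 2)),
    (τ.t * τ.X₀ a - τ.w * τ.X₃ a) / (2 * (τ.t ^ 2 - τ.w ^ 2))
      - (τ.u * τ.X₁ a - τ.v * τ.X₂ a) / (2 * (τ.u ^ 2 - τ.v ^ 2)),
    (τ.t * τ.X₃ a - τ.w * τ.X₀ a) / (2 * (τ.t ^ 2 - τ.w ^ 2))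
      + (τ.u * τ.X₂ a - τ.v * τ.X₁ a) / (2 * (τ.u ^ 2 - τ.v ^ 2)),
    (τ.t * τ.X₃ a - τ.w * τ.X₀ a) / (2 * (τ.t ^ 2 - τ.w ^ 2))
      - (τ.u * τ.X₂ a - τ.v * τ.X₁ a) / (2 * (τ.u ^ 2 - τ.v ^ 2)), fun z => ?_⟩
  rw [P₁_add_mul_P₁_sub, P₁_sq, P₂_sq, S₁_sq, S₂_sq]
  field_simp
  ring

theorem hasFDerivAt_sq {f : ℂ × ℂ → ℂ} (hf : Differentiable ℂ f) (z : ℂ × ℂ) :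
    HasFDerivAt (fun z => f z ^ 2) ((2 * f z) • fderiv ℂ f z) z := by
  simpa using (hf z).hasFDerivAt.pow 2

/-- Along a direction killed by `μ` and `ν` the logarithmic derivatives of the theta functions
`P₁, P₂, S₁, S₂` agree near the origin. -/
theorem Nondegenerate.eventually_log_fderiv (h : τ.Nondegenerate) {e : ℂ × ℂ}
    (hν : τ.ν e = 0) (hμ : τ.μ e = 0) : ∀ᶠ z in nhds (0 : ℂ × ℂ), τ.P₁ z ≠ 0 ∧
      τ.P₁ z * fderiv ℂ τ.P₂ z e = τ.P₂ z * fderiv ℂ τ.P₁ z e ∧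
      τ.P₁ z * fderiv ℂ τ.S₁ z e = τ.S₁ z * fderiv ℂ τ.P₁ z e ∧
      τ.P₁ z * fderiv ℂ τ.S₂ z e = τ.S₂ z * fderiv ℂ τ.P₁ z e := by
  have c1 := τ.differentiable_P₁.continuous
  have c2 := τ.differentiable_P₂.continuous
  have c3 := τ.differentiable_S₁.continuous
  have c4 := τ.differentiable_S₂.continuous
  have n1 : ∀ᶠ z in nhds (0 : ℂ × ℂ), τ.P₁ z ≠ 0 := c1.continuousAt.eventually_ne h.P₁_zero_ne
  have n2 : ∀ᶠ z in nhds (0 : ℂ × ℂ), τ.P₂ z ≠ 0 := c2.continuousAt.eventually_ne h.P₂_zero_ne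
  -- If P₁, S₁ have logarithmic derivative λ along e and P₂, S₂ have λ', homogeneity of the quartic
  -- in the two pairs gives (λ − λ')(Q₁ − Q₂) = 0, where Qᵢ collects its terms in the i-th pair
  -- alone. The expression here is Q₁ − Q₂; at the origin it is P₁⁴ − P₂⁴.
  have n3 : ∀ᶠ z in nhds (0 : ℂ × ℂ),
      (τ.P₁ z ^ 4 + τ.S₁ z ^ 4 - 2 * τ.E * (τ.P₁ z ^ 2 * τ.S₁ z ^ 2))
        - (τ.P₂ z ^ 4 + τ.S₂ z ^ 4 - 2 * τ.E * (τ.P₂ z ^ 2 * τ.S₂ z ^ 2)) ≠ 0 := by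
    refine ContinuousAt.eventually_ne (Continuous.continuousAt (by fun_prop)) ?_
    rw [τ.S₁_zero, τ.S₂_zero]
    have := h.P₁_zero_pow_ne
    contrapose! this
    linear_combination this
  filter_upwards [n1, n2, n3] with z h1 h2 h3
  have w1 := h.wronskian₁ z e
  have w2 := h.wronskian₂ z e
  rw [hν, hμ] at w1 w2
  have d1 := hasFDerivAt_sq τ.differentiable_P₁ z
  have d2 := hasFDerivAt_sq τ.differentiable_P₂ z
  have d3 := hasFDerivAt_sq τ.differentiable_S₁ z
  have d4 := hasFDerivAt_sq τ.differentiable_S₂ z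
  have e1 := (τ.differentiable_P₁ z).hasFDerivAt
  have e2 := (τ.differentiable_P₂ z).hasFDerivAt
  have e3 := (τ.differentiable_S₁ z).hasFDerivAt
  have e4 := (τ.differentiable_S₂ z).hasFDerivAt
  have hk : (fun z => τ.P₁ z ^ 2 * τ.P₁ z ^ 2 + τ.S₁ z ^ 2 * τ.S₁ z ^ 2 + τ.P₂ z ^ 2 * τ.P₂ z ^ 2
      + τ.S₂ z ^ 2 * τ.S₂ z ^ 2
      - 2 * τ.E * (τ.P₁ z ^ 2 * τ.S₁ z ^ 2 + τ.P₂ z ^ 2 * τ.S₂ z ^ 2)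
      - 2 * τ.F * (τ.P₁ z ^ 2 * τ.P₂ z ^ 2 + τ.S₁ z ^ 2 * τ.S₂ z ^ 2)
      + 2 * τ.C * (τ.P₁ z ^ 2 * τ.S₂ z ^ 2 + τ.P₂ z ^ 2 * τ.S₁ z ^ 2)
      - 4 * τ.D * (τ.P₁ z * τ.P₂ z * (τ.S₁ z * τ.S₂ z))) = fun _ => 0 := by
    ext z
    rw [← h.kummer z]
    ring
  have hd := (((((((d1.mul d1).add (d3.mul d3)).add (d2.mul d2)).add (d4.mul d4)).sub
    (((d1.mul d3).add (d2.mul d4)).const_mul (2 * τ.E))).sub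
    (((d1.mul d2).add (d3.mul d4)).const_mul (2 * τ.F))).add
    (((d1.mul d4).add (d2.mul d3)).const_mul (2 * τ.C))).sub
    (((e1.mul e2).mul (e3.mul e4)).const_mul (4 * τ.D))
  have hk' : HasFDerivAt _ (0 : ℂ × ℂ →L[ℂ] ℂ) z := hk ▸ hasFDerivAt_const (0 : ℂ) z
  have hz := congrArg (fun φ : ℂ × ℂ →L[ℂ] ℂ => φ e) (hd.unique hk')
  simp only [_root_.smul_apply, _root_.add_apply, _root_.sub_apply, _root_.zero_apply,
    smul_eq_mul, Pi.mul_apply] at hz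
  have hkz := h.kummer z
  have hP : τ.P₁ z * fderiv ℂ τ.P₂ z e = τ.P₂ z * fderiv ℂ τ.P₁ z e := by
    refine mul_left_cancel₀ h3 ?_
    linear_combination (-1 / 2 : ℂ) * τ.P₁ z * τ.P₂ z * hz
      + 2 * τ.P₂ z * (τ.S₁ z ^ 3 - τ.E * τ.P₁ z ^ 2 * τ.S₁ z - τ.F * τ.S₁ z * τ.S₂ z ^ 2
        + τ.C * τ.P₂ z ^ 2 * τ.S₁ z - τ.D * τ.P₁ z * τ.P₂ z * τ.S₂ z) * w1
      + 2 * τ.P₁ z * (τ.S₂ z ^ 3 - τ.E * τ.P₂ z ^ 2 * τ.S₂ z - τ.F * τ.S₁ z ^ 2 * τ.S₂ z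
        + τ.C * τ.P₁ z ^ 2 * τ.S₂ z - τ.D * τ.P₁ z * τ.P₂ z * τ.S₁ z) * w2
      + (fderiv ℂ τ.P₁ z e * τ.P₂ z + τ.P₁ z * fderiv ℂ τ.P₂ z e) * hkz
  refine ⟨h1, hP, by linear_combination w1, ?_⟩
  refine mul_left_cancel₀ h2 ?_
  linear_combination τ.P₁ z * w2 + τ.S₂ z * hP

/-- Two entire functions on `ℂ²` that agree near the origin are equal. -/
theorem eq_of_eventuallyEq_zero {f g : ℂ × ℂ → ℂ} (hf : Differentiable ℂ f)
    (hg : Differentiable ℂ g) (h : f =ᶠ[nhds 0] g) (z : ℂ × ℂ) : f z = g z := by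
  -- Restriction to the complex line through z reduces the claim to the identity theorem in one
  -- variable.
  have hl : Differentiable ℂ fun s : ℂ => s • z := differentiable_id.smul_const z
  have h1 : AnalyticOnNhd ℂ (fun s : ℂ => f (s • z)) Set.univ :=
    (hf.comp hl).differentiableOn.analyticOnNhd isOpen_univ
  have h2 : AnalyticOnNhd ℂ (fun s : ℂ => g (s • z)) Set.univ :=
    (hg.comp hl).differentiableOn.analyticOnNhd isOpen_univ
  have h3 : Filter.Tendsto (fun s : ℂ => s • z) (nhds 0) (nhds 0) := by
    simpa using hl.continuous.tendsto 0
  have h4 := congrFun (h1.eq_of_eventuallyEq h2 (z₀ := 0) (h3.eventually h)) 1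
  simpa using h4

/-- A differentiable function that is additive near the origin is linear there. -/
theorem exists_linear_of_additive {g : ℂ × ℂ → ℂ} {ε : ℝ} (hε : 0 < ε)
    (hg : ∀ z ∈ Metric.ball (0 : ℂ × ℂ) ε, DifferentiableAt ℂ g z)
    (hadd : ∀ x ∈ Metric.ball (0 : ℂ × ℂ) ε, ∀ y ∈ Metric.ball (0 : ℂ × ℂ) ε,
      g (x + y) = g x + g y) :
    ∃ l : ℂ × ℂ →L[ℂ] ℂ, ∀ z ∈ Metric.ball (0 : ℂ × ℂ) ε, g z = l z := by
  have m0 : (0 : ℂ × ℂ) ∈ Metric.ball (0 : ℂ × ℂ) ε := Metric.mem_ball_self hε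
  have g0 : g 0 = 0 := by simpa using hadd 0 m0 0 m0
  have hc : ∀ x ∈ Metric.ball (0 : ℂ × ℂ) ε, fderiv ℂ g x = fderiv ℂ g 0 := by
    intro x hx
    have h1 : HasFDerivAt g (fderiv ℂ g x) (x + id 0) := by simpa using (hg x hx).hasFDerivAt
    have h2 := h1.comp (0 : ℂ × ℂ) ((hasFDerivAt_id (𝕜 := ℂ) 0).const_add x)
    have h3 := (hg 0 m0).hasFDerivAt.const_add (g x)
    have h4 : (g ∘ fun y => x + id y) =ᶠ[nhds 0] fun y => g x + g y := by
      filter_upwards [Metric.ball_mem_nhds (0 : ℂ × ℂ) hε] with y hy using hadd x hx y hy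
    simpa using h2.unique (h3.congr_of_eventuallyEq h4)
  refine ⟨fderiv ℂ g 0, fun z hz => ?_⟩
  have hd : ∀ x ∈ Metric.ball (0 : ℂ × ℂ) ε, HasFDerivAt (fun y => g y - fderiv ℂ g 0 y) 0 x :=
    fun x hx => by
      have := (hg x hx).hasFDerivAt.sub (fderiv ℂ g 0).hasFDerivAt
      rwa [hc x hx, sub_self] at this
  have := Metric.isOpen_ball.is_const_of_fderiv_eq_zero (𝕜 := ℂ)
    (convex_ball (0 : ℂ × ℂ) ε).isPreconnected
    (fun x hx => (hd x hx).differentiableAt.differentiableWithinAt)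
    (fun x hx => (hd x hx).fderiv) hz m0
  rw [g0, map_zero, sub_zero] at this
  exact sub_eq_zero.1 this

/-- The linear forms `μ` and `ν` are independent. -/
theorem Nondegenerate.eq_zero_of_forms (h : τ.Nondegenerate) {e : ℂ × ℂ}
    (hν : τ.ν e = 0) (hμ : τ.μ e = 0) : e = 0 := by
  have hdP := τ.differentiable_P₁
  have hdP' : Differentiable ℂ fun z => fderiv ℂ τ.P₁ z e :=
    τ.differentiable_fderiv_theta_apply 0 0 0 1 e
  obtain ⟨ε, hε, hball⟩ := Metric.eventually_nhds_iff_ball.1 (h.eventually_log_fderiv hν hμ)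
  -- the derivative of `P₁(z + a) P₁(z - a)` along `e`
  have hprod : ∀ z ∈ Metric.ball (0 : ℂ × ℂ) ε, ∀ a,
      τ.P₁ z * (fderiv ℂ τ.P₁ (z + a) e * τ.P₁ (z - a) + τ.P₁ (z + a) * fderiv ℂ τ.P₁ (z - a) e)
        = 2 * fderiv ℂ τ.P₁ z e * (τ.P₁ (z + a) * τ.P₁ (z - a)) := by
    intro z hz a
    obtain ⟨h1, h2, h3, h4⟩ := hball z hz
    obtain ⟨c₁, c₂, c₃, c₄, hc⟩ := h.exists_P₁_add_mul_P₁_sub a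
    have d1 := ((hdP (z + a)).hasFDerivAt.comp z ((hasFDerivAt_id (𝕜 := ℂ) z).add_const a)).mul
      ((hdP (z - a)).hasFDerivAt.comp z ((hasFDerivAt_id (𝕜 := ℂ) z).sub_const a))
    have d2 := ((((hasFDerivAt_sq hdP z).const_mul c₁).add
      ((hasFDerivAt_sq τ.differentiable_P₂ z).const_mul c₂)).add
      ((hasFDerivAt_sq τ.differentiable_S₁ z).const_mul c₃)).add
      ((hasFDerivAt_sq τ.differentiable_S₂ z).const_mul c₄)
    have d3 := d2.congr_of_eventuallyEq (Filter.Eventually.of_forall hc)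
    have d4 := congrArg (fun φ : ℂ × ℂ →L[ℂ] ℂ => φ e) (d1.unique d3)
    simp only [ContinuousLinearMap.comp_id, _root_.add_apply, _root_.smul_apply, smul_eq_mul,
      Function.comp_apply, id] at d4
    rw [hc]
    linear_combination τ.P₁ z * d4 + 2 * c₂ * τ.P₂ z * h2 + 2 * c₃ * τ.S₁ z * h3
      + 2 * c₄ * τ.S₂ z * h4
  have hodd : fderiv ℂ τ.P₁ 0 e = 0 := by
    have h1 := hasFDerivAt_reflect hdP (g := τ.P₁) fun z => (τ.P₁_neg z).symm
    have h2 := congrArg (fun φ : ℂ × ℂ →L[ℂ] ℂ => φ e) (h1.unique (hdP 0).hasFDerivAt)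
    simp only [_root_.neg_apply] at h2
    linear_combination (-1 / 2 : ℂ) * h2
  -- the logarithmic derivative
  set g : ℂ × ℂ → ℂ := fun z => fderiv ℂ τ.P₁ z e / τ.P₁ z with hg
  have hne : ∀ z ∈ Metric.ball (0 : ℂ × ℂ) ε, τ.P₁ z ≠ 0 := fun z hz => (hball z hz).1
  -- The product formula is applied at the midpoint of x and y, with half their difference as the
  -- shift.
  have hmid : ∀ x ∈ Metric.ball (0 : ℂ × ℂ) ε, ∀ y ∈ Metric.ball (0 : ℂ × ℂ) ε,
      g x + g y = 2 * g ((1 / 2 : ℂ) • (x + y)) := by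
    intro x hx y hy
    have hm : (1 / 2 : ℂ) • (x + y) ∈ Metric.ball (0 : ℂ × ℂ) ε := by
      rw [mem_ball_zero_iff] at *
      rw [norm_smul]
      have := norm_add_le x y
      norm_num
      linarith
    have h1 := hprod _ hm ((1 / 2 : ℂ) • (x - y))
    rw [← smul_add, ← smul_sub, show x + y + (x - y) = (2 : ℂ) • x by rw [two_smul]; abel,
      show x + y - (x - y) = (2 : ℂ) • y by rw [two_smul]; abel, smul_smul, smul_smul,
      show (1 / 2 : ℂ) * 2 = 1 by norm_num, one_smul, one_smul] at h1
    have hx0 := hne x hx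
    have hy0 := hne y hy
    have hm0 := hne _ hm
    simp only [hg]
    field_simp
    linear_combination h1
  have hhalf : ε / 2 < ε := by linarith
  have hsub : Metric.ball (0 : ℂ × ℂ) (ε / 2) ⊆ Metric.ball (0 : ℂ × ℂ) ε :=
    Metric.ball_subset_ball hhalf.le
  have m0 : (0 : ℂ × ℂ) ∈ Metric.ball (0 : ℂ × ℂ) ε := Metric.mem_ball_self hε
  have g0 : g 0 = 0 := by simp [hg, hodd]
  -- Taking y = 0 in the midpoint identity, with g(0) = 0 by parity, turns it into additivity; the
  -- halved radius keeps x + y in the original ball.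
  have hadd : ∀ x ∈ Metric.ball (0 : ℂ × ℂ) (ε / 2), ∀ y ∈ Metric.ball (0 : ℂ × ℂ) (ε / 2),
      g (x + y) = g x + g y := by
    intro x hx y hy
    have hxy : x + y ∈ Metric.ball (0 : ℂ × ℂ) ε := by
      rw [mem_ball_zero_iff] at *
      have := norm_add_le x y
      linarith
    have h1 := hmid _ hxy 0 m0
    rw [add_zero, g0, add_zero] at h1
    rw [h1, hmid x (hsub hx) y (hsub hy)]
  obtain ⟨l, hl⟩ := exists_linear_of_additive (half_pos hε)
    (fun z hz => by
      simp only [hg, div_eq_mul_inv]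
      exact (hdP' z).mul ((hdP z).inv (hne z (hsub hz)))) hadd
  refine τ.eq_zero_of_fderiv_theta (b := 0) (d := 1) l h.P₁_zero_ne fun z => ?_
  refine eq_of_eventuallyEq_zero (f := fun z => fderiv ℂ τ.P₁ z e) (g := fun z => l z * τ.P₁ z)
    hdP' (l.differentiable.mul hdP) ?_ z
  filter_upwards [Metric.ball_mem_nhds (0 : ℂ × ℂ) (half_pos hε)] with z hz
  rw [← hl z hz, hg, div_mul_cancel₀ _ (hne z (hsub hz))]

end Period

/-! ### The differentials of x and x' on the domain of a branch. -/

theorem hasDerivAt_quarticΔ {p : ℂ → ℂ} {E p' s : ℂ} (hp : HasDerivAt p p' s) :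
    HasDerivAt (fun t => quarticΔ E (p t)) ((-4 * E * p s + 4 * p s ^ 3) * p') s := by
  have := (((hp.pow 2).const_mul (2 * E)).const_sub 1).add (hp.pow 4)
  refine this.congr_deriv ?_
  norm_num
  ring

theorem deriv_x_eq_of_hasDerivAt {p q r x : ℂ → ℂ} {E p' q' r' x' s : ℂ} (hp : HasDerivAt p p' s)
    (hq : HasDerivAt q q' s) (hr : HasDerivAt r r' s) (hx : HasDerivAt x x' s)
    (h1 : ∀ᶠ t in nhds s, r t ^ 2 = quarticΔ E (p t) * quarticΔ E (q t))
    (h2 : ∀ᶠ t in nhds s, (E + 1) * (p t * q t + 1) ^ 2 * x t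
      = E * (1 + p t ^ 2 * q t ^ 2) - (p t ^ 2 + q t ^ 2) - r t)
    (hE : E + 1 ≠ 0) (h : p s * q s + 1 ≠ 0) (hr0 : r s ≠ 0) (hp0 : quarticΔ E (p s) ≠ 0) :
    x' = 2 * derivNumerator E (p s) (q s) (r s)
      / ((E + 1) * (p s * q s + 1) ^ 3 * quarticΔ E (p s))
      * (p' - quarticΔ E (p s) / r s * q') := by
  have d1 := ((hasDerivAt_quarticΔ (E := E) hp).mul (hasDerivAt_quarticΔ (E := E) hq)).unique
    ((hr.pow 2).congr_of_eventuallyEq (h1.mono fun t ht => ht.symm))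
  have d2 := ((((hp.mul hq).add_const 1).pow 2).const_mul (E + 1)).mul hx
  have d3 := ((((((hp.pow 2).mul (hq.pow 2)).const_add 1).const_mul E).sub
    ((hp.pow 2).add (hq.pow 2))).sub hr).unique (d2.congr_of_eventuallyEq
      (h2.mono fun t ht => ht.symm))
  refine deriv_x_eq (r' := r') h1.self_of_nhds ?_ hE h hr0 hp0 h2.self_of_nhds ?_
  · norm_num at d1
    linear_combination -d1
  · norm_num at d3
    linear_combination -d3

namespace Period

variable {τ : Period}

/-- Reversing the sign of Δ(p)Δ(q) exchanges x and x', so results on x carry over to x'. -/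
theorem IsBranch.neg {V : Set (ℂ × ℂ)} {r : ℂ × ℂ → ℂ} (hr : τ.IsBranch V r) :
    τ.IsBranch V (-r) where
  isOpen := hr.isOpen
  differentiableOn := hr.differentiableOn.neg
  P₁_ne := hr.P₁_ne
  P₂_ne := hr.P₂_ne
  one_add_pq_ne := hr.one_add_pq_ne
  sq_eq z hz := by rw [Pi.neg_apply, neg_sq, hr.sq_eq z hz]
  ne_zero z hz := neg_ne_zero.2 (hr.ne_zero z hz)
  f₅_x_ne z hz := by simpa [x, x', sub_eq_add_neg] using hr.f₅_x'_ne z hz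
  f₅_x'_ne z hz := by simpa [x, x', sub_eq_add_neg] using hr.f₅_x_ne z hz

variable (τ) in
theorem x_neg (r : ℂ × ℂ → ℂ) : τ.x (-r) = τ.x' r := by
  ext z
  simp [x, x']

variable (τ) in
theorem x'_neg (r : ℂ × ℂ → ℂ) : τ.x' (-r) = τ.x r := by
  ext z
  simp [x, x', sub_eq_add_neg]

section Branch

variable {V : Set (ℂ × ℂ)} {r : ℂ × ℂ → ℂ}

theorem IsBranch.mul_x (h : τ.Nondegenerate) (hr : τ.IsBranch V r) {z : ℂ × ℂ} (hz : z ∈ V) :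
    (τ.E + 1) * (τ.p z * τ.q z + 1) ^ 2 * τ.x r z
      = τ.E * (1 + τ.p z ^ 2 * τ.q z ^ 2) - (τ.p z ^ 2 + τ.q z ^ 2) - r z :=
  mul_div_cancel₀ _ (mul_ne_zero h.E_add_one_ne (pow_ne_zero 2 (hr.one_add_pq_ne z hz)))

theorem IsBranch.mul_x' (h : τ.Nondegenerate) (hr : τ.IsBranch V r) {z : ℂ × ℂ} (hz : z ∈ V) :
    (τ.E + 1) * (τ.p z * τ.q z + 1) ^ 2 * τ.x' r z
      = τ.E * (1 + τ.p z ^ 2 * τ.q z ^ 2) - (τ.p z ^ 2 + τ.q z ^ 2) + r z :=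
  mul_div_cancel₀ _ (mul_ne_zero h.E_add_one_ne (pow_ne_zero 2 (hr.one_add_pq_ne z hz)))

theorem IsBranch.mul_x_mul_x' (h : τ.Nondegenerate) (hr : τ.IsBranch V r) {z : ℂ × ℂ}
    (hz : z ∈ V) : (τ.E + 1) * (τ.p z * τ.q z + 1) ^ 2 * (τ.x r z * τ.x' r z)
      = (τ.E - 1) * (1 - τ.p z * τ.q z) ^ 2 :=
  mul_conj_eq (hr.sq_eq z hz) h.E_add_one_ne (hr.one_add_pq_ne z hz) (hr.mul_x h hz)
    (hr.mul_x' h hz)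

theorem IsBranch.differentiableOn_inv_P₁ (hr : τ.IsBranch V r) :
    DifferentiableOn ℂ (fun z => (τ.P₁ z)⁻¹) V :=
  τ.differentiable_P₁.differentiableOn.inv hr.P₁_ne

theorem IsBranch.differentiableOn_inv_P₂ (hr : τ.IsBranch V r) :
    DifferentiableOn ℂ (fun z => (τ.P₂ z)⁻¹) V :=
  τ.differentiable_P₂.differentiableOn.inv hr.P₂_ne

theorem IsBranch.differentiableOn_p (hr : τ.IsBranch V r) : DifferentiableOn ℂ τ.p V := by
  simp only [funext_iff.2 fun z => show τ.p z = τ.S₁ z * (τ.P₁ z)⁻¹ from div_eq_mul_inv _ _]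
  exact τ.differentiable_S₁.differentiableOn.mul hr.differentiableOn_inv_P₁

theorem IsBranch.differentiableOn_q (hr : τ.IsBranch V r) : DifferentiableOn ℂ τ.q V := by
  simp only [funext_iff.2 fun z => show τ.q z = τ.S₂ z * (τ.P₂ z)⁻¹ from div_eq_mul_inv _ _]
  exact τ.differentiable_S₂.differentiableOn.mul hr.differentiableOn_inv_P₂

theorem IsBranch.differentiableOn_x (h : τ.Nondegenerate) (hr : τ.IsBranch V r) :
    DifferentiableOn ℂ (τ.x r) V := by
  have hp := hr.differentiableOn_p
  have hq := hr.differentiableOn_q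
  have hr' := hr.differentiableOn
  have h1 : DifferentiableOn ℂ (fun z => (τ.E + 1) * (τ.p z * τ.q z + 1) ^ 2) V := by fun_prop
  have h2 := h1.inv fun z hz =>
    mul_ne_zero h.E_add_one_ne (pow_ne_zero 2 (hr.one_add_pq_ne z hz))
  have h3 : DifferentiableOn ℂ (fun z => τ.E * (1 + τ.p z ^ 2 * τ.q z ^ 2)
    - (τ.p z ^ 2 + τ.q z ^ 2) - r z) V := by fun_prop
  exact (h3.mul h2).congr fun z _ => div_eq_mul_inv _ _

theorem IsBranch.fderiv_p (h : τ.Nondegenerate) (hr : τ.IsBranch V r) {z : ℂ × ℂ} (hz : z ∈ V)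
    (e : ℂ × ℂ) : HasDerivAt (fun s : ℂ => τ.p (z + s • e))
      ((evenν τ z * τ.ν e + evenμ τ z * τ.μ e) / τ.P₁ z ^ 2) 0 := by
  have h1 : HasDerivAt (fun s : ℂ => τ.S₁ (z + s • e)) _ 0 :=
    (τ.differentiable_S₁ z).hasFDerivAt.hasLineDerivAt e
  have h2 : HasDerivAt (fun s : ℂ => τ.P₁ (z + s • e)) _ 0 :=
    (τ.differentiable_P₁ z).hasFDerivAt.hasLineDerivAt e
  have h3 := h1.div h2 (by simpa using hr.P₁_ne z hz)
  refine h3.congr_deriv ?_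
  simp only [zero_smul, add_zero]
  rw [← h.wronskian₁]
  ring

theorem IsBranch.fderiv_q (h : τ.Nondegenerate) (hr : τ.IsBranch V r) {z : ℂ × ℂ} (hz : z ∈ V)
    (e : ℂ × ℂ) : HasDerivAt (fun s : ℂ => τ.q (z + s • e))
      ((evenν τ z * τ.ν e - evenμ τ z * τ.μ e) / τ.P₂ z ^ 2) 0 := by
  have h1 : HasDerivAt (fun s : ℂ => τ.S₂ (z + s • e)) _ 0 :=
    (τ.differentiable_S₂ z).hasFDerivAt.hasLineDerivAt e
  have h2 : HasDerivAt (fun s : ℂ => τ.P₂ (z + s • e)) _ 0 :=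
    (τ.differentiable_P₂ z).hasFDerivAt.hasLineDerivAt e
  have h3 := h1.div h2 (by simpa using hr.P₂_ne z hz)
  refine h3.congr_deriv ?_
  simp only [zero_smul, add_zero]
  rw [← h.wronskian₂]
  ring

theorem IsBranch.ΔSq_p_ne (hr : τ.IsBranch V r) {z : ℂ × ℂ} (hz : z ∈ V) :
    quarticΔ τ.E (τ.p z) ≠ 0 :=
  left_ne_zero_of_mul (b := τ.ΔSq (τ.q z)) (hr.sq_eq z hz ▸ pow_ne_zero 2 (hr.ne_zero z hz))

theorem IsBranch.fderiv_x (h : τ.Nondegenerate) (hr : τ.IsBranch V r) {z : ℂ × ℂ} (hz : z ∈ V)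
    (e : ℂ × ℂ) : fderiv ℂ (τ.x r) z e
      = 2 * derivNumerator τ.E (τ.p z) (τ.q z) (r z)
        / ((τ.E + 1) * (τ.p z * τ.q z + 1) ^ 3 * quarticΔ τ.E (τ.p z))
        * ((evenν τ z * τ.ν e + evenμ τ z * τ.μ e) / τ.P₁ z ^ 2
          - quarticΔ τ.E (τ.p z) / r z
            * ((evenν τ z * τ.ν e - evenμ τ z * τ.μ e) / τ.P₂ z ^ 2)) := by
  have hV : V ∈ nhds z := hr.isOpen.mem_nhds hz
  have h1 : HasDerivAt (fun s : ℂ => r (z + s • e)) _ 0 :=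
    (hr.differentiableOn.differentiableAt hV).hasFDerivAt.hasLineDerivAt e
  have h2 : HasDerivAt (fun s : ℂ => τ.x r (z + s • e)) _ 0 :=
    ((hr.differentiableOn_x h).differentiableAt hV).hasFDerivAt.hasLineDerivAt e
  have h3 : ∀ᶠ s in nhds (0 : ℂ), z + s • e ∈ V := by
    have hc : Continuous fun s : ℂ => z + s • e := by fun_prop
    exact (hc.continuousAt (x := 0)).eventually_mem (by simpa using hV)
  have := deriv_x_eq_of_hasDerivAt (hr.fderiv_p h hz e) (hr.fderiv_q h hz e) h1 h2
    (h3.mono fun s hs => hr.sq_eq _ hs) (h3.mono fun s hs => hr.mul_x h hs) h.E_add_one_ne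
  simp only [zero_smul, add_zero] at this
  exact this (hr.one_add_pq_ne z hz) (hr.ne_zero z hz) (hr.ΔSq_p_ne hz)

end Branch

end Period

/-! ### The normalising constants and the square root of f₅(x). -/

theorem sq_eq_of_coeff_sq {W d s r h E f l₁ l₁' l₂ K c B : ℂ} (hE : E + 1 ≠ 0) (hh : h ≠ 0)
    (hs : (E + 1) * h ^ 2 * s = -2 * r)
    (hW : W ^ 2 * r ^ 2 = -2 * (E ^ 2 - 1) * f * (B - r) * K * c * h ^ 2 * (l₁ * l₁'))
    (hB : (E + 1) * h ^ 2 * (l₂ * l₁') = d * (B - r)) :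
    (W * d * s) ^ 2 = f * l₁ * l₂ * (-8 * (E - 1) * (K * c * d) * l₁' ^ 2) := by
  refine mul_left_cancel₀ (pow_ne_zero 2 (mul_ne_zero hE (pow_ne_zero 2 hh))) ?_
  linear_combination W ^ 2 * d ^ 2 * ((E + 1) * h ^ 2 * s - 2 * r) * hs + 4 * d ^ 2 * hW
    + 8 * d * (E ^ 2 - 1) * f * K * c * h ^ 2 * (l₁ * l₁') * hB

namespace Period

variable {τ : Period}

/-- The normalizing constants of the differentials. -/
theorem Nondegenerate.exists_constants (h : τ.Nondegenerate) {K₃ : ℂ}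
    (hK₃ : K₃ ^ 2 * (64 * (τ.E ^ 2 - 1)) = 1) : ∃ κ₁ κ₂ : ℂ,
      κ₁ ^ 2 = 4 * (τ.b + τ.b₁) * ((1 - τ.E) * (1 - τ.E₁) / ((τ.F + 1) * (1 - τ.E₂))) ∧
      κ₂ ^ 2 = 4 * (τ.b - τ.b₁) * ((1 - τ.E) * (1 - τ.E₂) / ((τ.F - 1) * (1 - τ.E₁))) ∧
      κ₁ ≠ 0 ∧ κ₂ ≠ 0 ∧
      κ₁ ^ 2 = -8 * (τ.E - 1)
        * ((τ.b + τ.b₁) / (8 * (τ.E - τ.E₁)) * (τ.E₁ - 1) ^ 2 * (τ.m₁ - τ.m₂)) ∧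
      κ₂ * ((τ.b + τ.b₁) / (8 * (τ.E - τ.E₁)) * (τ.E₁ - 1) ^ 2 * (τ.m₁ - τ.m₂))
        = -4 * κ₁ * K₃ := by
  have hE := h.E_sub_one_ne
  have hE' := h.E_add_one_ne
  have hE₁ := h.E₁_sub_one_ne
  have hE₂ := h.E₂_sub_one_ne
  have hF := h.F_add_one_ne
  have hF' := h.F_sub_one_ne
  have hb := h.b_add_b₁_ne
  have hb' := h.b_sub_b₁_ne
  have hEE := h.E_sub_E₁_ne
  have hd : τ.m₁ - τ.m₂ ≠ 0 := sub_ne_zero.2 h.m₁_ne_m₂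
  have n1 : 1 - τ.E ≠ 0 := fun h0 => hE (by linear_combination -h0)
  have n2 : 1 - τ.E₁ ≠ 0 := fun h0 => hE₁ (by linear_combination -h0)
  have n3 : 1 - τ.E₂ ≠ 0 := fun h0 => hE₂ (by linear_combination -h0)
  have hK₃0 : K₃ ≠ 0 := fun h0 => by simp [h0] at hK₃
  set T₁ := 4 * (τ.b + τ.b₁) * ((1 - τ.E) * (1 - τ.E₁) / ((τ.F + 1) * (1 - τ.E₂))) with hT₁
  set T₂ := 4 * (τ.b - τ.b₁) * ((1 - τ.E) * (1 - τ.E₂) / ((τ.F - 1) * (1 - τ.E₁))) with hT₂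
  set G := (τ.b + τ.b₁) / (8 * (τ.E - τ.E₁)) * (τ.E₁ - 1) ^ 2 * (τ.m₁ - τ.m₂) with hG
  have hG0 : G ≠ 0 := mul_ne_zero (mul_ne_zero (div_ne_zero hb (mul_ne_zero (by norm_num) hEE))
    (pow_ne_zero 2 hE₁)) hd
  have hT₁0 : T₁ ≠ 0 := mul_ne_zero (mul_ne_zero (by norm_num) hb)
    (div_ne_zero (mul_ne_zero n1 n2) (mul_ne_zero hF n3))
  have h1 : T₁ = -8 * (τ.E - 1) * G := by
    have e1 : T₁ * ((τ.F + 1) * (1 - τ.E₂)) = 4 * (τ.b + τ.b₁) * ((1 - τ.E) * (1 - τ.E₁)) := by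
      rw [hT₁]; field_simp
    have e2 : G * (8 * (τ.E - τ.E₁)) = (τ.b + τ.b₁) * (τ.E₁ - 1) ^ 2 * (τ.m₁ - τ.m₂) := by
      rw [hG]; field_simp
    refine mul_right_cancel₀ (mul_ne_zero (mul_ne_zero hF n3) hEE) ?_
    linear_combination (τ.E - τ.E₁) * e1 + (τ.E - 1) * (τ.F + 1) * (1 - τ.E₂) * e2
      - (τ.E - 1) * (τ.F + 1) * (τ.b + τ.b₁) * (τ.E₁ - 1) * h.m₁_sub_m₂_mul
      - 2 * (τ.E - 1) * (τ.b + τ.b₁) * (τ.E₁ - 1) * h.E₂_sub_E₁_mul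
  -- E₁ and E₂ cancel in the product of the two prescribed squares, and the relation for (b + b₁)(b
  -- − b₁) eliminates F.
  have h2 : T₁ * T₂ * (τ.E + 1) = 16 * (τ.E - 1) := by
    have e1 : T₁ * T₂ * (τ.F ^ 2 - 1) = 16 * ((τ.b + τ.b₁) * (τ.b - τ.b₁)) * (1 - τ.E) ^ 2 := by
      rw [hT₁, hT₂]; field_simp; ring
    refine mul_right_cancel₀ h.F_sq_sub_one_ne ?_
    linear_combination (τ.E + 1) * e1 + 16 * (τ.E - 1) * h.b_add_mul_b_sub
  have h3 : T₂ * (G * (τ.E + 1)) = -2 := by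
    refine mul_left_cancel₀ hE ?_
    rw [h1] at h2
    linear_combination (-1 / 8 : ℂ) * h2
  -- κ₁ may be either root. κ₂ is then forced by the linear relation with K₃, and the condition on
  -- K₃² shows that it has the required square.
  obtain ⟨κ₁, hκ₁⟩ := IsAlgClosed.exists_pow_nat_eq T₁ two_pos
  have hκ₁0 : κ₁ ≠ 0 := fun h0 => hT₁0 (by rw [← hκ₁, h0]; ring)
  have hκ₂ : -4 * κ₁ * K₃ / G * G = -4 * κ₁ * K₃ := div_mul_cancel₀ _ hG0
  refine ⟨κ₁, -4 * κ₁ * K₃ / G, hκ₁, ?_, hκ₁0,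
    div_ne_zero (mul_ne_zero (mul_ne_zero (by norm_num) hκ₁0) hK₃0) hG0, hκ₁.trans h1, hκ₂⟩
  refine mul_right_cancel₀ (mul_ne_zero hG0 (mul_ne_zero hG0 hE')) ?_
  linear_combination (τ.E + 1) * (-4 * κ₁ * K₃ / G * G + -4 * κ₁ * K₃) * hκ₂
    + 16 * K₃ ^ 2 * (τ.E + 1) * (hκ₁.trans h1) - 2 * G * hK₃ - G * h3

section Branch

variable {V : Set (ℂ × ℂ)} {r : ℂ × ℂ → ℂ}

theorem IsBranch.one_sub_m₁_mul_x'_ne (hr : τ.IsBranch V r) {z : ℂ × ℂ} (hz : z ∈ V) :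
    1 - τ.m₁ * τ.x' r z ≠ 0 :=
  right_ne_zero_of_mul (left_ne_zero_of_mul (hr.f₅_x'_ne z hz))

theorem IsBranch.mul_x_sub_x' (h : τ.Nondegenerate) (hr : τ.IsBranch V r) {z : ℂ × ℂ}
    (hz : z ∈ V) : (τ.E + 1) * (τ.p z * τ.q z + 1) ^ 2 * (τ.x r z - τ.x' r z) = -2 * r z := by
  linear_combination hr.mul_x h hz - hr.mul_x' h hz

theorem IsBranch.x_sub_x'_ne (h : τ.Nondegenerate) (hr : τ.IsBranch V r) {z : ℂ × ℂ}
    (hz : z ∈ V) : τ.x r z - τ.x' r z ≠ 0 :=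
  right_ne_zero_of_mul (hr.mul_x_sub_x' h hz ▸ mul_ne_zero (by norm_num) (hr.ne_zero z hz))

/-- The Kummer quartic regrouped: its terms in P₁, S₁ alone and in P₂, S₂ alone are the values of
Δ², and the mixed terms form the right side. -/
theorem IsBranch.kummer (h : τ.Nondegenerate) (hr : τ.IsBranch V r) {z : ℂ × ℂ} (hz : z ∈ V) :
    τ.P₁ z ^ 4 * quarticΔ τ.E (τ.p z) + τ.P₂ z ^ 4 * quarticΔ τ.E (τ.q z)
      = 2 * (τ.P₁ z * τ.P₂ z) ^ 2 * (τ.F * (1 + τ.p z ^ 2 * τ.q z ^ 2)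
        - τ.C * (τ.p z ^ 2 + τ.q z ^ 2) + 2 * τ.D * (τ.p z * τ.q z)) := by
  have h1 := hr.P₁_ne z hz
  have h2 := hr.P₂_ne z hz
  have hk := h.kummer z
  rw [p, q, quarticΔ, quarticΔ]
  field_simp
  linear_combination hk

/-- The coefficient of `ν` in `dx`. -/
noncomputable def coeffν (τ : Period) (r : ℂ × ℂ → ℂ) (z : ℂ × ℂ) : ℂ :=
  2 * derivNumerator τ.E (τ.p z) (τ.q z) (r z)
    / ((τ.E + 1) * (τ.p z * τ.q z + 1) ^ 3 * quarticΔ τ.E (τ.p z))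
    * ((1 / τ.P₁ z ^ 2 - quarticΔ τ.E (τ.p z) / (r z * τ.P₂ z ^ 2)) * τ.evenν z)

theorem IsBranch.differentiableOn_coeffν (h : τ.Nondegenerate) (hr : τ.IsBranch V r) :
    DifferentiableOn ℂ (coeffν τ r) V := by
  have hp := hr.differentiableOn_p
  have hq := hr.differentiableOn_q
  have hr' := hr.differentiableOn
  have hν := τ.differentiable_evenν.differentiableOn (s := V)
  have h1 := hr.differentiableOn_inv_P₁
  have h2 := hr.differentiableOn_inv_P₂
  have h3 := hr.differentiableOn.inv hr.ne_zero
  have hΔ : DifferentiableOn ℂ (fun z => quarticΔ τ.E (τ.p z)) V := by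
    unfold quarticΔ
    fun_prop
  have hJ : DifferentiableOn ℂ (fun z => derivNumerator τ.E (τ.p z) (τ.q z) (r z)) V := by
    unfold derivNumerator quarticΔ
    fun_prop
  have h4 : DifferentiableOn ℂ (fun z => ((τ.E + 1) * (τ.p z * τ.q z + 1) ^ 3
      * quarticΔ τ.E (τ.p z))⁻¹) V := by
    refine DifferentiableOn.inv (by fun_prop) fun z hz => ?_
    exact mul_ne_zero (mul_ne_zero h.E_add_one_ne (pow_ne_zero 3 (hr.one_add_pq_ne z hz)))
      (hr.ΔSq_p_ne hz)
  have h5 : DifferentiableOn ℂ (fun z => 2 * derivNumerator τ.E (τ.p z) (τ.q z) (r z)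
      * ((τ.E + 1) * (τ.p z * τ.q z + 1) ^ 3 * quarticΔ τ.E (τ.p z))⁻¹
      * (((τ.P₁ z)⁻¹ ^ 2 - quarticΔ τ.E (τ.p z) * ((r z)⁻¹ * (τ.P₂ z)⁻¹ ^ 2)) * τ.evenν z)) V :=
    ((hJ.const_mul 2).mul h4).mul (((h1.pow 2).sub (hΔ.mul (h3.mul (h2.pow 2)))).mul hν)
  refine h5.congr fun z _ => ?_
  simp only [coeffν, div_eq_mul_inv, mul_inv, inv_pow, one_mul]

/-- The square root of `f₅(x)` for which the inversion system holds. -/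
theorem IsBranch.exists_sqrt (h : τ.Nondegenerate) (hr : τ.IsBranch V r) {K₃ κ₁ κ₂ : ℂ}
    (hK₃ : ∀ z, τ.evenν z * τ.evenμ z = K₃ *
      ((τ.P₂ z ^ 4 - 2 * τ.E * τ.P₂ z ^ 2 * τ.S₂ z ^ 2 + τ.S₂ z ^ 4)
        - (τ.P₁ z ^ 4 - 2 * τ.E * τ.P₁ z ^ 2 * τ.S₁ z ^ 2 + τ.S₁ z ^ 4)))
    (hκ₁0 : κ₁ ≠ 0)
    (hκ₁ : κ₁ ^ 2 = -8 * (τ.E - 1)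
        * ((τ.b + τ.b₁) / (8 * (τ.E - τ.E₁)) * (τ.E₁ - 1) ^ 2 * (τ.m₁ - τ.m₂)))
    (hκ₂ : κ₂ * ((τ.b + τ.b₁) / (8 * (τ.E - τ.E₁)) * (τ.E₁ - 1) ^ 2 * (τ.m₁ - τ.m₂))
        = -4 * κ₁ * K₃) :
    ∃ y : ℂ × ℂ → ℂ, DifferentiableOn ℂ y V ∧ ∀ z ∈ V, y z ≠ 0 ∧ y z ^ 2 = τ.f₅ (τ.x r z) ∧
      ∀ e, (τ.m₁ - τ.m₂) * (τ.x r z - τ.x' r z) * fderiv ℂ (τ.x r) z e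
        = y z * ((1 - τ.m₁ * τ.x' r z) * (κ₁ * τ.ν e)
          - (1 - τ.m₂ * τ.x' r z) * (κ₂ * τ.μ e)) := by
  have hd : τ.m₁ - τ.m₂ ≠ 0 := sub_ne_zero.2 h.m₁_ne_m₂
  -- The choice is dictated by the coefficient of ν in the required formula for dx; κ₁ and 1 − m₁x'
  -- are invertible.
  refine ⟨fun z => coeffν τ r z * (τ.m₁ - τ.m₂) * (τ.x r z - τ.x' r z)
    * (κ₁ * (1 - τ.m₁ * τ.x' r z))⁻¹, ?_, fun z hz => ?_⟩
  · have h1 := hr.differentiableOn_coeffν h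
    have h2 := hr.differentiableOn_x h
    have h3 : DifferentiableOn ℂ (τ.x' r) V := by
      rw [← x_neg]
      exact hr.neg.differentiableOn_x h
    have h4 : DifferentiableOn ℂ (fun z => (κ₁ * (1 - τ.m₁ * τ.x' r z))⁻¹) V :=
      DifferentiableOn.inv (by fun_prop) fun z hz =>
        mul_ne_zero hκ₁0 (hr.one_sub_m₁_mul_x'_ne hz)
    fun_prop
  have hE := h.E_add_one_ne
  have hh := hr.one_add_pq_ne z hz
  have hΔ := hr.ΔSq_p_ne hz
  have hr0 := hr.ne_zero z hz
  have hP₁ := hr.P₁_ne z hz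
  have hP₂ := hr.P₂_ne z hz
  have hsq : r z ^ 2 = quarticΔ τ.E (τ.p z) * quarticΔ τ.E (τ.q z) := hr.sq_eq z hz
  have hx := hr.mul_x h hz
  have hx' := hr.mul_x' h hz
  have hxx' := hr.mul_x_mul_x' h hz
  have hk := hr.kummer h hz
  have hJ := derivNumerator_sq hsq h.m_mul hx
  have hg := one_sub_mul_one_sub h.m₁_mul hx hx' hxx'
  have hB := one_sub_mul_one_sub' h.m₁_mul h.m₂_mul h.E₁_sub_one_ne h.E₂_sub_one_ne h.F_eq h.C_eq
    h.D_eq hx hx' hxx'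
  -- The same identity with x and x' exchanged, which means r replaced by −r.
  have hB' := one_sub_mul_one_sub' (r := -r z) h.m₁_mul h.m₂_mul h.E₁_sub_one_ne h.E₂_sub_one_ne
    h.F_eq h.C_eq h.D_eq (by rw [hx']; ring) (by rw [hx]; ring)
    (by rw [mul_comm (τ.x' r z)]; exact hxx')
  rw [sub_neg_eq_add] at hB'
  have hA : τ.evenν z ^ 2 = (τ.b + τ.b₁) / (8 * (τ.E - τ.E₁)) / 2 * (τ.P₁ z * τ.P₂ z) ^ 2
      * ((τ.E₁ - 1) ^ 2 * (τ.E + 1) * (τ.p z * τ.q z + 1) ^ 2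
        * ((1 - τ.m₁ * τ.x r z) * (1 - τ.m₁ * τ.x' r z))) := by
    rw [h.evenν_sq, hg, p, q]
    have := h.E_sub_E₁_ne
    field_simp
  have hAA' : τ.evenν z * τ.evenμ z = K₃ * (τ.P₂ z ^ 4 * quarticΔ τ.E (τ.q z)
      - τ.P₁ z ^ 4 * quarticΔ τ.E (τ.p z)) := by
    rw [hK₃, p, q, quarticΔ, quarticΔ]
    field_simp
  have hl' := hr.one_sub_m₁_mul_x'_ne hz
  have hxsub := hr.mul_x_sub_x' h hz
  have hx0 := hr.x_sub_x'_ne h hz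
  set W := coeffν τ r z with hW
  have hWsq := coeff_sq hE hh hΔ hr0 hP₁ hP₂ hsq hW hJ hA hk
  have hy : (W * (τ.m₁ - τ.m₂) * (τ.x r z - τ.x' r z)
      * (κ₁ * (1 - τ.m₁ * τ.x' r z))⁻¹) ^ 2 = τ.f₅ (τ.x r z) := by
    rw [← div_eq_mul_inv, div_pow, div_eq_iff (pow_ne_zero 2 (mul_ne_zero hκ₁0 hl')), f₅, mul_pow κ₁,
      hκ₁]
    exact sq_eq_of_coeff_sq hE hh hxsub hWsq hB
  have hW0 : W ≠ 0 := fun h0 => hr.f₅_x_ne z hz (by rw [← hy, h0]; ring)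
  refine ⟨mul_ne_zero (mul_ne_zero (mul_ne_zero hW0 hd) hx0)
    (inv_ne_zero (mul_ne_zero hκ₁0 hl')), hy, fun e => ?_⟩
  obtain ⟨c, hc, he⟩ : ∃ c, c * (κ₁ * (1 - τ.m₁ * τ.x' r z)) = -κ₂ * (1 - τ.m₂ * τ.x' r z) * W ∧
      fderiv ℂ (τ.x r) z e = W * τ.ν e + c * τ.μ e := by
    refine ⟨_, coeff_relation (A' := τ.evenμ z) hE hh hΔ hr0 hP₁ hP₂ hsq hW rfl hA hAA' hk hB'
      (by linear_combination hκ₂) hW0, ?_⟩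
    rw [hr.fderiv_x h hz, hW, coeffν]
    ring
  have hN := inv_mul_cancel₀ (mul_ne_zero hκ₁0 hl')
  beta_reduce
  rw [he, ← hW]
  generalize (κ₁ * (1 - τ.m₁ * τ.x' r z))⁻¹ = N at hN
  linear_combination (τ.m₁ - τ.m₂) * (τ.x r z - τ.x' r z) * (N * τ.μ e * hc
    - (W * τ.ν e + c * τ.μ e) * hN)

end Branch

end Period

/-! ### The inversion systems in both coordinates. -/

theorem div_mul_add_div_mul_eq {d x x' y y' dx dx' A A' g g' ω : ℂ} (hd : d ≠ 0) (hs : x - x' ≠ 0)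
    (hy : y ≠ 0) (hy' : y' ≠ 0) (h : d * (x - x') * dx = y * A) (h' : d * (x' - x) * dx' = y' * A')
    (hω : g * A - g' * A' = d * (x - x') * ω) : g / y * dx + g' / y' * dx' = ω := by
  rw [div_mul_eq_mul_div, div_mul_eq_mul_div, div_add_div _ _ hy hy',
    div_eq_iff (mul_ne_zero hy hy')]
  refine mul_left_cancel₀ (mul_ne_zero hd hs) ?_
  linear_combination g * y' * h - y * g' * h' + y * y' * hω

namespace Period

variable {τ : Period} {V : Set (ℂ × ℂ)} {r : ℂ × ℂ → ℂ} {κ₁ κ₂ : ℂ}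

theorem IsBranch.differentiableOn_x' (h : τ.Nondegenerate) (hr : τ.IsBranch V r) :
    DifferentiableOn ℂ (τ.x' r) V :=
  τ.x_neg r ▸ hr.neg.differentiableOn_x h

theorem IsBranch.solvesInversion (h : τ.Nondegenerate) (hr : τ.IsBranch V r) {K₃ : ℂ}
    (hK₃ : ∀ z, τ.evenν z * τ.evenμ z = K₃ *
      ((τ.P₂ z ^ 4 - 2 * τ.E * τ.P₂ z ^ 2 * τ.S₂ z ^ 2 + τ.S₂ z ^ 4)
        - (τ.P₁ z ^ 4 - 2 * τ.E * τ.P₁ z ^ 2 * τ.S₁ z ^ 2 + τ.S₁ z ^ 4)))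
    (hκ₁0 : κ₁ ≠ 0)
    (hκ₁ : κ₁ ^ 2 = -8 * (τ.E - 1)
        * ((τ.b + τ.b₁) / (8 * (τ.E - τ.E₁)) * (τ.E₁ - 1) ^ 2 * (τ.m₁ - τ.m₂)))
    (hκ₂ : κ₂ * ((τ.b + τ.b₁) / (8 * (τ.E - τ.E₁)) * (τ.E₁ - 1) ^ 2 * (τ.m₁ - τ.m₂))
        = -4 * κ₁ * K₃) :
    SolvesInversion τ.f₅ ![fun x => 1 - τ.m₂ * x, fun x => 1 - τ.m₁ * x]
      ![κ₁ • τ.ν, κ₂ • τ.μ] V (τ.x r) (τ.x' r) := by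
  obtain ⟨y, hyd, hy⟩ := hr.exists_sqrt h hK₃ hκ₁0 hκ₁ hκ₂
  obtain ⟨y', hyd', hy'⟩ := hr.neg.exists_sqrt h hK₃ hκ₁0 hκ₁ hκ₂
  simp only [x_neg, x'_neg] at hy'
  refine ⟨hr.differentiableOn_x h, hr.differentiableOn_x' h, y, y', hyd, hyd', fun z hz => ?_⟩
  obtain ⟨h0, h1, h2⟩ := hy z hz
  obtain ⟨h0', h1', h2'⟩ := hy' z hz
  have hd : τ.m₁ - τ.m₂ ≠ 0 := sub_ne_zero.2 h.m₁_ne_m₂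
  have hs := hr.x_sub_x'_ne h hz
  refine ⟨h0, h0', h1, h1', fun i => ContinuousLinearMap.ext fun e => ?_⟩
  fin_cases i
  -- Interpolation: (1 − m₂x)(1 − m₁x') − (1 − m₂x')(1 − m₁x) = (m₁ − m₂)(x − x'), while the terms
  -- in μ cancel. In the second equation the terms in ν cancel instead.
  · exact div_mul_add_div_mul_eq hd hs h0 h0' (h2 e) (h2' e) (by
      simp only [Fin.zero_eta, Matrix.cons_val_zero, _root_.smul_apply, smul_eq_mul]
      ring)
  · exact div_mul_add_div_mul_eq hd hs h0 h0' (h2 e) (h2' e) (by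
      simp only [Fin.mk_one, Matrix.cons_val_one, Matrix.cons_val_zero, _root_.smul_apply,
        smul_eq_mul]
      ring)

/-- The coordinates `(U₁, U₂)` as functions of `(u, v)`. -/
theorem Nondegenerate.exists_coordinates (h : τ.Nondegenerate) (hκ₁ : κ₁ ≠ 0) (hκ₂ : κ₂ ≠ 0) :
    ∃ L : (ℂ × ℂ) ≃L[ℂ] (ℂ × ℂ),
      ∀ z, L z = ((τ.m₁ * (κ₁ * τ.ν z) - τ.m₂ * (κ₂ * τ.μ z)) / (τ.m₁ - τ.m₂),
        (κ₁ * τ.ν z - κ₂ * τ.μ z) / (τ.m₁ - τ.m₂)) := by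
  have hd : τ.m₁ - τ.m₂ ≠ 0 := sub_ne_zero.2 h.m₁_ne_m₂
  let L₀ : ℂ × ℂ →L[ℂ] ℂ × ℂ :=
    ((τ.m₁ - τ.m₂)⁻¹ • (τ.m₁ • κ₁ • τ.ν - τ.m₂ • κ₂ • τ.μ)).prod
      ((τ.m₁ - τ.m₂)⁻¹ • (κ₁ • τ.ν - κ₂ • τ.μ))
  have hL₀ : ∀ z, L₀ z = ((τ.m₁ * (κ₁ * τ.ν z) - τ.m₂ * (κ₂ * τ.μ z)) / (τ.m₁ - τ.m₂),
      (κ₁ * τ.ν z - κ₂ * τ.μ z) / (τ.m₁ - τ.m₂)) := fun z => by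
    simp [L₀, div_eq_inv_mul]
  -- A kernel vector is killed by both μ and ν, because m₁ ≠ m₂ and κ₁, κ₂ ≠ 0.
  have hinj : Function.Injective (L₀ : ℂ × ℂ →ₗ[ℂ] ℂ × ℂ) := by
    rw [← LinearMap.ker_eq_bot, LinearMap.ker_eq_bot']
    intro z hz
    have hz' : L₀ z = 0 := hz
    rw [hL₀, Prod.mk_eq_zero, div_eq_zero_iff, div_eq_zero_iff] at hz'
    have h1 := hz'.1.resolve_right hd
    have h2 := hz'.2.resolve_right hd
    have h3 : (τ.m₁ - τ.m₂) * κ₁ * τ.ν z = 0 := by linear_combination h1 - τ.m₂ * h2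
    have h4 : (τ.m₁ - τ.m₂) * κ₂ * τ.μ z = 0 := by linear_combination h1 - τ.m₁ * h2
    exact h.eq_zero_of_forms ((mul_eq_zero.1 h3).resolve_left (mul_ne_zero hd hκ₁))
      ((mul_eq_zero.1 h4).resolve_left (mul_ne_zero hd hκ₂))
  exact ⟨(LinearEquiv.ofInjectiveEndo _ hinj).toContinuousLinearEquiv, fun z => hL₀ z⟩

/-- The inversion system in the coordinates `(U₁, U₂)`. -/
theorem solvesInversion_coordinates {L : (ℂ × ℂ) ≃L[ℂ] (ℂ × ℂ)} {f : ℂ → ℂ} {m₁ m₂ : ℂ}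
    {ω₁ ω₂ : ℂ × ℂ →L[ℂ] ℂ} {X X' : ℂ × ℂ → ℂ} (hm : m₁ ≠ m₂)
    (hL : ∀ z, L z = ((m₁ * ω₁ z - m₂ * ω₂ z) / (m₁ - m₂), (ω₁ z - ω₂ z) / (m₁ - m₂)))
    (h : SolvesInversion f ![fun x => 1 - m₂ * x, fun x => 1 - m₁ * x] ![ω₁, ω₂] V X X') :
    SolvesInversion f ![fun _ => 1, fun x => x]
      ![ContinuousLinearMap.fst ℂ ℂ ℂ, ContinuousLinearMap.snd ℂ ℂ ℂ] (L '' V)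
      (fun U => X (L.symm U)) (fun U => X' (L.symm U)) := by
  obtain ⟨hX, hX', y, y', hy, hy', hsol⟩ := h
  have hmaps : Set.MapsTo L.symm (L '' V) V := by
    rintro _ ⟨z, hz, rfl⟩
    rwa [L.symm_apply_apply]
  have hcomp : ∀ {g : ℂ × ℂ → ℂ}, DifferentiableOn ℂ g V →
      DifferentiableOn ℂ (fun U => g (L.symm U)) (L '' V) := fun hg =>
    hg.comp L.symm.differentiable.differentiableOn hmaps
  refine ⟨hcomp hX, hcomp hX', _, _, hcomp hy, hcomp hy', fun U hU => ?_⟩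
  have hz := hmaps hU
  obtain ⟨h0, h0', h1, h1', h2⟩ := hsol _ hz
  refine ⟨h0, h0', h1, h1', fun i => ContinuousLinearMap.ext fun e => ?_⟩
  have hd : m₁ - m₂ ≠ 0 := sub_ne_zero.2 hm
  have e1 := congrArg (fun φ : ℂ × ℂ →L[ℂ] ℂ => φ (L.symm e)) (h2 0)
  have e2 := congrArg (fun φ : ℂ × ℂ →L[ℂ] ℂ => φ (L.symm e)) (h2 1)
  have e3 := hL (L.symm e)
  rw [L.apply_symm_apply] at e3
  have f1 : fderiv ℂ (fun U => X (L.symm U)) U = _ := L.symm.comp_right_fderiv (f := X)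
  have f2 : fderiv ℂ (fun U => X' (L.symm U)) U = _ := L.symm.comp_right_fderiv (f := X')
  rw [f1, f2]
  simp only [Matrix.cons_val_zero, Matrix.cons_val_one, _root_.add_apply, _root_.smul_apply,
    smul_eq_mul] at e1 e2
  have k1 := congrArg Prod.fst e3
  have k2 := congrArg Prod.snd e3
  rw [eq_div_iff hd] at k1 k2
  refine mul_right_cancel₀ hd ?_
  -- The new numerators arise from m₁(1 − m₂x) − m₂(1 − m₁x) = m₁ − m₂ and (1 − m₂x) − (1 − m₁x) =
  -- (m₁ − m₂)x.
  fin_cases i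
  · simp only [Fin.zero_eta, Matrix.cons_val_zero, _root_.add_apply, _root_.smul_apply, smul_eq_mul,
      ContinuousLinearMap.comp_apply, ContinuousLinearEquiv.coe_coe, ContinuousLinearMap.coe_fst']
    linear_combination m₁ * e1 - m₂ * e2 - k1
  · simp only [Fin.mk_one, Matrix.cons_val_one, Matrix.cons_val_zero, _root_.add_apply,
      _root_.smul_apply, smul_eq_mul, ContinuousLinearMap.comp_apply,
      ContinuousLinearEquiv.coe_coe, ContinuousLinearMap.coe_snd']
    linear_combination e1 - e2 - k2

theorem IsBranch.x_add_x' (h : τ.Nondegenerate) (hr : τ.IsBranch V r) {z : ℂ × ℂ} (hz : z ∈ V) :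
    τ.x r z + τ.x' r z = 2 * (τ.E * (1 + τ.p z ^ 2 * τ.q z ^ 2) - (τ.p z ^ 2 + τ.q z ^ 2))
      / ((τ.E + 1) * (τ.p z * τ.q z + 1) ^ 2) := by
  rw [eq_div_iff (mul_ne_zero h.E_add_one_ne (pow_ne_zero 2 (hr.one_add_pq_ne z hz)))]
  linear_combination hr.mul_x h hz + hr.mul_x' h hz

end Period

theorem mainTheorem1 (τ : Period) (hτ : τ.Nondegenerate) :
    -- the roots of `f₅` are simple, so that `y² = f₅(x)` has genus two
    ((τ.m ≠ 0 ∧ τ.m₁ ≠ 0 ∧ τ.m₂ ≠ 0) ∧ (τ.m ≠ 1 ∧ τ.m₁ ≠ 1 ∧ τ.m₂ ≠ 1) ∧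
      (τ.m ≠ τ.m₁ ∧ τ.m ≠ τ.m₂ ∧ τ.m₁ ≠ τ.m₂)) ∧
    ∃ κ₁ κ₂ : ℂ,
      κ₁ ^ 2 = 4 * (τ.b + τ.b₁) * ((1 - τ.E) * (1 - τ.E₁) / ((τ.F + 1) * (1 - τ.E₂))) ∧
      κ₂ ^ 2 = 4 * (τ.b - τ.b₁) * ((1 - τ.E) * (1 - τ.E₂) / ((τ.F - 1) * (1 - τ.E₁))) ∧
      ∃ L : (ℂ × ℂ) ≃L[ℂ] (ℂ × ℂ),
        -- the coordinates `(U₁, U₂)` as linear functions of `(u, v)`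
        (∀ z, L z = ((τ.m₁ * (κ₁ * τ.ν z) - τ.m₂ * (κ₂ * τ.μ z)) / (τ.m₁ - τ.m₂),
          (κ₁ * τ.ν z - κ₂ * τ.μ z) / (τ.m₁ - τ.m₂))) ∧
        ∀ (V : Set (ℂ × ℂ)) (r : ℂ × ℂ → ℂ), τ.IsBranch V r →
          SolvesInversion τ.f₅ ![fun x => 1 - τ.m₂ * x, fun x => 1 - τ.m₁ * x]
            ![κ₁ • τ.ν, κ₂ • τ.μ] V (τ.x r) (τ.x' r) ∧
          SolvesInversion τ.f₅ ![fun _ => 1, fun x => x]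
            ![ContinuousLinearMap.fst ℂ ℂ ℂ, ContinuousLinearMap.snd ℂ ℂ ℂ] (L '' V)
            (fun U => τ.x r (L.symm U)) (fun U => τ.x' r (L.symm U)) ∧
          ∀ U ∈ L '' V, ∀ p q : ℂ, p = τ.p (L.symm U) → q = τ.q (L.symm U) →
            wp₂₂ (fun U => τ.x r (L.symm U)) (fun U => τ.x' r (L.symm U)) U
                = 2 * (τ.E * (1 + p ^ 2 * q ^ 2) - (p ^ 2 + q ^ 2))
                    / ((τ.E + 1) * (p * q + 1) ^ 2) ∧
            wp₂₂ (fun U => τ.x r (L.symm U)) (fun U => τ.x' r (L.symm U)) U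
                = 2 * τ.E / (τ.E + 1)
                    - 2 * (p ^ 2 + q ^ 2 + 2 * τ.E * p * q) / ((τ.E + 1) * (1 + p * q) ^ 2) ∧
            wp₁₂ (fun U => τ.x r (L.symm U)) (fun U => τ.x' r (L.symm U)) U
                = -(τ.E - 1) / (τ.E + 1)
                    + 4 * (τ.E - 1) * p * q / ((τ.E + 1) * (1 + p * q) ^ 2) := by
  refine ⟨hτ.m_simple, ?_⟩
  -- The constant K₃ inferred here is the one in `evenν_mul_evenμ`; sharing it makes the signs of κ₁
  -- and κ₂ compatible.
  obtain ⟨κ₁, κ₂, h1, h2, h3, h4, h5, h6⟩ := hτ.exists_constants hτ.K_sq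
  obtain ⟨L, hL⟩ := hτ.exists_coordinates h3 h4
  refine ⟨κ₁, κ₂, h1, h2, L, hL, fun V r hr => ?_⟩
  have hsol := hr.solvesInversion hτ hτ.evenν_mul_evenμ h3 h5 h6
  refine ⟨hsol, Period.solvesInversion_coordinates hτ.m₁_ne_m₂ hL hsol, ?_⟩
  rintro _ ⟨z, hz, rfl⟩ p q rfl rfl
  simp only [wp₂₂, wp₁₂, L.symm_apply_apply, add_comm (1 : ℂ) (τ.p z * τ.q z)]
  have hE := hτ.E_add_one_ne
  have hpq := hr.one_add_pq_ne z hz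
  refine ⟨hr.x_add_x' hτ hz, ?_, ?_⟩
  · rw [hr.x_add_x' hτ hz]
    field_simp
    ring
  · have hxx' := hr.mul_x_mul_x' hτ hz
    refine mul_left_cancel₀ (mul_ne_zero hE (pow_ne_zero 2 hpq)) ?_
    rw [mul_neg, hxx']
    field_simp
    ring
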